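/- **Setting.** A dataset is a finite set of pairs (key, val) with $\mathrm{val}\in\mathbb{R}^d$; $\mathcal{A}.\mathrm{vals}$ is the matrix whose rows are the values of the items of $\mathcal{A}$. Let $G=(V,E)$ be an arbitrary finite simple undirected graph with $|V|=s$. Each node $u$ holds a dataset $\mathcal{S}_u$, and the datasets are conforming: a key never occurs with two different values. Let $\mathcal{S}_u^{\le\Delta}=\bigcup_{v:\,\mathrm{dist}(u,v)\le\Delta}\mathcal{S}_v$ (every item is counted once). A matrix $M$ is an $\varepsilon$ $\ell_p$-subspace embedding of $A$ if $(1-\varepsilon)\|Ax\|_p^p\le\|Mx\|_p^p\le(1+\varepsilon)\|Ax\|_p^p$ for all $x\in\mathbb{R}^d$. The $\ell_p$ sensitivity of a vector $a$ w.r.t. $A$ is $\tau_A(a)=\sup_{x:Ax\ne0}|\langle a,x\rangle|^p/\|Ax\|_p^p\in[0,\infty]$. **Sketches.** All nodes share independent fully random hash functions $h_1,h_2,\dots$ from keys to $[0,1]$. A sketch with $t$ copies is a list of $t$ sets (samples) of triples $(\mathrm{key},\mathrm{val},\mathrm{prob})$; its number of rows is the total number of triples. Fix an oversampling factor $\kappa$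 and $T=\Delta+2$. * *Create.* For a dataset $\mathcal{A}$ put $p_{\mathrm{key}}=\kappa(1+\varepsilon)^T\tau_{\mathcal{A}.\mathrm{vals}}(\mathrm{val})$. For $1\le j\le T$, the $j$-th sample is $\{(\mathrm{key},\mathrm{val},\min(1,p_{\mathrm{key}})) : (\mathrm{key},\mathrm{val})\in\mathcal{A},\ h_j(\mathrm{key})\le p_{\mathrm{key}}\}$. * *Merge.* Given several sketches, let $t$ be their least number of copies ($t=T$ if no sketch is given). Let $R_j$ be the union of their $j$-th samples, and for an item occurring in $R_j$ let $p^{(j)}_{\mathrm{key}}$ be the largest probability stored for it in $R_j$. Let $M$ have the rows $(1/p^{(t)}_{\mathrm{key}})^{1/p}\,\mathrm{val}$, for the items of $R_t$. Put $p_{\mathrm{key}}=\kappa(1+\varepsilon)^{t-1}(1+\varepsilon/4)\,\tau_M(\mathrm{val})$. If $\min(1,p_{\mathrm{key}})>p^{(j)}_{\mathrm{key}}$ for some item of some $R_j$, $1\le j\le t-1$, the result is FAIL. Otherwise it is the sketch with $t-1$ copies whose $j$-th sample is $\{(\mathrm{key},\mathrm{val},\min(1,p_{\mathrm{key}})) :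 (\mathrm{key},\mathrm{val})\text{ occurs in }R_j,\ h_j(\mathrm{key})\le p_{\mathrm{key}}\}$. Merging with a FAIL gives FAIL. * *Solve.* Output the matrix with rows $(1/\mathrm{prob})^{1/p}\,\mathrm{val}$ for the triples of the first sample. **Neighborhood propagation.** Each node $u$ creates $\mathrm{sk}^0_u$ from $\mathcal{S}_u$. In round $i=1,\dots,\Delta$ every node sends $\mathrm{sk}^{i-1}_u$ to all its neighbors (FAIL has no rows), and forms $\mathrm{sk}^i_u$ by merging the sketches received from its neighbors. At the end $u$ merges $\mathrm{sk}^0_u,\dots,\mathrm{sk}^\Delta_u$ and applies Solve. **Theorem.** Let $\delta=\frac{1}{10s}(2s)^{-\Delta}$. 1. For every real $p\ge1$ there are constants $C,K>0$, depending only on $p$, such that for every such $G$, all conforming datasets, every $d$, every integer $\Delta\ge1$ and every $0<\varepsilon<1/\Delta$, the algorithm with $\kappa=C(d\log d+\log(1/\delta))\varepsilon^{-2}$ satisfies, with probability at least $9/10$: every node $u$ outputs an $\varepsilon$ $\ell_p$-subspace embedding of $\mathcal{S}_u^{\le\Delta}.\mathrm{vals}$, and in each of the $\Delta$ rounds every node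 sends to each of its neighbors at most $K\,\Delta\,d^{\max(p/2,1)}(d\log d+\Delta\log s)\varepsilon^{-2}$ rows (each with its key and probability). 2. For $p=2$ there are absolute constants $C,K>0$ such that the same holds for the algorithm with $\kappa=C(\log d+\log(1/\delta))\varepsilon^{-2}$ and at most $K\,\Delta\,d(\log d+\Delta\log s)\varepsilon^{-2}$ rows. (Here $0\log 0=\log 0=0$ if $d=0$.) -/

import Mathlib

open MeasureTheory
open scoped NNReal ENNReal Matrix

noncomputable section

namespace PersonalizedCongest

/-! ### Subspace embeddings and sensitivities -/

/-- `‖y‖_p ^ p` for a real vector with finitely many coordinates `y`. -/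
def lpPow (p : ℝ) {n : Type*} [Fintype n] (y : n → ℝ) : ℝ :=
  ∑ i, |y i| ^ p

/-- `M` is an `ε` `ℓ_p`-subspace embedding of `A`: `‖M x‖_p^p = (1 ± ε) ‖A x‖_p^p` for all `x`. -/
def IsSubspaceEmbedding (p ε : ℝ) {d : ℕ} {m n : Type*} [Fintype m] [Fintype n]
    (M : Matrix m (Fin d) ℝ) (A : Matrix n (Fin d) ℝ) : Prop :=
  ∀ x : Fin d → ℝ,
    (1 - ε) * lpPow p (A *ᵥ x) ≤ lpPow p (M *ᵥ x) ∧
      lpPow p (M *ᵥ x) ≤ (1 + ε) * lpPow p (A *ᵥ x)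

/-- The `ℓ_p` sensitivity of the vector `a` with respect to the matrix `A`,
`sup {|⟨a, x⟩|^p / ‖A x‖_p^p : A x ≠ 0}`. If `a` is a row of `A` it is at most `1`; for other
vectors it may be infinite, and so it is taken in `[0, ∞]`. -/
def sensitivity (p : ℝ) {d : ℕ} {n : Type*} [Fintype n]
    (A : Matrix n (Fin d) ℝ) (a : Fin d → ℝ) : ℝ≥0∞ :=
  ⨆ (x : Fin d → ℝ) (_ : A *ᵥ x ≠ 0), ENNReal.ofReal (|a ⬝ᵥ x| ^ p / lpPow p (A *ᵥ x))

/-! ### Datasets -/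

/-- A dataset is a finite set of pairs `(key, val)` with `val ∈ ℝ^d`. -/
abbrev Dataset (Key : Type*) (d : ℕ) := Finset (Key × (Fin d → ℝ))

/-- The matrix whose rows are the values of the items of the dataset. -/
def Dataset.vals {Key : Type*} {d : ℕ} (A : Dataset Key d) : Matrix A (Fin d) ℝ :=
  fun item j => item.1.2 j

/-- A family of datasets is conforming if a key never occurs with two different values, neither in
two datasets of the family nor in one of them. -/
def Conforming {V Key : Type*} {d : ℕ} (S : V → Dataset Key d) : Prop :=
  ∀ u v : V, ∀ k : Key, ∀ a b : Fin d → ℝ, (k, a) ∈ S u → (k, b) ∈ S v → a = b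

open Classical in
/-- The union (every item is counted once) of the datasets held by the vertices at distance at most
`Δ` from `u`. -/
def neighborhoodData {V Key : Type*} [Fintype V] {d : ℕ} (G : SimpleGraph V)
    (S : V → Dataset Key d) (Δ : ℕ) (u : V) : Dataset Key d :=
  (Finset.univ.filter fun v => G.edist u v ≤ (Δ : ℕ∞)).biUnion S

/-! ### The composable sketch -/

/-- A sampled item together with the probability with which it was sampled. -/
structure SampledRow (Key : Type*) (d : ℕ) where
  key : Key
  val : Fin d → ℝ
  prob : ℝ≥0

/-- The matrix whose rows are `(1 / prob)^(1/p) • val` for the sampled rows `(key, val, prob)`. -/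
def rescaledMatrix (p : ℝ) {Key : Type*} {d : ℕ} (R : Finset (SampledRow Key d)) :
    Matrix R (Fin d) ℝ :=
  fun r j => (1 / (r.1.prob : ℝ)) ^ (1 / p) * r.1.val j

/-- A sketch that consists of `copies` samples `sample 1, …, sample copies`. -/
structure Sketch (Key : Type*) (d : ℕ) where
  copies : ℕ
  sample : ℕ → Finset (SampledRow Key d)

/-- The number of rows of a sketch. -/
def Sketch.rows {Key : Type*} {d : ℕ} (sk : Sketch Key d) : ℕ :=
  ∑ j ∈ Finset.Icc 1 sk.copies, (sk.sample j).card

/-- The values of all hash functions: `h (j, key)` is the value of the `j`-th one at `key`. -/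
abbrev Hashes (Key : Type*) := ℕ × Key → unitInterval

/-- Independent fully random hash functions: all the values `h (j, key)` are independent and
uniform on `[0, 1]`. -/
def hashLaw (Key : Type*) : Measure (Hashes Key) :=
  Measure.infinitePi fun _ => (volume : Measure unitInterval)

/-- Parameters of the sketch: the exponent `p`, the accuracy `ε`, the oversampling factor `κ` by
which approximate sensitivities are multiplied to give sampling probabilities, and the number
`copies` of samples in a newly created sketch. -/
structure SketchParams where
  p : ℝ
  ε : ℝ
  κ : ℝ
  copies : ℕ

variable {Key : Type*} {d : ℕ}

open Classical in
/-- Creation of the sketch of a dataset `A` with `t = P.copies` samples. The item `(key, val)` has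
the sampling value `p_key = κ (1 + ε)^t τ`, where `τ` is the sensitivity of `val` with respect to
`A.vals`; it is in the `j`-th sample if `h_j(key) ≤ p_key`, and is stored together with
`min(1, p_key)`. -/
def Sketch.create (P : SketchParams) (h : Hashes Key) (A : Dataset Key d) : Sketch Key d where
  copies := P.copies
  sample j :=
    let pKey : (Fin d → ℝ) → ℝ≥0∞ := fun a =>
      ENNReal.ofReal (P.κ * (1 + P.ε) ^ P.copies) * sensitivity P.p A.vals a
    if j ∈ Finset.Icc 1 P.copies then
      (A.filter fun item => ENNReal.ofReal (h (j, item.1) : ℝ) ≤ pKey item.2).image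
        fun item => ⟨item.1, item.2, (min 1 (pKey item.2)).toNNReal⟩
    else ∅

open Classical in
/-- The union of the `j`-th samples of several sketches. -/
def pooled (l : Multiset (Sketch Key d)) (j : ℕ) : Finset (SampledRow Key d) :=
  l.toFinset.biUnion fun sk => sk.sample j

open Classical in
/-- The largest probability that is stored for the item `(k, a)`. -/
def maxProb (R : Finset (SampledRow Key d)) (k : Key) (a : Fin d → ℝ) : ℝ≥0 :=
  (R.filter fun r => r.key = k ∧ r.val = a).sup SampledRow.prob

open Classical in
/-- The items of a set of sampled rows, each one with the largest of its probabilities. -/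
def dedup (R : Finset (SampledRow Key d)) : Finset (SampledRow Key d) :=
  R.image fun r => ⟨r.key, r.val, maxProb R r.key r.val⟩

open Classical in
/-- Merging of sketches that were built with the same hash functions; `none` is the answer `FAIL`.
Let `t` be the least number of samples of the given sketches (if none is given, the number of
samples of a new sketch). The `t`-th samples give a matrix `M`. An item `(key, val)` has the new
sampling value `p_key = κ (1 + ε)^(t-1) (1 + ε/4) sup_x |⟨val, x⟩|^p / ‖M x‖_p^p`, and with these
values the `j`-th samples, `1 ≤ j ≤ t - 1`, are thinned out. The answer is `FAIL` if some new
probability `min(1, p_key)` exceeds the largest one that is stored in the `j`-th samples. -/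
def Sketch.merge (P : SketchParams) (h : Hashes Key) (l : Multiset (Sketch Key d)) :
    Option (Sketch Key d) :=
  let t : ℕ := (l.map Sketch.copies).fold min P.copies
  let M := rescaledMatrix P.p (dedup (pooled l t))
  let pKey : (Fin d → ℝ) → ℝ≥0∞ := fun a =>
    ENNReal.ofReal (P.κ * ((1 + P.ε) ^ (t - 1) * (1 + P.ε / 4))) * sensitivity P.p M a
  if ∃ j ∈ Finset.Icc 1 (t - 1), ∃ r ∈ pooled l j,
      maxProb (pooled l j) r.key r.val < (min 1 (pKey r.val)).toNNReal then
    none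
  else
    some
      { copies := t - 1
        sample := fun j =>
          if j ∈ Finset.Icc 1 (t - 1) then
            ((pooled l j).filter fun r => ENNReal.ofReal (h (j, r.key) : ℝ) ≤ pKey r.val).image
              fun r => ⟨r.key, r.val, (min 1 (pKey r.val)).toNNReal⟩
          else ∅ }

open Classical in
/-- Merging where some of the given sketches may already be `FAIL`. -/
def mergeAll (P : SketchParams) (h : Hashes Key) (l : Multiset (Option (Sketch Key d))) :
    Option (Sketch Key d) :=
  if none ∈ l then none else Sketch.merge P h (l.filterMap id)

/-- The matrix computed from a sketch, by rescaling the rows of its first sample. -/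
def Sketch.solve (P : SketchParams) (sk : Sketch Key d) : Matrix (sk.sample 1) (Fin d) ℝ :=
  rescaledMatrix P.p (sk.sample 1)

/-! ### Neighborhood propagation -/

variable {V : Type*} [Fintype V]

open Classical in
/-- The sketch at the vertex `u` after `i` communication rounds. In round `i + 1` every vertex sends
`roundSketch … i` to all its neighbors, and merges what it receives. -/
def roundSketch (P : SketchParams) (G : SimpleGraph V) (S : V → Dataset Key d) (h : Hashes Key) :
    ℕ → V → Option (Sketch Key d)
  | 0, u => some (Sketch.create P h (S u))
  | i + 1, u =>
      mergeAll P h ((Finset.univ.filter fun v => G.Adj u v).val.map (roundSketch P G S h i))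

/-- After `Δ` rounds every vertex merges its sketches of the rounds `0, …, Δ`. -/
def finalSketch (P : SketchParams) (G : SimpleGraph V) (S : V → Dataset Key d) (h : Hashes Key)
    (Δ : ℕ) (u : V) : Option (Sketch Key d) :=
  mergeAll P h ((Multiset.range (Δ + 1)).map fun i => roundSketch P G S h i u)

/-- The number of rows in a message (`0` for `FAIL`). -/
def messageRows (m : Option (Sketch Key d)) : ℕ :=
  m.elim 0 Sketch.rows

/-- With probability at least `9/10` over the hash functions, after `Δ` rounds of neighborhood
propagation every vertex holds an `ε` `ℓ_p`-subspace embedding of the matrix of the data in its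
`Δ`-neighborhood, and in each of the rounds no vertex has sent more than `bound` rows to a
neighbor. -/
def PropagationSucceeds (P : SketchParams) (G : SimpleGraph V) (S : V → Dataset Key d)
    (Δ : ℕ) (bound : ℝ) : Prop :=
  ∃ E : Set (Hashes Key), MeasurableSet E ∧ 9 / 10 ≤ hashLaw Key E ∧ ∀ h ∈ E,
    (∀ u : V, ∃ sk : Sketch Key d, finalSketch P G S h Δ u = some sk ∧
      IsSubspaceEmbedding P.p P.ε (sk.solve P) (neighborhoodData G S Δ u).vals) ∧
    (∀ i < Δ, ∀ u v : V, G.Adj u v → (messageRows (roundSketch P G S h i u) : ℝ) ≤ bound)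

/-- The failure parameter `δ = δ' / (2 s)^Δ` with `δ' = 1 / (10 s)`. -/
def failureParam (s Δ : ℕ) : ℝ :=
  1 / (10 * (s : ℝ)) / (2 * (s : ℝ)) ^ Δ

end PersonalizedCongest

end

/-! Everything rests on one sampling statement, `SamplesWell`: if each row of a matrix A is kept
independently with rate at least min(1, κτ), τ its sensitivity, and is reweighted by the inverse
rate, then ‖Ax‖_p^p is preserved up to a factor 1 ± ε for all x at once, except with small
probability. For p = 2 this is a matrix Chernoff bound (`bernProb_quadratic_le`); for general p it
is Bernstein's inequality chained over nets of the unit ball of the column space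
(`bernProb_chaining`).

The sampling values of a merge are computed from earlier samples, which threatens independence. The
copies repair this: the values of a sketch with t copies are functions of the hashes h_j with j > t
only, so its t-th sample uses fresh randomness (`Revealed`, `hashLaw_adaptive_le`). Because the
nodes share their hashes, the union of several samples, with the largest stored probabilities, is
exactly the sample of the united dataset with the largest sampling values (`dedup_pooled`).
Duplicated items therefore do no harm, and neither do correlations between nodes, since a union
bound treats every merge separately.

The invariant `Plan.Accurate` says that the values of a sketch with t copies lie between κ(1+ε)^t τ
and κ(1+ε)^(t+1) τ, with τ taken in the data that the sketch represents. When data are united,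
sensitivities can only drop (`sensitivity_vals_anti`), and a good ε/4-embedding M distorts them by a
factor that the passage from t to t-1 absorbs (`merge_bounds`). So new values never exceed old ones,
no merge fails (`mergeAll_sketch`), and the values stay above κτ, as the next sample requires.

After i rounds a node represents the data at the ends of walks of length i; the last merge collects
i = 0, …, Δ, which is the Δ-neighborhood. Messages are short because the sensitivities of any matrix
with d columns sum to at most d^max(p/2,1) (`sum_sensitivity_le`, by Lewis' change of position),
while (1+ε)^(Δ+3) is bounded when εΔ < 1; a Chernoff bound then controls the sample sizes. Finally
`propagationSucceeds_of` takes a union bound over s(Δ+1)(Δ+2) events, each of probability at most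
δ². -/

noncomputable section

namespace PersonalizedCongest

/-! ### Independent Bernoulli sampling from a finite set -/

section Bernoulli

variable {ι : Type*} [Fintype ι] [DecidableEq ι]

/-- The probability that independent Bernoulli sampling with rates `q` selects exactly `σ`. -/
def bernWeight (q : ι → ℝ) (σ : Finset ι) : ℝ :=
  ∏ i, if i ∈ σ then q i else 1 - q i

open Classical in
/-- The probability that the selected set satisfies `B`. -/
def bernProb (q : ι → ℝ) (B : Finset ι → Prop) : ℝ :=
  ∑ σ, if B σ then bernWeight q σ else 0

/-- The expectation of a function of the selected set. -/
def bernExp (q : ι → ℝ) (F : Finset ι → ℝ) : ℝ :=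
  ∑ σ, bernWeight q σ * F σ

lemma bernWeight_nonneg {q : ι → ℝ} (h0 : ∀ i, 0 ≤ q i) (h1 : ∀ i, q i ≤ 1) (σ : Finset ι) :
    0 ≤ bernWeight q σ :=
  Finset.prod_nonneg fun i _ => by split_ifs <;> linarith [h0 i, h1 i]

/-- Independence of the coordinates: expanding the product of two-term sums over all subsets gives
the expectation. All exponential moments are computed through this. -/
lemma bernExp_prod (q a b : ι → ℝ) :
    bernExp q (fun σ => ∏ i, if i ∈ σ then a i else b i) =
      ∏ i, (q i * a i + (1 - q i) * b i) := by
  rw [Finset.prod_add]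
  simp only [bernExp, bernWeight, ← Finset.prod_mul_distrib, Finset.powerset_univ]
  refine Finset.sum_congr rfl fun σ _ => ?_
  rw [← Finset.prod_mul_prod_compl σ, ← Finset.compl_eq_univ_sdiff]
  congr 1
  · exact Finset.prod_congr rfl fun i hi => by simp [hi]
  · exact Finset.prod_congr rfl fun i hi => by simp [Finset.mem_compl.mp hi]

lemma bernExp_one (q : ι → ℝ) : bernExp q (fun _ => 1) = 1 := by
  have := bernExp_prod q (fun _ => 1) (fun _ => 1)
  simpa using this

lemma bernExp_sum {κ : Type*} (s : Finset κ) (q : ι → ℝ) (F : κ → Finset ι → ℝ) :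
    bernExp q (fun σ => ∑ k ∈ s, F k σ) = ∑ k ∈ s, bernExp q (F k) := by
  simp only [bernExp, Finset.mul_sum]
  exact Finset.sum_comm

lemma bernExp_const_mul (q : ι → ℝ) (c : ℝ) (F : Finset ι → ℝ) :
    bernExp q (fun σ => c * F σ) = c * bernExp q F := by
  simp only [bernExp, Finset.mul_sum]
  exact Finset.sum_congr rfl fun σ _ => by ring

lemma bernExp_add (q : ι → ℝ) (F F' : Finset ι → ℝ) :
    bernExp q (fun σ => F σ + F' σ) = bernExp q F + bernExp q F' := by
  simp only [bernExp, ← Finset.sum_add_distrib, mul_add]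

lemma bernProb_mono {q : ι → ℝ} (h0 : ∀ i, 0 ≤ q i) (h1 : ∀ i, q i ≤ 1) {B B' : Finset ι → Prop}
    (h : ∀ σ, B σ → B' σ) : bernProb q B ≤ bernProb q B' := by
  refine Finset.sum_le_sum fun σ _ => ?_
  by_cases hB : B σ
  · simp [hB, h σ hB]
  · simp only [hB, if_false]
    split_ifs
    exacts [bernWeight_nonneg h0 h1 σ, le_rfl]

/-- Markov's inequality. -/
lemma bernProb_le_bernExp {q : ι → ℝ} (h0 : ∀ i, 0 ≤ q i) (h1 : ∀ i, q i ≤ 1)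
    {B : Finset ι → Prop} {F : Finset ι → ℝ} (hF : ∀ σ, 0 ≤ F σ) (h : ∀ σ, B σ → 1 ≤ F σ) :
    bernProb q B ≤ bernExp q F := by
  refine Finset.sum_le_sum fun σ _ => ?_
  have hw := bernWeight_nonneg h0 h1 σ
  split_ifs with hB
  · exact le_mul_of_one_le_right hw (h σ hB)
  · exact mul_nonneg hw (hF σ)

lemma bernProb_or_le {q : ι → ℝ} (h0 : ∀ i, 0 ≤ q i) (h1 : ∀ i, q i ≤ 1)
    (B B' : Finset ι → Prop) :
    bernProb q (fun σ => B σ ∨ B' σ) ≤ bernProb q B + bernProb q B' := by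
  rw [bernProb, bernProb, bernProb, ← Finset.sum_add_distrib]
  refine Finset.sum_le_sum fun σ _ => ?_
  have hw := bernWeight_nonneg h0 h1 σ
  by_cases hB : B σ <;> by_cases hB' : B' σ <;> simp [hB, hB', hw]

/-- The union bound. -/
lemma bernProb_exists_le {κ : Type*} (s : Finset κ) {q : ι → ℝ} (h0 : ∀ i, 0 ≤ q i)
    (h1 : ∀ i, q i ≤ 1) (B : κ → Finset ι → Prop) :
    bernProb q (fun σ => ∃ k ∈ s, B k σ) ≤ ∑ k ∈ s, bernProb q (B k) := by
  classical
  simp only [bernProb]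
  rw [Finset.sum_comm]
  refine Finset.sum_le_sum fun σ _ => ?_
  have hw := bernWeight_nonneg h0 h1 σ
  have hnn : ∀ k ∈ s, (0 : ℝ) ≤ if B k σ then bernWeight q σ else 0 := fun k _ => by
    split_ifs
    exacts [hw, le_rfl]
  split_ifs with h
  · obtain ⟨k, hk, hB⟩ := h
    refine le_trans ?_ (Finset.single_le_sum hnn hk)
    simp [hB]
  · exact Finset.sum_nonneg hnn

/-- Inequalities between expectations may be checked on the two values of one coordinate. -/
lemma bernExp_le_of_coord {q : ι → ℝ} (h0 : ∀ i, 0 ≤ q i) (h1 : ∀ i, q i ≤ 1) (i : ι)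
    {F F' : Finset ι → ℝ}
    (h : ∀ σ, i ∉ σ → q i * F (insert i σ) + (1 - q i) * F σ ≤
      q i * F' (insert i σ) + (1 - q i) * F' σ) : bernExp q F ≤ bernExp q F' := by
  -- Pair each σ that avoids i with `insert i σ`; the two weights share the factor of the other
  -- coordinates.
  have key : ∀ H : Finset ι → ℝ, bernExp q H = ∑ σ ∈ (Finset.univ.erase i).powerset,
      (∏ j ∈ Finset.univ.erase i, if j ∈ σ then q j else 1 - q j) *
        (q i * H (insert i σ) + (1 - q i) * H σ) := by
    intro H
    have hu : (Finset.univ : Finset (Finset ι)) =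
        (insert i (Finset.univ.erase i)).powerset := by
      rw [Finset.insert_erase (Finset.mem_univ i), Finset.powerset_univ]
    rw [bernExp, hu, Finset.sum_powerset_insert (Finset.notMem_erase i _),
      ← Finset.sum_add_distrib]
    refine Finset.sum_congr rfl fun σ hσ => ?_
    have hi : i ∉ σ := fun hi => Finset.notMem_erase i _ (Finset.mem_powerset.mp hσ hi)
    have e1 : bernWeight q σ =
        (1 - q i) * ∏ j ∈ Finset.univ.erase i, if j ∈ σ then q j else 1 - q j := by
      rw [bernWeight, ← Finset.mul_prod_erase _ _ (Finset.mem_univ i)]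
      simp [hi]
    have e2 : bernWeight q (insert i σ) =
        q i * ∏ j ∈ Finset.univ.erase i, if j ∈ σ then q j else 1 - q j := by
      rw [bernWeight, ← Finset.mul_prod_erase _ _ (Finset.mem_univ i)]
      simp only [Finset.mem_insert_self, if_true]
      congr 1
      refine Finset.prod_congr rfl fun j hj => ?_
      simp [Finset.ne_of_mem_erase hj]
    rw [e1, e2]
    ring
  rw [key, key]
  refine Finset.sum_le_sum fun σ hσ => mul_le_mul_of_nonneg_left (h σ fun hi =>
    Finset.notMem_erase i _ (Finset.mem_powerset.mp hσ hi)) (Finset.prod_nonneg fun j _ => ?_)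
  split_ifs <;> linarith [h0 j, h1 j]

/-- The union bound for countably many events. -/
lemma bernProb_exists_nat_le {q : ι → ℝ} (h0 : ∀ i, 0 ≤ q i) (h1 : ∀ i, q i ≤ 1)
    (B : ℕ → Finset ι → Prop) {c : ℝ}
    (hc : ∀ K, ∑ k ∈ Finset.range K, bernProb q (B k) ≤ c) :
    bernProb q (fun σ => ∃ k, B k σ) ≤ c := by
  classical
  -- There are finitely many σ, so one witness index for each of them bounds the range of indices
  -- that matter, and the finite union bound suffices.
  have hf : ∀ σ, ∃ K, (∃ k, B k σ) → B K σ := by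
    intro σ
    by_cases h : ∃ k, B k σ
    · obtain ⟨k, hk⟩ := h
      exact ⟨k, fun _ => hk⟩
    · exact ⟨0, fun h' => absurd h' h⟩
  choose f hf using hf
  refine (bernProb_mono h0 h1 (B' := fun σ => ∃ k ∈ Finset.range (Finset.univ.sup f + 1), B k σ)
    fun σ h => ⟨f σ, ?_, hf σ h⟩).trans ((bernProb_exists_le _ h0 h1 B).trans (hc _))
  exact Finset.mem_range.mpr (Nat.lt_succ_of_le (Finset.le_sup (Finset.mem_univ σ)))

lemma exp_le_one_add_add_sq {x : ℝ} (hx : |x| ≤ 1) : Real.exp x ≤ 1 + x + x ^ 2 := by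
  have := (abs_le.mp (Real.abs_exp_sub_one_sub_id_le hx)).2
  linarith

/-- One-sided Bernstein inequality, in the form in which it comes from exponential moments. -/
lemma bernProb_bernstein {q : ι → ℝ} (h0 : ∀ i, 0 ≤ q i) (h1 : ∀ i, q i ≤ 1) (c : ι → ℝ)
    {θ V t : ℝ} (hθ : ∀ i, q i = 1 ∨ θ * |c i| ≤ q i) (hθ0 : 0 ≤ θ)
    (hV : ∑ i, (if q i = 1 then 0 else c i ^ 2 / q i) ≤ V) :
    bernProb q (fun σ => t < ∑ i, ((if i ∈ σ then 1 / q i else 0) - 1) * c i) ≤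
      Real.exp (-(θ * t) + θ ^ 2 * V) := by
  -- Chernoff's method: F is exp(θ(sum - t)), written as a product over coordinates so that its
  -- expectation factors.
  set F : Finset ι → ℝ := fun σ => Real.exp (-(θ * t)) *
    ∏ i, if i ∈ σ then Real.exp (θ * ((1 / q i - 1) * c i)) else Real.exp (θ * (-1 * c i)) with hF
  have hFe : ∀ σ, F σ = Real.exp (-(θ * t) +
      θ * ∑ i, ((if i ∈ σ then 1 / q i else 0) - 1) * c i) := by
    intro σ
    rw [hF, Real.exp_add, Finset.mul_sum, Real.exp_sum]
    refine congrArg _ (Finset.prod_congr rfl fun i _ => ?_)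
    split_ifs <;> simp
  refine (bernProb_le_bernExp h0 h1 (F := F) (fun σ => ?_) fun σ hσ => ?_).trans ?_
  · rw [hFe]; positivity
  · rw [hFe, Real.one_le_exp_iff]
    nlinarith [mul_le_mul_of_nonneg_left hσ.le hθ0]
  rw [hF, bernExp_const_mul, bernExp_prod, Real.exp_add]
  refine mul_le_mul_of_nonneg_left ?_ (Real.exp_pos _).le
  calc ∏ i, (q i * Real.exp (θ * ((1 / q i - 1) * c i)) +
        (1 - q i) * Real.exp (θ * (-1 * c i)))
      ≤ ∏ i, Real.exp (θ ^ 2 * if q i = 1 then 0 else c i ^ 2 / q i) := by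
        refine Finset.prod_le_prod (fun i _ => ?_) fun i _ => ?_
        · have := h0 i
          have := h1 i
          have : 0 ≤ 1 - q i := by linarith
          positivity
        · rcases hθ i with hq | hq
          · simp [hq]
          by_cases hqi1 : q i = 1
          · simp [hqi1]
          · rw [if_neg hqi1]
            rcases (h0 i).eq_or_lt with hq0 | hq0
            · rw [← hq0] at hq ⊢
              have hz : θ * c i = 0 := by
                rw [← abs_eq_zero, abs_mul, abs_of_nonneg hθ0]
                exact le_antisymm hq (by positivity)
              simp [hz]
            · have hy : |θ * c i / q i| ≤ 1 := by
                rw [abs_div, abs_mul, abs_of_nonneg hθ0, abs_of_pos hq0, div_le_one hq0]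
                exact hq
              have hq1 := h1 i
              -- The exponent takes the values (1-q)y and -qy with probabilities q and 1-q. Its mean
              -- vanishes and its second moment is q(1-q)y² ≤ qy², so exp x ≤ 1 + x + x² bounds the
              -- factor by exp(qy²).
              set y := θ * c i / q i with hydef
              have hyq : θ * c i = q i * y := by rw [hydef]; field_simp
              have a1 : θ * ((1 / q i - 1) * c i) = (1 - q i) * y := by
                have : θ * ((1 / q i - 1) * c i) = (1 / q i - 1) * (θ * c i) := by ring
                rw [this, hyq]; field_simp
              have a2 : θ * (-1 * c i) = -(q i * y) := by linarith
              have a3 : θ ^ 2 * (c i ^ 2 / q i) = q i * y ^ 2 := by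
                have : θ ^ 2 * (c i ^ 2 / q i) = (θ * c i) ^ 2 / q i := by ring
                rw [this, hyq]; field_simp
              rw [a1, a2, a3]
              have b1 : |(1 - q i) * y| ≤ 1 := by
                rw [abs_mul, abs_of_nonneg (by linarith : 0 ≤ 1 - q i)]
                nlinarith [abs_nonneg y]
              have b2 : |-(q i * y)| ≤ 1 := by
                rw [abs_neg, abs_mul, abs_of_pos hq0]
                nlinarith [abs_nonneg y]
              have c1 := mul_le_mul_of_nonneg_left (exp_le_one_add_add_sq b1) hq0.le
              have c2 := mul_le_mul_of_nonneg_left (exp_le_one_add_add_sq b2)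
                (by linarith : 0 ≤ 1 - q i)
              refine (add_le_add c1 c2).trans (le_trans ?_ (Real.add_one_le_exp _))
              have : q i ^ 2 * y ^ 2 ≥ 0 := by positivity
              nlinarith
    _ = Real.exp (θ ^ 2 * ∑ i, if q i = 1 then 0 else c i ^ 2 / q i) := by rw [← Real.exp_sum, Finset.mul_sum]
    _ ≤ Real.exp (θ ^ 2 * V) :=
        Real.exp_le_exp.mpr (mul_le_mul_of_nonneg_left hV (sq_nonneg θ))

/-- Two-sided Bernstein inequality. -/
lemma bernProb_bernstein_abs {q : ι → ℝ} (h0 : ∀ i, 0 ≤ q i) (h1 : ∀ i, q i ≤ 1) (c : ι → ℝ)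
    {θ V t : ℝ} (hθ : ∀ i, q i = 1 ∨ θ * |c i| ≤ q i) (hθ0 : 0 ≤ θ)
    (hV : ∑ i, (if q i = 1 then 0 else c i ^ 2 / q i) ≤ V) :
    bernProb q (fun σ => t < |∑ i, ((if i ∈ σ then 1 / q i else 0) - 1) * c i|) ≤
      2 * Real.exp (-(θ * t) + θ ^ 2 * V) := by
  have A := bernProb_bernstein h0 h1 c (t := t) hθ hθ0 hV
  have B := bernProb_bernstein h0 h1 (fun i => -c i) (θ := θ) (V := V) (t := t)
    (by simpa using hθ) hθ0 (by simpa using hV)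
  refine (bernProb_mono h0 h1 fun σ hσ => ?_).trans
    ((bernProb_or_le h0 h1 _ _).trans ((add_le_add A B).trans (two_mul _).ge))
  rcases lt_abs.mp hσ with h | h
  · exact Or.inl h
  · right
    simpa using h

/-- A Chernoff bound for the size of the selected set. -/
lemma bernProb_card_le {q : ι → ℝ} (h0 : ∀ i, 0 ≤ q i) (h1 : ∀ i, q i ≤ 1) {B : ℝ}
    (hB : ∑ i, q i ≤ B) : bernProb q (fun σ => 3 * B < σ.card) ≤ Real.exp (-B) := by
  -- Exponential moment at parameter 1: since e ≤ 3, each factor is at most 1 + 2q ≤ exp(2q), which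
  -- leaves the exponent -3B + 2B.
  set F : Finset ι → ℝ := fun σ => Real.exp (-(3 * B)) *
    ∏ i, if i ∈ σ then Real.exp 1 else 1 with hF
  have hFe : ∀ σ, F σ = Real.exp (-(3 * B) + σ.card) := by
    intro σ
    simp only [hF, Real.exp_add]
    congr 1
    rw [Finset.prod_ite_mem, Finset.univ_inter, Finset.prod_const, ← Real.exp_nat_mul, mul_one]
  refine (bernProb_le_bernExp h0 h1 (F := F) (fun σ => ?_) fun σ hσ => ?_).trans ?_
  · rw [hFe]; positivity
  · rw [hFe, Real.one_le_exp_iff]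
    linarith
  rw [hF, bernExp_const_mul, bernExp_prod (b := fun _ => 1) (a := fun _ => Real.exp 1)]
  have he : Real.exp 1 ≤ 3 := Real.exp_one_lt_three.le
  have hB0 : 0 ≤ B := (Finset.sum_nonneg fun i _ => h0 i).trans hB
  calc Real.exp (-(3 * B)) * ∏ i, (q i * Real.exp 1 + (1 - q i) * 1)
      ≤ Real.exp (-(3 * B)) * ∏ i, Real.exp (2 * q i) := by
        refine mul_le_mul_of_nonneg_left (Finset.prod_le_prod (fun i _ => ?_) fun i _ => ?_)
          (Real.exp_pos _).le
        · nlinarith [h0 i, h1 i, Real.exp_pos 1, mul_nonneg (h0 i) (Real.exp_pos 1).le]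
        · refine le_trans ?_ (Real.add_one_le_exp _)
          nlinarith [h0 i]
    _ = Real.exp (-(3 * B) + 2 * ∑ i, q i) := by
        rw [← Real.exp_sum, ← Real.exp_add, Finset.mul_sum]
    _ ≤ Real.exp (-B) := Real.exp_le_exp.mpr (by linarith)

/-- Serves the degenerate case B = 0, which occurs for d = 0, where the Chernoff bound exp(-B) = 1
says nothing. -/
lemma bernProb_nonempty_of_zero {q : ι → ℝ} (h : ∀ i, q i = 0) :
    bernProb q (fun σ => 0 < σ.card) = 0 := by
  refine Finset.sum_eq_zero fun σ _ => ?_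
  split_ifs with hσ
  · obtain ⟨i, hi⟩ := Finset.card_pos.mp hσ
    exact Finset.prod_eq_zero (Finset.mem_univ i) (by simp [hi, h i])
  · rfl

end Bernoulli

end PersonalizedCongest

end

noncomputable section

namespace PersonalizedCongest

/-! ### Concentration of a Bernoulli sample of rank one operators -/

section MatrixConcentration

open scoped RealInnerProductSpace

/-- The scalar form of the trace inequality below; a and b will run through the eigenvalues of two
operators. It follows from the tangent line bound e^x - e^y ≤ (x - y)e^x. -/
lemma abs_mul_exp_sub_exp_le (θ a b : ℝ) :
    |(a - b) * (Real.exp (θ * a) - Real.exp (θ * b))| ≤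
      |θ| * (a - b) ^ 2 * (Real.exp (θ * a) + Real.exp (θ * b)) := by
  have key : ∀ x y : ℝ, Real.exp x - Real.exp y ≤ |x - y| * (Real.exp x + Real.exp y) := by
    intro x y
    have h1 : Real.exp x - Real.exp y ≤ (x - y) * Real.exp x := by
      have := mul_le_mul_of_nonneg_left (Real.add_one_le_exp (y - x)) (Real.exp_pos x).le
      rw [← Real.exp_add] at this
      have e : x + (y - x) = y := by ring
      rw [e] at this
      linarith
    have h2 : (x - y) * Real.exp x ≤ |x - y| * Real.exp x :=
      mul_le_mul_of_nonneg_right (le_abs_self _) (Real.exp_pos x).le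
    have h3 : 0 ≤ |x - y| * Real.exp y := by positivity
    linarith
  have hk : |Real.exp (θ * a) - Real.exp (θ * b)| ≤
      |θ * a - θ * b| * (Real.exp (θ * a) + Real.exp (θ * b)) := by
    rw [abs_le]
    constructor
    · have := key (θ * b) (θ * a)
      rw [abs_sub_comm, add_comm] at this
      linarith
    · exact key _ _
  rw [← mul_sub, abs_mul] at hk
  rw [abs_mul]
  calc |a - b| * |Real.exp (θ * a) - Real.exp (θ * b)|
      ≤ |a - b| * (|θ| * |a - b| * (Real.exp (θ * a) + Real.exp (θ * b))) :=
        mul_le_mul_of_nonneg_left hk (abs_nonneg _)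
    _ = |θ| * |a - b| ^ 2 * (Real.exp (θ * a) + Real.exp (θ * b)) := by ring
    _ = _ := by rw [sq_abs]

variable {E : Type*} [NormedAddCommGroup E] [InnerProductSpace ℝ E]

/-- The quadratic form of `exp (θ A)` at `w`, for `A` with eigenbasis `u` and eigenvalues `a`. -/
def expForm {κ : Type*} [Fintype κ] (θ : ℝ) (u : OrthonormalBasis κ ℝ E) (a : κ → ℝ) (w : E) : ℝ :=
  ∑ k, Real.exp (θ * a k) * ⟪u k, w⟫ ^ 2

lemma expForm_nonneg {κ : Type*} [Fintype κ] (θ : ℝ) (u : OrthonormalBasis κ ℝ E) (a : κ → ℝ)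
    (w : E) : 0 ≤ expForm θ u a w :=
  Finset.sum_nonneg fun k _ => by positivity

/-- The mean value trace inequality for a rank one perturbation. -/
lemma abs_expForm_sub_le {κ : Type*} [Fintype κ] (θ : ℝ) {A B : E →ₗ[ℝ] E} (hA : A.IsSymmetric)
    {u v : OrthonormalBasis κ ℝ E} {a b : κ → ℝ} (hu : ∀ k, A (u k) = a k • u k)
    (hv : ∀ k, B (v k) = b k • v k) {s : ℝ} {w : E} (h : ∀ x, A x - B x = (s * ⟪w, x⟫) • w) :
    |s * (expForm θ u a w - expForm θ v b w)| ≤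
      |θ| * s ^ 2 * ‖w‖ ^ 2 * (expForm θ u a w + expForm θ v b w) := by
  -- The matrix entry of A - B between an eigenvector of A and one of B, computed in two ways. With
  -- Parseval it turns every quantity into a double sum weighted by ⟪u k, v l⟫², although A and B
  -- need not commute.
  have hkl : ∀ k l, s * ⟪u k, w⟫ * ⟪w, v l⟫ = (a k - b l) * ⟪u k, v l⟫ := by
    intro k l
    have e1 : ⟪u k, A (v l) - B (v l)⟫ = s * ⟪u k, w⟫ * ⟪w, v l⟫ := by
      rw [h, inner_smul_right]; ring
    rw [← e1, inner_sub_right, ← hA (u k) (v l), hu, hv, real_inner_smul_left, inner_smul_right]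
    ring
  have parseval : ∀ (x y : E) (z : OrthonormalBasis κ ℝ E),
      ∑ k, ⟪x, z k⟫ * ⟪z k, y⟫ = ⟪x, y⟫ := fun x y z => z.sum_inner_mul_inner x y
  have hnorm : ∀ z : OrthonormalBasis κ ℝ E, ∑ k, ⟪w, z k⟫ ^ 2 = ‖w‖ ^ 2 := by
    intro z
    rw [← real_inner_self_eq_norm_sq, ← parseval w w z]
    exact Finset.sum_congr rfl fun k _ => by rw [real_inner_comm w, sq]
  have r1 : ∀ k, s * ⟪u k, w⟫ ^ 2 = ∑ l, (a k - b l) * ⟪u k, v l⟫ ^ 2 := by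
    intro k
    have : s * ⟪u k, w⟫ ^ 2 = s * ⟪u k, w⟫ * ∑ l, ⟪w, v l⟫ * ⟪v l, u k⟫ := by
      rw [parseval, real_inner_comm w]; ring
    rw [this, Finset.mul_sum]
    refine Finset.sum_congr rfl fun l _ => ?_
    rw [← mul_assoc, hkl, real_inner_comm (u k)]; ring
  have r2 : ∀ l, s * ⟪v l, w⟫ ^ 2 = ∑ k, (a k - b l) * ⟪u k, v l⟫ ^ 2 := by
    intro l
    have : s * ⟪v l, w⟫ ^ 2 = s * ⟪v l, w⟫ * ∑ k, ⟪w, u k⟫ * ⟪u k, v l⟫ := by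
      rw [parseval, real_inner_comm w]; ring
    rw [this, Finset.mul_sum]
    refine Finset.sum_congr rfl fun k _ => ?_
    have := hkl k l
    rw [real_inner_comm (v l) w] at this
    rw [real_inner_comm (u k) w]
    linear_combination ⟪u k, v l⟫ * this
  have r3 : ∀ k, s ^ 2 * ‖w‖ ^ 2 * ⟪u k, w⟫ ^ 2 = ∑ l, (a k - b l) ^ 2 * ⟪u k, v l⟫ ^ 2 := by
    intro k
    rw [← hnorm v, Finset.mul_sum, Finset.sum_mul]
    refine Finset.sum_congr rfl fun l _ => ?_
    rw [← mul_pow (a k - b l), ← hkl]; ring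
  have r4 : ∀ l, s ^ 2 * ‖w‖ ^ 2 * ⟪v l, w⟫ ^ 2 = ∑ k, (a k - b l) ^ 2 * ⟪u k, v l⟫ ^ 2 := by
    intro l
    rw [← hnorm u, Finset.mul_sum, Finset.sum_mul]
    refine Finset.sum_congr rfl fun k _ => ?_
    rw [← mul_pow (a k - b l), ← hkl, real_inner_comm (v l) w, real_inner_comm w (u k)]; ring
  have L : s * (expForm θ u a w - expForm θ v b w) = ∑ k, ∑ l,
      (a k - b l) * (Real.exp (θ * a k) - Real.exp (θ * b l)) * ⟪u k, v l⟫ ^ 2 := by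
    have e1 : s * expForm θ u a w =
        ∑ k, ∑ l, Real.exp (θ * a k) * ((a k - b l) * ⟪u k, v l⟫ ^ 2) := by
      rw [expForm, Finset.mul_sum]
      refine Finset.sum_congr rfl fun k _ => ?_
      rw [← Finset.mul_sum, ← r1]; ring
    have e2 : s * expForm θ v b w =
        ∑ k, ∑ l, Real.exp (θ * b l) * ((a k - b l) * ⟪u k, v l⟫ ^ 2) := by
      rw [expForm, Finset.mul_sum, Finset.sum_comm]
      refine Finset.sum_congr rfl fun l _ => ?_
      rw [← Finset.mul_sum, ← r2]; ring
    rw [mul_sub, e1, e2]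
    simp only [← Finset.sum_sub_distrib]
    exact Finset.sum_congr rfl fun k _ => Finset.sum_congr rfl fun l _ => by ring
  have R : |θ| * s ^ 2 * ‖w‖ ^ 2 * (expForm θ u a w + expForm θ v b w) = ∑ k, ∑ l,
      |θ| * (a k - b l) ^ 2 * (Real.exp (θ * a k) + Real.exp (θ * b l)) * ⟪u k, v l⟫ ^ 2 := by
    have e1 : s ^ 2 * ‖w‖ ^ 2 * expForm θ u a w =
        ∑ k, ∑ l, Real.exp (θ * a k) * ((a k - b l) ^ 2 * ⟪u k, v l⟫ ^ 2) := by
      rw [expForm, Finset.mul_sum]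
      refine Finset.sum_congr rfl fun k _ => ?_
      rw [← Finset.mul_sum, ← r3]; ring
    have e2 : s ^ 2 * ‖w‖ ^ 2 * expForm θ v b w =
        ∑ k, ∑ l, Real.exp (θ * b l) * ((a k - b l) ^ 2 * ⟪u k, v l⟫ ^ 2) := by
      rw [expForm, Finset.mul_sum, Finset.sum_comm]
      refine Finset.sum_congr rfl fun l _ => ?_
      rw [← Finset.mul_sum, ← r4]; ring
    rw [mul_assoc |θ|, mul_assoc |θ|, mul_add, e1, e2]
    simp only [← Finset.sum_add_distrib, Finset.mul_sum]
    exact Finset.sum_congr rfl fun k _ => Finset.sum_congr rfl fun l _ => by ring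
  rw [L, R]
  -- Both sides now carry the same nonnegative weights, so the scalar inequality applies termwise.
  refine (Finset.abs_sum_le_sum_abs _ _).trans (Finset.sum_le_sum fun k _ => ?_)
  refine (Finset.abs_sum_le_sum_abs _ _).trans (Finset.sum_le_sum fun l _ => ?_)
  rw [abs_mul, abs_of_nonneg (sq_nonneg ⟪u k, v l⟫)]
  exact mul_le_mul_of_nonneg_right (abs_mul_exp_sub_exp_le _ _ _) (sq_nonneg _)

/-- The operator `∑ i, c i • w i ⊗ w i`. -/
def rankOneSum {ι : Type*} [Fintype ι] (w : ι → E) (c : ι → ℝ) : E →ₗ[ℝ] E :=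
  ∑ i, c i • (innerₛₗ ℝ (w i)).smulRight (w i)

lemma rankOneSum_apply {ι : Type*} [Fintype ι] (w : ι → E) (c : ι → ℝ) (x : E) :
    rankOneSum w c x = ∑ i, (c i * ⟪w i, x⟫) • w i := by
  simp [rankOneSum, LinearMap.sum_apply, smul_smul]

lemma inner_rankOneSum {ι : Type*} [Fintype ι] (w : ι → E) (c : ι → ℝ) (x y : E) :
    ⟪y, rankOneSum w c x⟫ = ∑ i, c i * (⟪w i, y⟫ * ⟪w i, x⟫) := by
  rw [rankOneSum_apply, inner_sum]
  refine Finset.sum_congr rfl fun i _ => ?_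
  rw [inner_smul_right, real_inner_comm (w i) y]; ring

lemma rankOneSum_isSymmetric {ι : Type*} [Fintype ι] (w : ι → E) (c : ι → ℝ) :
    (rankOneSum w c).IsSymmetric := by
  intro x y
  rw [inner_rankOneSum, real_inner_comm, inner_rankOneSum]
  exact Finset.sum_congr rfl fun i _ => by ring

variable [FiniteDimensional ℝ E] {ι : Type*} [Fintype ι] [DecidableEq ι]

/-- The centered coefficients of a Bernoulli sample. -/
def centeredCoeff (q : ι → ℝ) (σ : Finset ι) (i : ι) : ℝ :=
  (if i ∈ σ then 1 / q i else 0) - 1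

/-- Concentration of a Bernoulli sample of rank one operators that sum up to the identity. -/
lemma bernProb_quadratic_le {q : ι → ℝ} (h0 : ∀ i, 0 ≤ q i) (h1 : ∀ i, q i ≤ 1) (w : ι → E)
    (hw : ∀ x : E, ∑ i, ⟪w i, x⟫ ^ 2 = ‖x‖ ^ 2) {β ε : ℝ} (hβ : 0 < β)
    (hq : ∀ i, q i = 1 ∨ ‖w i‖ ^ 2 ≤ β * q i) (hε : 0 ≤ ε) (hε2 : ε ≤ 2) :
    bernProb q (fun σ => ∃ x : E, ε * ‖x‖ ^ 2 < |∑ i, centeredCoeff q σ i * ⟪w i, x⟫ ^ 2|) ≤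
      2 * Module.finrank ℝ E * Real.exp (-(ε ^ 2 / (8 * β))) := by
  set r := Module.finrank ℝ E with hr
  set Y : Finset ι → E →ₗ[ℝ] E := fun σ => rankOneSum w (centeredCoeff q σ) with hY
  have hsym : ∀ σ, (Y σ).IsSymmetric := fun σ => rankOneSum_isSymmetric _ _
  set u : Finset ι → OrthonormalBasis (Fin r) ℝ E := fun σ => (hsym σ).eigenvectorBasis hr.symm
    with hu
  set lam : Finset ι → Fin r → ℝ := fun σ => (hsym σ).eigenvalues hr.symm with hlam
  have heig : ∀ σ k, Y σ (u σ k) = lam σ k • u σ k := fun σ k =>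
    (hsym σ).apply_eigenvectorBasis hr.symm k
  have hlamsum : ∀ σ k, lam σ k = ∑ i, centeredCoeff q σ i * ⟪u σ k, w i⟫ ^ 2 := by
    intro σ k
    have : ⟪u σ k, Y σ (u σ k)⟫ = lam σ k := by
      rw [heig, inner_smul_right, real_inner_self_eq_norm_sq, (u σ).norm_eq_one]; ring
    rw [← this, hY, inner_rankOneSum]
    exact Finset.sum_congr rfl fun i _ => by rw [real_inner_comm]; ring
  have hone : ∀ σ k, ∑ i, ⟪u σ k, w i⟫ ^ 2 = 1 := by
    intro σ k
    have := hw (u σ k)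
    rw [(u σ).norm_eq_one, one_pow] at this
    rw [← this]
    exact Finset.sum_congr rfl fun i _ => by rw [real_inner_comm]
  -- the derivative of the moment generating function is controlled coordinate by coordinate
  have hcoord : ∀ θ s : ℝ, (s = 1 ∨ s = -1) →
      s * bernExp q (fun σ => ∑ k, lam σ k * Real.exp (θ * lam σ k)) ≤
        |θ| * β * (bernExp q (fun σ => ∑ k, lam σ k * Real.exp (θ * lam σ k)) +
          2 * bernExp q (fun σ => ∑ k, Real.exp (θ * lam σ k))) := by
    intro θ s hs
    have e1 : ∀ σ, ∑ k, lam σ k * Real.exp (θ * lam σ k) =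
        ∑ i, centeredCoeff q σ i * expForm θ (u σ) (lam σ) (w i) := by
      intro σ
      simp only [expForm, Finset.mul_sum]
      rw [Finset.sum_comm]
      refine Finset.sum_congr rfl fun k _ => ?_
      conv_lhs => rw [hlamsum σ k, Finset.sum_mul, ← hlamsum σ k]
      exact Finset.sum_congr rfl fun i _ => by ring
    have e2 : ∀ σ, ∑ k, Real.exp (θ * lam σ k) = ∑ i, expForm θ (u σ) (lam σ) (w i) := by
      intro σ
      simp only [expForm]
      rw [Finset.sum_comm]
      refine Finset.sum_congr rfl fun k _ => ?_
      rw [← Finset.mul_sum, hone, mul_one]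
    simp only [e1, e2]
    rw [bernExp_sum, bernExp_sum, Finset.mul_sum, Finset.mul_sum, ← Finset.sum_add_distrib,
      Finset.mul_sum]
    refine Finset.sum_le_sum fun i _ => ?_
    rw [← bernExp_const_mul, ← bernExp_const_mul, ← bernExp_add, ← bernExp_const_mul]
    -- With the other coordinates fixed, the centered coefficient has mean zero, so only (1-q)(G1 -
    -- G0) survives on the left. The mean value inequality for the perturbation (1/q) w ⊗ w bounds
    -- that difference by |θ|β(G1 + G0).
    refine bernExp_le_of_coord h0 h1 i fun σ hi => ?_
    set G1 := expForm θ (u (insert i σ)) (lam (insert i σ)) (w i)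
    set G0 := expForm θ (u σ) (lam σ) (w i)
    have hG1 : 0 ≤ G1 := expForm_nonneg _ _ _ _
    have hG0 : 0 ≤ G0 := expForm_nonneg _ _ _ _
    have hθβ : 0 ≤ |θ| * β := by positivity
    simp only [centeredCoeff, Finset.mem_insert_self, if_true, hi, if_false]
    rcases hq i with hqi | hqi
    · rw [hqi]
      have : 0 ≤ |θ| * β * (2 * G1) := by positivity
      norm_num
      linarith
    rcases (h0 i).eq_or_lt with hq0 | hq0
    · have hwi : w i = 0 := by
        rw [← hq0, mul_zero] at hqi
        have : ‖w i‖ = 0 := by nlinarith [norm_nonneg (w i)]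
        exact norm_eq_zero.mp this
      have z1 : G1 = 0 := by simp [G1, expForm, hwi]
      have z0 : G0 = 0 := by simp [G0, expForm, hwi]
      rw [z1, z0]
      simp
    · have hdiff : ∀ x, Y (insert i σ) x - Y σ x = ((1 / q i) * ⟪w i, x⟫) • w i := by
        intro x
        rw [hY]
        simp only
        rw [rankOneSum_apply, rankOneSum_apply, ← Finset.sum_sub_distrib, Finset.sum_eq_single i]
        · rw [← sub_smul]
          congr 1
          simp [centeredCoeff, hi]
          ring
        · intro j _ hj
          simp [centeredCoeff, hj]
        · simp
      have hmv := abs_expForm_sub_le θ (hsym (insert i σ)) (heig (insert i σ)) (heig σ) hdiff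
      have hq1 := h1 i
      have hG : |G1 - G0| ≤ |θ| * β * (G1 + G0) := by
        have a1 : |1 / q i * (G1 - G0)| = |G1 - G0| / q i := by
          rw [abs_mul, abs_of_pos (by positivity : 0 < 1 / q i)]; ring
        rw [a1, div_le_iff₀ hq0] at hmv
        refine hmv.trans ?_
        have a2 : |θ| * (1 / q i) ^ 2 * ‖w i‖ ^ 2 * (G1 + G0) * q i =
            |θ| * (‖w i‖ ^ 2 / q i) * (G1 + G0) := by field_simp
        rw [a2]
        have a3 : ‖w i‖ ^ 2 / q i ≤ β := by rwa [div_le_iff₀ hq0]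
        gcongr
      have hsG : s * (G1 - G0) ≤ |θ| * β * (G1 + G0) := by
        refine le_trans ?_ hG
        rcases hs with rfl | rfl
        · rw [one_mul]; exact le_abs_self _
        · rw [neg_one_mul]; exact neg_le_abs _
      have b1 : q i * (s * ((1 / q i - 1) * G1)) + (1 - q i) * (s * ((0 - 1) * G0)) =
          (1 - q i) * (s * (G1 - G0)) := by field_simp; ring
      -- The expectation of (coefficient + 2)·G exceeds (1-q)(G1 + G0) by 2qG1. This form sums over
      -- i to the derivative and the value of the trace moment again.
      have b2 : q i * (|θ| * β * ((1 / q i - 1) * G1 + 2 * G1)) +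
          (1 - q i) * (|θ| * β * ((0 - 1) * G0 + 2 * G0)) =
          (1 - q i) * (|θ| * β * (G1 + G0)) + 2 * q i * (|θ| * β * G1) := by field_simp; ring
      rw [b1, b2]
      have c1 := mul_le_mul_of_nonneg_left hsG (by linarith : 0 ≤ 1 - q i)
      have c2 : 0 ≤ 2 * q i * (|θ| * β * G1) := by positivity
      linarith
  -- the moment generating function
  set m : ℝ → ℝ → ℝ := fun s θ => bernExp q (fun σ => ∑ k, Real.exp (s * θ * lam σ k)) with hm
  have hmgf : ∀ s : ℝ, (s = 1 ∨ s = -1) → ∀ θ, 0 ≤ θ → θ * β ≤ 1 / 2 →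
      m s θ ≤ r * Real.exp (2 * β * θ ^ 2) := by
    intro s hs θ hθ hθβ
    set m' : ℝ → ℝ := fun θ => s * bernExp q
      (fun σ => ∑ k, lam σ k * Real.exp (s * θ * lam σ k)) with hm'
    have hder : ∀ t, HasDerivAt (m s) (m' t) t := by
      intro t
      have : m' t = ∑ σ, bernWeight q σ * ∑ k, Real.exp (s * t * lam σ k) * (s * 1 * lam σ k) := by
        simp only [hm', bernExp, Finset.mul_sum]
        exact Finset.sum_congr rfl fun σ _ => Finset.sum_congr rfl fun k _ => by ring
      rw [this]
      refine HasDerivAt.fun_sum fun σ _ => HasDerivAt.const_mul _ ?_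
      refine HasDerivAt.fun_sum fun k _ => ?_
      exact (((hasDerivAt_id t).const_mul s).mul_const (lam σ k)).exp
    have hmnn : ∀ t, 0 ≤ m s t := fun t => Finset.sum_nonneg fun σ _ =>
      mul_nonneg (bernWeight_nonneg h0 h1 σ) (Finset.sum_nonneg fun k _ => (Real.exp_pos _).le)
    have hbound : ∀ t, 0 ≤ t → t * β ≤ 1 / 2 → m' t ≤ 4 * β * t * m s t := by
      intro t ht htβ
      have hst : |s * t| = t := by
        rw [abs_mul, abs_of_nonneg ht]
        rcases hs with rfl | rfl <;> simp
      have hc := hcoord (s * t) s hs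
      rw [hst] at hc
      set D := bernExp q (fun σ => ∑ k, lam σ k * Real.exp (s * t * lam σ k))
      have hm't : m' t = s * D := rfl
      have hmt : m s t = bernExp q (fun σ => ∑ k, Real.exp (s * t * lam σ k)) := rfl
      rw [← hmt] at hc
      rw [hm't]
      have := hmnn t
      have htb : 0 ≤ t * β := by positivity
      have hnn : 0 ≤ t * β * m s t := by positivity
      -- If the derivative sD is positive, then D ≤ sD, and tβ ≤ 1/2 lets half of sD be absorbed on
      -- the left.
      rcases le_or_gt (s * D) 0 with hle | hgt
      · linarith
      · have hD : D ≤ s * D := by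
          rcases hs with rfl | rfl <;> linarith
        nlinarith [mul_le_mul_of_nonneg_left hD htb]
    -- Grönwall: m' ≤ 4βt·m makes m·exp(-2βt²) decreasing, and m(0) = r.
    have hanti : AntitoneOn (fun t => m s t * Real.exp (-(2 * β * t ^ 2)))
        (Set.Icc 0 (1 / (2 * β))) := by
      have hd2 : ∀ t, HasDerivAt (fun t => m s t * Real.exp (-(2 * β * t ^ 2)))
          (m' t * Real.exp (-(2 * β * t ^ 2)) +
            m s t * (Real.exp (-(2 * β * t ^ 2)) * -(2 * β * (2 * t)))) t := by
        intro t
        refine (hder t).mul (HasDerivAt.exp ?_)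
        refine (((hasDerivAt_pow 2 t).const_mul (2 * β)).fun_neg).congr_deriv ?_
        norm_num
      refine antitoneOn_of_deriv_nonpos (convex_Icc _ _) ?_ ?_ ?_
      · exact fun t _ => (hd2 t).continuousAt.continuousWithinAt
      · exact fun t _ => (hd2 t).differentiableAt.differentiableWithinAt
      · intro t ht
        rw [interior_Icc] at ht
        rw [(hd2 t).deriv]
        have htβ : t * β ≤ 1 / 2 := by
          have := mul_le_mul_of_nonneg_right ht.2.le hβ.le
          refine this.trans_eq ?_
          field_simp
        have := mul_le_mul_of_nonneg_right (hbound t ht.1.le htβ)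
          (Real.exp_pos (-(2 * β * t ^ 2))).le
        linarith
    have hmem : θ ∈ Set.Icc 0 (1 / (2 * β)) := by
      refine ⟨hθ, ?_⟩
      rw [le_div_iff₀ (by positivity)]
      linarith
    have := hanti (Set.left_mem_Icc.mpr (by positivity)) hmem hθ
    have hm0 : m s 0 = r := by
      simp only [hm, mul_zero, zero_mul, Real.exp_zero, Finset.sum_const, Finset.card_univ,
        Fintype.card_fin, nsmul_eq_mul, mul_one]
      have := bernExp_const_mul q (r : ℝ) (fun _ => 1)
      simpa [bernExp_one] using this
    simp only [hm0] at this
    rw [Real.exp_neg, ← div_eq_mul_inv, div_le_iff₀ (Real.exp_pos _)] at this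
    simpa using this
  -- This θ minimizes -θε + 2βθ², with value -ε²/(8β); ε ≤ 2 keeps θβ ≤ 1/2.
  set θ := ε / (4 * β) with hθ
  have hθ0 : 0 ≤ θ := by positivity
  have hθβ : θ * β ≤ 1 / 2 := by
    have : θ * β = ε / 4 := by rw [hθ]; field_simp
    linarith
  have hF := fun s hs => mul_le_mul_of_nonneg_left (hmgf s hs θ hθ0 hθβ)
    (Real.exp_pos (-(θ * ε))).le
  have hB := bernProb_le_bernExp h0 h1
    (B := fun σ => ∃ x : E, ε * ‖x‖ ^ 2 < |∑ i, centeredCoeff q σ i * ⟪w i, x⟫ ^ 2|)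
    (F := fun σ => Real.exp (-(θ * ε)) * (∑ k, Real.exp (1 * θ * lam σ k)) +
      Real.exp (-(θ * ε)) * ∑ k, Real.exp (-1 * θ * lam σ k))
    (fun σ => by positivity) ?_
  · rw [bernExp_add, bernExp_const_mul, bernExp_const_mul] at hB
    refine hB.trans ((add_le_add (hF 1 (Or.inl rfl)) (hF (-1) (Or.inr rfl))).trans_eq ?_)
    have : Real.exp (-(ε ^ 2 / (8 * β))) =
        Real.exp (-(θ * ε)) * Real.exp (2 * β * θ ^ 2) := by
      rw [← Real.exp_add]
      congr 1
      rw [hθ]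
      field_simp
      ring
    rw [this]; ring
  · rintro σ ⟨x, hx⟩
    -- A vector violating the bound forces an eigenvalue outside [-ε, ε], and a single eigenvalue
    -- already makes one of the two trace exponentials large.
    have hex : ∃ k, ε < |lam σ k| := by
      by_contra! hcon
      refine absurd hx (not_lt.mpr ?_)
      have e : ∑ i, centeredCoeff q σ i * ⟪w i, x⟫ ^ 2 = ∑ k, lam σ k * ⟪u σ k, x⟫ ^ 2 := by
        have e1 : ∑ i, centeredCoeff q σ i * ⟪w i, x⟫ ^ 2 = ⟪x, Y σ x⟫ := by
          rw [hY, inner_rankOneSum]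
          exact Finset.sum_congr rfl fun i _ => by ring
        rw [e1, ← (u σ).sum_inner_mul_inner]
        refine Finset.sum_congr rfl fun k _ => ?_
        rw [← hsym σ, heig, real_inner_smul_left, real_inner_comm]; ring
      have e2 : ‖x‖ ^ 2 = ∑ k, ⟪u σ k, x⟫ ^ 2 := by
        rw [← real_inner_self_eq_norm_sq, ← (u σ).sum_inner_mul_inner]
        exact Finset.sum_congr rfl fun k _ => by rw [real_inner_comm]; ring
      rw [e, e2, Finset.mul_sum]
      refine (Finset.abs_sum_le_sum_abs _ _).trans (Finset.sum_le_sum fun k _ => ?_)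
      rw [abs_mul, abs_of_nonneg (sq_nonneg ⟪u σ k, x⟫)]
      exact mul_le_mul_of_nonneg_right (hcon k) (sq_nonneg _)
    obtain ⟨k, hk⟩ := hex
    have hpos : ∀ s : ℝ, 0 ≤ Real.exp (-(θ * ε)) * ∑ k, Real.exp (s * θ * lam σ k) :=
      fun s => by positivity
    have hsingle : ∀ s : ℝ, Real.exp (-(θ * ε)) * Real.exp (s * θ * lam σ k) ≤
        Real.exp (-(θ * ε)) * ∑ k, Real.exp (s * θ * lam σ k) := fun s =>
      mul_le_mul_of_nonneg_left (Finset.single_le_sum (f := fun k => Real.exp (s * θ * lam σ k))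
        (fun _ _ => (Real.exp_pos _).le) (Finset.mem_univ k)) (Real.exp_pos _).le
    rcases lt_abs.mp hk with h | h
    · refine le_trans ?_ ((hsingle 1).trans (le_add_of_nonneg_right (hpos (-1))))
      rw [← Real.exp_add, Real.one_le_exp_iff]
      nlinarith
    · refine le_trans ?_ ((hsingle (-1)).trans (le_add_of_nonneg_left (hpos 1)))
      rw [← Real.exp_add, Real.one_le_exp_iff]
      nlinarith

end MatrixConcentration

end PersonalizedCongest

end

noncomputable section

namespace PersonalizedCongest

/-! ### Chaining for general `p` -/

section Nets

variable {E : Type*} [NormedAddCommGroup E] [NormedSpace ℝ E] [FiniteDimensional ℝ E]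

/-- Volume comparison: the balls of radius γ/2 around the points are disjoint and lie in the ball of
radius 1 + γ/2. -/
lemma card_le_of_separated_unitBall (s : Finset E) (hs : ∀ c ∈ s, ‖c‖ ≤ 1) {γ : ℝ} (hγ : 0 < γ)
    (h : ∀ c ∈ s, ∀ d ∈ s, c ≠ d → γ < ‖c - d‖) :
    (s.card : ℝ) ≤ (1 + 2 / γ) ^ Module.finrank ℝ E := by
  borelize E
  let μ : Measure E := Measure.addHaar
  have hδ : 0 < γ / 2 := by positivity
  have hρ : 0 < 1 + γ / 2 := by positivity
  have D : Set.Pairwise (s : Set E) (Function.onFun Disjoint fun c => Metric.ball (c : E) (γ / 2)) := by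
    rintro c hc d hd hcd
    apply Metric.ball_disjoint_ball
    rw [dist_eq_norm]
    linarith [h c hc d hd hcd]
  have A_subset : (⋃ c ∈ s, Metric.ball (c : E) (γ / 2)) ⊆ Metric.ball (0 : E) (1 + γ / 2) := by
    refine Set.iUnion₂_subset fun x hx => ?_
    apply Metric.ball_subset_ball'
    rw [dist_zero_right]
    linarith [hs x hx]
  have I : (s.card : ℝ≥0∞) * ENNReal.ofReal ((γ / 2) ^ Module.finrank ℝ E) * μ (Metric.ball 0 1) ≤
      ENNReal.ofReal ((1 + γ / 2) ^ Module.finrank ℝ E) * μ (Metric.ball 0 1) :=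
    calc (s.card : ℝ≥0∞) * ENNReal.ofReal ((γ / 2) ^ Module.finrank ℝ E) * μ (Metric.ball 0 1)
        = μ (⋃ c ∈ s, Metric.ball (c : E) (γ / 2)) := by
          rw [measure_biUnion_finset D fun c _ => measurableSet_ball]
          simp only [μ.addHaar_ball_of_pos _ hδ]
          simp only [Finset.sum_const, nsmul_eq_mul, mul_assoc]
      _ ≤ μ (Metric.ball (0 : E) (1 + γ / 2)) := measure_mono A_subset
      _ = _ := by simp only [μ.addHaar_ball_of_pos _ hρ]
  have J : (s.card : ℝ≥0∞) * ENNReal.ofReal ((γ / 2) ^ Module.finrank ℝ E) ≤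
      ENNReal.ofReal ((1 + γ / 2) ^ Module.finrank ℝ E) :=
    (ENNReal.mul_le_mul_iff_left (Metric.measure_ball_pos _ _ zero_lt_one).ne'
      measure_ball_lt_top.ne).1 I
  have K := ENNReal.toReal_le_of_le_ofReal (pow_nonneg hρ.le _) J
  rw [ENNReal.toReal_mul, ENNReal.toReal_natCast, ENNReal.toReal_ofReal (by positivity),
    ← le_div_iff₀ (by positivity), ← div_pow] at K
  refine K.trans_eq (congrArg (· ^ _) ?_)
  field_simp
  ring

/-- Nets of the unit ball of a normed space. -/
lemma exists_net_unitBall {γ : ℝ} (hγ : 0 < γ) :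
    ∃ s : Finset E, (∀ c ∈ s, ‖c‖ ≤ 1) ∧ (∀ x : E, ‖x‖ ≤ 1 → ∃ c ∈ s, ‖x - c‖ ≤ γ) ∧
      (s.card : ℝ) ≤ (1 + 2 / γ) ^ Module.finrank ℝ E := by
  classical
  set P : ℕ → Prop := fun n => ∃ s : Finset E, s.card = n ∧ (∀ c ∈ s, ‖c‖ ≤ 1) ∧
    ∀ c ∈ s, ∀ d ∈ s, c ≠ d → γ < ‖c - d‖ with hP
  have hbdd : BddAbove {n | P n} := by
    refine ⟨⌊(1 + 2 / γ) ^ Module.finrank ℝ E⌋₊, ?_⟩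
    rintro n ⟨s, rfl, h1, h2⟩
    exact Nat.le_floor (card_le_of_separated_unitBall s h1 hγ h2)
  -- A γ-separated set of largest size is a net, for an uncovered point could be added to it.
  obtain ⟨s, hcard, h1, h2⟩ := Nat.sSup_mem (s := {n | P n}) ⟨0, ∅, by simp⟩ hbdd
  refine ⟨s, h1, fun x hx => ?_, card_le_of_separated_unitBall s h1 hγ h2⟩
  by_contra! hcon
  have hxs : x ∉ s := fun hxs => by
    have := hcon x hxs
    simp at this
    linarith
  have : P (s.card + 1) := by
    refine ⟨insert x s, Finset.card_insert_of_notMem hxs, ?_, ?_⟩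
    · intro c hc
      rcases Finset.mem_insert.mp hc with rfl | hc
      exacts [hx, h1 c hc]
    · intro c hc d hd hcd
      rcases Finset.mem_insert.mp hc with hc' | hc' <;>
        rcases Finset.mem_insert.mp hd with hd' | hd'
      · exact absurd (hc'.trans hd'.symm) hcd
      · rw [hc']; exact hcon d hd'
      · rw [hd', norm_sub_rev]; exact hcon c hc'
      · exact h2 c hc' d hd' hcd
  have := le_csSup hbdd this
  omega

end Nets

/-- The mean value inequality for `x ↦ |x|^p`. -/
lemma abs_rpow_sub_rpow_le {p : ℝ} (hp : 1 ≤ p) (x y : ℝ) :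
    |(|x| ^ p - |y| ^ p)| ≤ p * |x - y| * max |x| |y| ^ (p - 1) := by
  have key : ∀ u v : ℝ, 0 ≤ v → v ≤ u → u ^ p - v ^ p ≤ p * (u - v) * u ^ (p - 1) := by
    intro u v hv huv
    rcases (hv.trans huv).eq_or_lt with hu | hu
    · have : v = 0 := le_antisymm (by linarith) hv
      rw [this, ← hu]
      simp
    · have hb := one_add_mul_self_le_rpow_one_add (s := (v - u) / u) (p := p) (by
        rw [le_div_iff₀ hu]; linarith) hp
      have e : 1 + (v - u) / u = v / u := by field_simp; ring
      rw [e, Real.div_rpow hv hu.le, le_div_iff₀ (Real.rpow_pos_of_pos hu p)] at hb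
      have e2 : u ^ p = u ^ (p - 1) * u := by
        rw [Real.rpow_sub_one hu.ne']; field_simp
      have e3 : (1 + p * ((v - u) / u)) * u ^ p = u ^ p + p * (v - u) * u ^ (p - 1) := by
        rw [e2]; field_simp
      rw [e3] at hb
      linarith
  have main : ∀ x y : ℝ, |y| ≤ |x| →
      |(|x| ^ p - |y| ^ p)| ≤ p * |x - y| * max |x| |y| ^ (p - 1) := by
    intro x y h
    rw [max_eq_left h, abs_of_nonneg (sub_nonneg.mpr
      (Real.rpow_le_rpow (abs_nonneg y) h (by linarith)))]
    refine (key _ _ (abs_nonneg y) h).trans ?_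
    have := abs_sub_abs_le_abs_sub x y
    have : 0 ≤ |x| ^ (p - 1) := Real.rpow_nonneg (abs_nonneg x) _
    gcongr
  rcases le_total |y| |x| with h | h
  · exact main x y h
  · rw [abs_sub_comm, abs_sub_comm x y, max_comm]
    exact main y x h

/-- `u v^(p-1) ≤ max(u, v)^p`. -/
lemma mul_rpow_sub_one_le {p u v : ℝ} (hp : 1 ≤ p) (hu : 0 ≤ u) (hv : 0 ≤ v) :
    u * v ^ (p - 1) ≤ max u v ^ p := by
  have hm : 0 ≤ max u v := le_max_of_le_left hu
  have e : max u v ^ p = max u v * max u v ^ (p - 1) := by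
    rw [← Real.rpow_one_add' hm (by linarith)]
    congr 1
    ring
  rw [e]
  exact mul_le_mul (le_max_left _ _) (Real.rpow_le_rpow hv (le_max_right _ _) (by linarith))
    (Real.rpow_nonneg hv _) hm

lemma max_rpow_le_add {p u v : ℝ} (hu : 0 ≤ u) (hv : 0 ≤ v) :
    max u v ^ p ≤ u ^ p + v ^ p := by
  rcases le_total u v with h | h
  · rw [max_eq_right h]; linarith [Real.rpow_nonneg hu p]
  · rw [max_eq_left h]; linarith [Real.rpow_nonneg hv p]

/-! ### Bernstein bounds for increments, and the chaining argument. -/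

section Chaining

variable {E : Type*} [NormedAddCommGroup E] [NormedSpace ℝ E]
  {ι : Type*} [Fintype ι] [DecidableEq ι]

/-- The deviation of the sampled `p`-th power sum at one pair of points. -/
lemma bernProb_increment_le {q : ι → ℝ} (h0 : ∀ i, 0 ≤ q i) (h1 : ∀ i, q i ≤ 1)
    (l : ι → E →ₗ[ℝ] ℝ) {p : ℝ} (hp : 1 ≤ p) (hnorm : ∀ y, ∑ i, |l i y| ^ p = ‖y‖ ^ p)
    {β : ℝ} (hβ : 0 < β) (hq : ∀ i, q i = 1 ∨ ∀ y, |l i y| ^ p ≤ β * q i * ‖y‖ ^ p)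
    {a b : E} (ha : ‖a‖ ≤ 1) (hb : ‖b‖ ≤ 1) {D : ℝ} (hD : 0 < D) (hab : ‖a - b‖ ≤ D)
    {θ t : ℝ} (hθ0 : 0 ≤ θ) (hθ : θ * (p * D * β) ≤ 1) :
    bernProb q (fun σ => t < |∑ i, centeredCoeff q σ i * |l i a| ^ p -
        ∑ i, centeredCoeff q σ i * |l i b| ^ p|) ≤
      2 * Real.exp (-(θ * t) + θ ^ 2 * (3 * p ^ 2 * β * D ^ 2)) := by
  have hp0 : 0 < p := by linarith
  set c : ι → ℝ := fun i => |l i a| ^ p - |l i b| ^ p with hc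
  have hone : ∀ y : E, ‖y‖ ≤ 1 → ‖y‖ ^ p ≤ 1 := fun y hy =>
    Real.rpow_le_one (norm_nonneg y) hy hp0.le
  -- On the unit ball each functional is at most A = (βq)^(1/p), and at most AD on differences of
  -- norm D; the mean value inequality then gives p·D·A^p.
  have hcb : ∀ i, q i ≠ 1 → |c i| ≤ p * D * β * q i := by
    intro i hi
    have hi' := (hq i).resolve_left hi
    have hA : ∀ y, |l i y| ≤ (β * q i) ^ (1 / p) * ‖y‖ := by
      intro y
      have h := Real.rpow_le_rpow (by positivity) (hi' y) (by positivity : 0 ≤ 1 / p)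
      have hbq : 0 ≤ β * q i := mul_nonneg hβ.le (h0 i)
      rwa [Real.mul_rpow hbq (by positivity), ← Real.rpow_mul (abs_nonneg _),
        ← Real.rpow_mul (norm_nonneg _), mul_one_div_cancel hp0.ne', Real.rpow_one,
        Real.rpow_one] at h
    set A := (β * q i) ^ (1 / p) with hAdef
    have hbq : 0 ≤ β * q i := mul_nonneg hβ.le (h0 i)
    have hA0 : 0 ≤ A := Real.rpow_nonneg hbq _
    have hAp : A * A ^ (p - 1) = β * q i := by
      rw [← Real.rpow_one_add' hA0 (by linarith), hAdef, ← Real.rpow_mul hbq]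
      have : 1 / p * (1 + (p - 1)) = 1 := by field_simp; ring
      rw [this, Real.rpow_one]
    have m1 : max |l i a| |l i b| ≤ A := max_le
      ((hA a).trans (mul_le_of_le_one_right hA0 ha)) ((hA b).trans (mul_le_of_le_one_right hA0 hb))
    have m2 : |l i a - l i b| ≤ A * D := by
      rw [← map_sub]
      exact (hA _).trans (mul_le_mul_of_nonneg_left hab hA0)
    calc |c i| ≤ p * |l i a - l i b| * max |l i a| |l i b| ^ (p - 1) :=
          abs_rpow_sub_rpow_le hp _ _
      _ ≤ p * (A * D) * A ^ (p - 1) := by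
          gcongr
      _ = p * D * (A * A ^ (p - 1)) := by ring
      _ = p * D * β * q i := by rw [hAp]; ring
  have hsum : ∑ i, |c i| ≤ 3 * p * D := by
    -- The difference a - b is normalized by D, so that Young's inequality costs only the p-th power
    -- sums of three vectors of norm at most 1.
    have hle : ∀ i, |c i| ≤ p * D * (|l i ((1 / D) • (a - b))| ^ p + |l i a| ^ p + |l i b| ^ p) := by
      intro i
      have e : |l i a - l i b| = D * |l i ((1 / D) • (a - b))| := by
        rw [map_smul, map_sub, smul_eq_mul, abs_mul, abs_of_pos (by positivity : 0 < 1 / D)]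
        field_simp
      calc |c i| ≤ p * |l i a - l i b| * max |l i a| |l i b| ^ (p - 1) :=
            abs_rpow_sub_rpow_le hp _ _
        _ = p * D * (|l i ((1 / D) • (a - b))| * max |l i a| |l i b| ^ (p - 1)) := by
            rw [e]; ring
        _ ≤ _ := by
            refine mul_le_mul_of_nonneg_left ?_ (by positivity)
            have hm : 0 ≤ max |l i a| |l i b| := le_max_of_le_left (abs_nonneg _)
            refine (mul_rpow_sub_one_le hp (abs_nonneg _) hm).trans
              ((max_rpow_le_add (abs_nonneg _) hm).trans ?_)
            rw [add_assoc]
            exact add_le_add_right (max_rpow_le_add (abs_nonneg _) (abs_nonneg _)) _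
    refine (Finset.sum_le_sum fun i _ => hle i).trans ?_
    rw [← Finset.mul_sum, Finset.sum_add_distrib, Finset.sum_add_distrib, hnorm, hnorm, hnorm]
    have hn : ‖(1 / D) • (a - b)‖ ≤ 1 := by
      rw [norm_smul, Real.norm_of_nonneg (by positivity : 0 ≤ 1 / D), one_div_mul_eq_div,
        div_le_one hD]
      exact hab
    have : p * D * (‖(1 / D) • (a - b)‖ ^ p + ‖a‖ ^ p + ‖b‖ ^ p) ≤ p * D * (1 + 1 + 1) := by
      have := hone _ hn
      have := hone _ ha
      have := hone _ hb
      gcongr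
    linarith
  have hB := bernProb_bernstein_abs h0 h1 c (θ := θ) (t := t) (V := 3 * p ^ 2 * β * D ^ 2) ?_ hθ0 ?_
  · refine le_trans (bernProb_mono h0 h1 fun σ hσ => ?_) hB
    rw [← Finset.sum_sub_distrib] at hσ
    simpa only [hc, mul_sub, centeredCoeff] using hσ
  · intro i
    by_cases hi : q i = 1
    · exact Or.inl hi
    · right
      have := mul_le_mul_of_nonneg_left (hcb i hi) hθ0
      have h2 := mul_le_mul_of_nonneg_right hθ (h0 i)
      linarith
  -- The variance is at most the largest ratio |c|/q times the sum of |c|.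
  · calc ∑ i, (if q i = 1 then 0 else c i ^ 2 / q i) ≤ ∑ i, p * D * β * |c i| := by
          refine Finset.sum_le_sum fun i _ => ?_
          split_ifs with hi
          · positivity
          · rcases (h0 i).eq_or_lt with hq0 | hq0
            · rw [← hq0]; simp; positivity
            · rw [div_le_iff₀ hq0, ← sq_abs]
              nlinarith [mul_le_mul_of_nonneg_left (hcb i hi) (abs_nonneg (c i))]
      _ = p * D * β * ∑ i, |c i| := by rw [Finset.mul_sum]
      _ ≤ p * D * β * (3 * p * D) := mul_le_mul_of_nonneg_left hsum (by positivity)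
      _ = _ := by ring

variable [FiniteDimensional ℝ E]

/-- Uniform concentration of the sampled `p`-th power sums, by chaining. -/
lemma bernProb_chaining {q : ι → ℝ} (h0 : ∀ i, 0 ≤ q i) (h1 : ∀ i, q i ≤ 1)
    (l : ι → E →ₗ[ℝ] ℝ) {p : ℝ} (hp : 1 ≤ p) (hnorm : ∀ y, ∑ i, |l i y| ^ p = ‖y‖ ^ p)
    {β : ℝ} (hβ : 0 < β) (hq : ∀ i, q i = 1 ∨ ∀ y, |l i y| ^ p ≤ β * q i * ‖y‖ ^ p)
    {ε L : ℝ} (hε : 0 < ε) (hε1 : ε ≤ 1) (hL : 1 ≤ L)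
    (hκ : 768 * p ^ 2 * (6 * (Module.finrank ℝ E + L)) ≤ ε ^ 2 / β) :
    bernProb q (fun σ => ∃ y, ε * ‖y‖ ^ p < |∑ i, centeredCoeff q σ i * |l i y| ^ p|) ≤
      Real.exp (-(4 * L)) := by
  classical
  have hp0 : 0 < p := by linarith
  set r := Module.finrank ℝ E with hr
  have hnet : ∀ k : ℕ, ∃ s : Finset E, (∀ c ∈ s, ‖c‖ ≤ 1) ∧
      (∀ x : E, ‖x‖ ≤ 1 → ∃ c ∈ s, ‖x - c‖ ≤ (1 / 2) ^ k) ∧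
      (s.card : ℝ) ≤ (1 + 2 / (1 / 2) ^ k) ^ r ∧ (k = 0 → ∀ c ∈ s, c = 0) := by
    intro k
    -- At level 0 the net is {0}, so every chain starts at a point where the process vanishes.
    rcases k.eq_zero_or_pos with rfl | hk
    · refine ⟨{0}, by simp, fun x hx => ⟨0, by simp, by simpa using hx⟩, ?_, by simp⟩
      simp only [Finset.card_singleton, Nat.cast_one]
      exact one_le_pow₀ (by norm_num)
    · obtain ⟨s, a, b, c⟩ := exists_net_unitBall (E := E) (γ := (1 / 2) ^ k) (by positivity)
      exact ⟨s, a, b, c, fun h => by omega⟩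
  choose N hN1 hNcov hNcard hN0 using hnet
  set Z : Finset ι → E → ℝ := fun σ y => ∑ i, centeredCoeff q σ i * |l i y| ^ p with hZ
  -- Links at level k have length at most 2^(-k) + 2^(-k-1) ≤ 2·2^(-k), and the allowances
  -- ε(3/4)^k/4 add up to ε over all levels.
  set B : ℕ → Finset ι → Prop := fun k σ => ∃ e ∈ N k ×ˢ N (k + 1),
    ‖e.1 - e.2‖ ≤ 2 * (1 / 2) ^ k ∧ ε * (3 / 4) ^ k / 4 < |Z σ e.1 - Z σ e.2| with hB
  have hexp1 : (2 : ℝ) ≤ Real.exp 1 := by linarith [Real.add_one_le_exp 1]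
  have hcard : ∀ k : ℕ, ((N k).card : ℝ) ≤ Real.exp (r * (2 + k)) := by
    intro k
    refine (hNcard k).trans ?_
    rw [Real.exp_nat_mul]
    refine pow_le_pow_left₀ (by positivity) ?_ _
    have e1 : (2 : ℝ) / (1 / 2) ^ k = 2 * 2 ^ k := by rw [one_div, inv_pow]; field_simp
    have e2 : Real.exp (2 + k) = Real.exp 1 * Real.exp 1 * Real.exp 1 ^ k := by
      rw [← Real.exp_nat_mul, ← Real.exp_add, ← Real.exp_add]
      congr 1; ring
    rw [e1, e2]
    have e3 : (2 : ℝ) ^ k ≤ Real.exp 1 ^ k := pow_le_pow_left₀ (by norm_num) hexp1 k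
    have e4 : (1 : ℝ) ≤ 2 ^ k := one_le_pow₀ (by norm_num)
    have e5 : (4 : ℝ) ≤ Real.exp 1 * Real.exp 1 := by nlinarith
    nlinarith
  have hlevel : ∀ k : ℕ, bernProb q (B k) ≤ 2 * Real.exp (-(6 * L)) * (1 / 2) ^ k := by
    intro k
    -- The allowance shrinks like (3/4)^k but the link length like 2^(-k). With this θ the linear
    -- term of the exponent grows like (3/2)^k, while the variance term is the constant ε²/(768p²β),
    -- which is at least 6(r + L) by `hκ`.
    set θ : ℝ := ε * 2 ^ k * (1 / (96 * p ^ 2)) / β with hθ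
    have h2k : (2 : ℝ) ^ k * (1 / 2) ^ k = 1 := by rw [← mul_pow]; norm_num
    have hlink : ∀ e ∈ N k ×ˢ N (k + 1), bernProb q (fun σ => ‖e.1 - e.2‖ ≤ 2 * (1 / 2) ^ k ∧
        ε * (3 / 4) ^ k / 4 < |Z σ e.1 - Z σ e.2|) ≤
          2 * Real.exp (-(6 * (r + L) * (1 + k / 2))) := by
      intro e he
      rw [Finset.mem_product] at he
      by_cases hd : ‖e.1 - e.2‖ ≤ 2 * (1 / 2) ^ k
      · refine (bernProb_mono h0 h1 fun σ hσ => hσ.2).trans ?_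
        refine (bernProb_increment_le h0 h1 l hp hnorm hβ hq (hN1 _ _ he.1) (hN1 _ _ he.2)
          (by positivity) hd (θ := θ) (by positivity) ?_).trans ?_
        · have : θ * (p * (2 * (1 / 2) ^ k) * β) = ε * (2 ^ k * (1 / 2) ^ k) * (1 / (48 * p)) := by
            rw [hθ]; field_simp; norm_num
          rw [this, h2k, mul_one]
          have : 1 / (48 * p) ≤ 1 := by
            rw [div_le_one (by positivity)]; linarith
          nlinarith [(by positivity : 0 < 1 / (48 * p))]
        · refine mul_le_mul_of_nonneg_left (Real.exp_le_exp.mpr ?_) (by norm_num)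
          have e1 : θ * (ε * (3 / 4) ^ k / 4) = ε ^ 2 / β * (1 / (384 * p ^ 2)) * (3 / 2) ^ k := by
            have : (3 / 2 : ℝ) ^ k = 2 ^ k * (3 / 4) ^ k := by rw [← mul_pow]; norm_num
            rw [hθ, this]; field_simp; norm_num
          have e2 : θ ^ 2 * (3 * p ^ 2 * β * (2 * (1 / 2) ^ k) ^ 2) =
              ε ^ 2 / β * (1 / (768 * p ^ 2)) * (2 ^ k * (1 / 2) ^ k) ^ 2 := by
            rw [hθ]; field_simp; norm_num
          rw [e1, e2, h2k, one_pow, mul_one]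
          have hb := one_add_mul_le_pow (a := (1 / 2 : ℝ)) (by norm_num) k
          have hb' : 1 + (k : ℝ) / 2 ≤ (3 / 2) ^ k := by
            have : (1 + 1 / 2 : ℝ) = 3 / 2 := by norm_num
            rw [this] at hb; linarith
          have hk0 : (0 : ℝ) ≤ k := Nat.cast_nonneg k
          have hX : 6 * (r + L) ≤ ε ^ 2 / β * (1 / (768 * p ^ 2)) := by
            rw [mul_one_div, le_div_iff₀ (by positivity)]
            linarith
          have e3 : ε ^ 2 / β * (1 / (384 * p ^ 2)) = 2 * (ε ^ 2 / β * (1 / (768 * p ^ 2))) := by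
            field_simp; norm_num
          rw [e3]
          set X := ε ^ 2 / β * (1 / (768 * p ^ 2)) with hXdef
          have hX0 : 0 ≤ X := by positivity
          have h3 : (1 : ℝ) ≤ (3 / 2) ^ k := by linarith
          have g1 : 6 * (r + L) * (1 + k / 2) ≤ X * (3 / 2) ^ k :=
            mul_le_mul hX hb' (by linarith) hX0
          have g2 : X ≤ X * (3 / 2) ^ k := le_mul_of_one_le_right hX0 h3
          linarith
      · refine le_trans (le_of_eq ?_) (by positivity)
        refine Finset.sum_eq_zero fun σ _ => if_neg fun h => hd h.1
    refine (bernProb_exists_le _ h0 h1 _).trans ((Finset.sum_le_card_nsmul _ _ _ hlink).trans ?_)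
    rw [nsmul_eq_mul, Finset.card_product, Nat.cast_mul]
    calc ((N k).card : ℝ) * (N (k + 1)).card * (2 * Real.exp (-(6 * (r + L) * (1 + k / 2))))
        ≤ Real.exp (r * (2 + k)) * Real.exp (r * (2 + (k + 1 : ℕ))) *
            (2 * Real.exp (-(6 * (r + L) * (1 + k / 2)))) := by
          gcongr
          exacts [hcard k, hcard (k + 1)]
      _ = 2 * Real.exp (r * (2 + k) + r * (2 + (k + 1 : ℕ)) - 6 * (r + L) * (1 + k / 2)) := by
          rw [sub_eq_add_neg, Real.exp_add, Real.exp_add]; ring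
      _ ≤ 2 * Real.exp (-(6 * L) + -k) := by
          -- The two nets cost r(5 + 2k), less than the part 6r(1 + k/2) of the gain; the rest, with
          -- L ≥ 1, leaves at least 6L + k.
          refine mul_le_mul_of_nonneg_left (Real.exp_le_exp.mpr ?_) (by norm_num)
          have hk0 : (0 : ℝ) ≤ k := Nat.cast_nonneg k
          have hr0 : (0 : ℝ) ≤ r := Nat.cast_nonneg r
          push_cast
          nlinarith [mul_nonneg hr0 hk0, mul_le_mul_of_nonneg_right hL hk0]
      _ = 2 * Real.exp (-(6 * L)) * (Real.exp (-1)) ^ k := by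
          rw [Real.exp_add, ← Real.exp_nat_mul]
          ring_nf
      _ ≤ 2 * Real.exp (-(6 * L)) * (1 / 2) ^ k := by
          gcongr
          rw [Real.exp_neg, one_div]
          exact inv_anti₀ (by norm_num) hexp1
  have hunion : bernProb q (fun σ => ∃ k, B k σ) ≤ Real.exp (-(4 * L)) := by
    refine bernProb_exists_nat_le h0 h1 B fun K => ?_
    refine (Finset.sum_le_sum fun k _ => hlevel k).trans ?_
    rw [← Finset.mul_sum]
    have hgeo : ∑ k ∈ Finset.range K, (1 / 2 : ℝ) ^ k ≤ 2 := by
      have := Summable.sum_le_tsum (Finset.range K)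
        (fun k _ => by positivity : ∀ k ∉ Finset.range K, (0 : ℝ) ≤ (1 / 2) ^ k)
        summable_geometric_two
      rwa [tsum_geometric_two] at this
    have e : Real.exp (-(4 * L)) = Real.exp (-(6 * L)) * Real.exp (2 * L) := by
      rw [← Real.exp_add]; congr 1; ring
    have e2 : 4 ≤ Real.exp (2 * L) := by
      have : Real.exp 1 * Real.exp 1 ≤ Real.exp (2 * L) := by
        rw [← Real.exp_add]
        exact Real.exp_le_exp.mpr (by linarith)
      nlinarith
    rw [e]
    have h6 := Real.exp_pos (-(6 * L))
    nlinarith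
  refine (bernProb_mono h0 h1 fun σ hσ => ?_).trans hunion
  by_contra! hcon
  obtain ⟨y, hy⟩ := hσ
  have hZ0 : Z σ 0 = 0 := by
    simp [hZ, Real.zero_rpow hp0.ne']
  have hZc : Continuous (Z σ) := by
    refine continuous_finsetSum _ fun i _ => continuous_const.mul ?_
    have : Continuous (l i) := (l i).continuous_of_finiteDimensional
    exact this.abs.rpow_const fun _ => Or.inr hp0.le
  have hball : ∀ y : E, ‖y‖ ≤ 1 → |Z σ y| ≤ ε := by
    intro y hy
    choose f hfN hf using fun k => hNcov k y hy
    -- Telescoping along the chain: 1 - (3/4)^k is the partial sum of (3/4)^k/4. Continuity carries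
    -- the bound to the limit point y, and homogeneity to all vectors.
    have hstep : ∀ k, |Z σ (f k)| ≤ ε * (1 - (3 / 4) ^ k) := by
      intro k
      induction k with
      | zero => rw [hN0 0 rfl _ (hfN 0), hZ0]; simp
      | succ k ih =>
        have hno := hcon k
        simp only [hB, not_exists, not_and, not_lt] at hno
        have hd : ‖f k - f (k + 1)‖ ≤ 2 * (1 / 2) ^ k := by
          have e : f k - f (k + 1) = (y - f (k + 1)) - (y - f k) := by abel
          rw [e]
          refine (norm_sub_le _ _).trans ((add_le_add (hf (k + 1)) (hf k)).trans ?_)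
          rw [pow_succ]
          have : (0 : ℝ) < (1 / 2) ^ k := by positivity
          linarith
        have hinc := hno (f k, f (k + 1)) (Finset.mk_mem_product (hfN k) (hfN (k + 1))) hd
        have e : Z σ (f (k + 1)) = Z σ (f k) - (Z σ (f k) - Z σ (f (k + 1))) := by ring
        rw [e]
        refine (abs_sub _ _).trans ((add_le_add ih hinc).trans (le_of_eq ?_))
        rw [pow_succ]; ring
    have hlim : Filter.Tendsto f Filter.atTop (nhds y) := by
      rw [tendsto_iff_norm_sub_tendsto_zero]
      refine squeeze_zero (fun k => norm_nonneg _) (fun k => ?_)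
        (tendsto_pow_atTop_nhds_zero_of_lt_one (r := (1 / 2 : ℝ)) (by norm_num) (by norm_num))
      rw [norm_sub_rev]
      exact hf k
    have hlimZ := ((hZc.tendsto y).comp hlim).abs
    refine le_of_tendsto' hlimZ fun k => (hstep k).trans ?_
    have : (0 : ℝ) < (3 / 4) ^ k := by positivity
    nlinarith
  have hhom : ∀ (s : ℝ) (y : E), Z σ (s • y) = |s| ^ p * Z σ y := by
    intro s y
    simp only [hZ, Finset.mul_sum]
    refine Finset.sum_congr rfl fun i _ => ?_
    rw [map_smul, smul_eq_mul, abs_mul, Real.mul_rpow (abs_nonneg _) (abs_nonneg _)]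
    ring
  refine absurd hy (not_lt.mpr ?_)
  rcases eq_or_ne y 0 with rfl | hy0
  · have : Z σ 0 = ∑ i, centeredCoeff q σ i * |l i 0| ^ p := rfl
    rw [← this, hZ0]
    simp [Real.zero_rpow hp0.ne']
  · have hn : 0 < ‖y‖ := norm_pos_iff.mpr hy0
    have h := hball (‖y‖⁻¹ • y) (by rw [norm_smul, norm_inv, norm_norm, inv_mul_cancel₀ hn.ne'])
    have e : Z σ y = ‖y‖ ^ p * Z σ (‖y‖⁻¹ • y) := by
      have := hhom ‖y‖ (‖y‖⁻¹ • y)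
      rwa [smul_smul, mul_inv_cancel₀ hn.ne', one_smul, abs_of_pos hn] at this
    have : Z σ y = ∑ i, centeredCoeff q σ i * |l i y| ^ p := rfl
    rw [← this, e, abs_mul, abs_of_nonneg (by positivity : 0 ≤ ‖y‖ ^ p), mul_comm]
    exact mul_le_mul_of_nonneg_right h (by positivity)

end Chaining

end PersonalizedCongest

end

noncomputable section

namespace PersonalizedCongest

/-! ### Lewis weights and the sum of the sensitivities -/

section Lewis

open scoped RealInnerProductSpace

/-- The first variation of ‖a‖^p under a ↦ (1 + s x xᵀ)a. The squared norm is a polynomial in s,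
positive at 0 unless a = 0; for a = 0 the curve is constant, so small p causes no singularity. -/
lemma hasDerivAt_norm_add_smul_rpow {E : Type*} [NormedAddCommGroup E] [InnerProductSpace ℝ E]
    (p : ℝ) (a x : E) :
    HasDerivAt (fun s : ℝ => ‖a + (s * ⟪a, x⟫) • x‖ ^ p) (p * (‖a‖ ^ (p - 2) * ⟪a, x⟫ ^ 2)) 0 := by
  rcases eq_or_ne a 0 with rfl | ha
  · simpa using hasDerivAt_const (0 : ℝ) (‖(0 : E)‖ ^ p)
  have hn : 0 < ‖a‖ := norm_pos_iff.mpr ha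
  have hsq : ∀ s : ℝ, ‖a + (s * ⟪a, x⟫) • x‖ ^ p =
      (‖a‖ ^ 2 + 2 * ⟪a, x⟫ ^ 2 * s + ⟪a, x⟫ ^ 2 * ‖x‖ ^ 2 * s ^ 2) ^ (p / 2) := by
    intro s
    have : ‖a‖ ^ 2 + 2 * ⟪a, x⟫ ^ 2 * s + ⟪a, x⟫ ^ 2 * ‖x‖ ^ 2 * s ^ 2 =
        ‖a + (s * ⟪a, x⟫) • x‖ ^ 2 := by
      rw [norm_add_sq_real, inner_smul_right, norm_smul, mul_pow, Real.norm_eq_abs, sq_abs]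
      ring
    rw [this, ← Real.rpow_natCast_mul (norm_nonneg _)]
    congr 1
    push_cast
    ring
  simp only [hsq]
  have h1 : HasDerivAt (fun s : ℝ => ‖a‖ ^ 2 + 2 * ⟪a, x⟫ ^ 2 * s + ⟪a, x⟫ ^ 2 * ‖x‖ ^ 2 * s ^ 2)
      (2 * ⟪a, x⟫ ^ 2) 0 := by
    refine ((((hasDerivAt_id (0 : ℝ)).const_mul (2 * ⟪a, x⟫ ^ 2)).const_add (‖a‖ ^ 2)).add
      ((hasDerivAt_pow 2 (0 : ℝ)).const_mul (⟪a, x⟫ ^ 2 * ‖x‖ ^ 2))).congr_deriv ?_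
    simp
  have h2 := h1.rpow_const (p := p / 2) (Or.inl (by simp [ha]))
  refine h2.congr_deriv ?_
  have : (‖a‖ ^ 2) ^ (p / 2 - 1) = ‖a‖ ^ (p - 2) := by
    rw [← Real.rpow_natCast_mul (norm_nonneg _)]
    congr 1
    push_cast
    ring
  simp only [mul_zero, add_zero, ne_eq, OfNat.ofNat_ne_zero, not_false_eq_true, zero_pow, this]
  ring

variable {n : Type*} {r : ℕ}

/-- The rows of a matrix as vectors of a Euclidean space. -/
def euclideanRow (B : Matrix n (Fin r) ℝ) (i : n) : EuclideanSpace ℝ (Fin r) :=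
  WithLp.toLp 2 (B i)

lemma inner_euclideanRow (B : Matrix n (Fin r) ℝ) (i : n) (x : EuclideanSpace ℝ (Fin r)) :
    ⟪euclideanRow B i, x⟫ = (B *ᵥ x.ofLp) i := by
  simp [euclideanRow, PiLp.inner_apply, Matrix.mulVec, dotProduct, mul_comm]

/-- Lewis' change of position: after an invertible change of coordinates, the rows, weighted by
powers of their norms, are isotropic. -/
lemma exists_lewis_position [Fintype n] {p : ℝ} (hp : 1 ≤ p) (hr : 0 < r) (B : Matrix n (Fin r) ℝ)
    (hB : ∀ c, B *ᵥ c = 0 → c = 0) :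
    ∃ (R : Matrix (Fin r) (Fin r) ℝ) (lam : ℝ), IsUnit R.det ∧ 0 < lam ∧
      (∀ x, ∑ i, ‖euclideanRow (B * R) i‖ ^ (p - 2) * ⟪euclideanRow (B * R) i, x⟫ ^ 2 =
        lam * ‖x‖ ^ 2) ∧
      ∑ i, ‖euclideanRow (B * R) i‖ ^ p = lam * r := by
  have hp0 : 0 < p := by linarith
  have hr0 : (0 : ℝ) < r := Nat.cast_pos.mpr hr
  have : Nonempty (Fin r) := ⟨⟨0, hr⟩⟩
  set T : Matrix (Fin r) (Fin r) ℝ →ₗ[ℝ] (n → EuclideanSpace ℝ (Fin r)) :=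
    { toFun := fun R i => euclideanRow (B * R) i
      map_add' := fun R R' => by
        ext i k
        simp [euclideanRow, Matrix.mul_add]
      map_smul' := fun c R => by
        ext i k
        simp [euclideanRow] } with hT
  have hTinj : LinearMap.ker T = ⊥ := by
    rw [LinearMap.ker_eq_bot']
    intro R hR
    ext j k
    have : (fun j => R j k) = 0 := hB _ (by
      ext i
      have := congrArg (fun v => v k) (congrFun hR i)
      simpa [hT, euclideanRow, Matrix.mul_apply, Matrix.mulVec, dotProduct] using this)
    exact congrFun this j
  set Q : Matrix (Fin r) (Fin r) ℝ → ℝ := fun R => ∑ i, ‖T R i‖ ^ p with hQ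
  have hTcont : Continuous T := T.continuous_of_finiteDimensional
  have hQcont : Continuous Q := continuous_finsetSum _ fun i _ =>
    (((continuous_apply i).comp hTcont).norm).rpow_const fun _ => Or.inr hp0.le
  -- Injectivity of T makes Q coercive, so Q attains a minimum on the closed set of matrices of
  -- determinant 1.
  have hQlim : Filter.Tendsto Q (Filter.cocompact _) Filter.atTop := by
    have h1 := (LinearMap.isClosedEmbedding_of_injective hTinj).tendsto_cocompact
    have h2 : Filter.Tendsto (fun v : n → EuclideanSpace ℝ (Fin r) => ‖v‖ ^ p)
        (Filter.cocompact _) Filter.atTop :=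
      (tendsto_rpow_atTop hp0).comp tendsto_norm_cocompact_atTop
    refine Filter.tendsto_atTop_mono (fun R => ?_) (h2.comp h1)
    simp only [Function.comp, hQ]
    have hnn : ∀ i ∈ Finset.univ, 0 ≤ ‖T R i‖ ^ p := fun i _ =>
      Real.rpow_nonneg (norm_nonneg _) _
    have hS : 0 ≤ ∑ i, ‖T R i‖ ^ p := Finset.sum_nonneg hnn
    have : ‖T R‖ ≤ (∑ i, ‖T R i‖ ^ p) ^ (1 / p) := by
      refine (pi_norm_le_iff_of_nonneg (Real.rpow_nonneg hS _)).mpr fun i => ?_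
      have := Real.rpow_le_rpow (Real.rpow_nonneg (norm_nonneg _) _)
        (Finset.single_le_sum hnn (Finset.mem_univ i)) (by positivity : 0 ≤ 1 / p)
      rwa [← Real.rpow_mul (norm_nonneg _), mul_one_div_cancel hp0.ne', Real.rpow_one] at this
    have h3 := Real.rpow_le_rpow (norm_nonneg _) this hp0.le
    rwa [← Real.rpow_mul hS, one_div_mul_cancel hp0.ne', Real.rpow_one] at h3
  obtain ⟨R, hRdet, hRmin⟩ : ∃ R ∈ {R : Matrix (Fin r) (Fin r) ℝ | R.det = 1},
      IsMinOn Q {R : Matrix (Fin r) (Fin r) ℝ | R.det = 1} R := by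
    refine hQcont.continuousOn.exists_isMinOn' (x₀ := 1) ?_ (by simp) ?_
    · exact isClosed_singleton.preimage (continuous_id.matrix_det)
    · exact Filter.Eventually.filter_mono inf_le_left (hQlim.eventually_ge_atTop (Q 1))
  have hRdet1 : R.det = 1 := hRdet
  -- Homogeneity removes the constraint: rescaling M to determinant 1 compares it with the
  -- minimizer, so a first-order condition can be read off without a multiplier.
  have hscale : ∀ M : Matrix (Fin r) (Fin r) ℝ, 0 < M.det → Q R * M.det ^ (p / r) ≤ Q M := by
    intro M hM
    set c : ℝ := M.det ^ (-(1 / r : ℝ)) with hc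
    have hc0 : 0 < c := Real.rpow_pos_of_pos hM _
    have hcdet : (c • M).det = 1 := by
      rw [Matrix.det_smul, Fintype.card_fin, hc, ← Real.rpow_mul_natCast hM.le]
      have : -(1 / (r : ℝ)) * r = -1 := by field_simp
      rw [this, Real.rpow_neg_one, inv_mul_cancel₀ hM.ne']
    have h1 : Q R ≤ Q (c • M) := hRmin hcdet
    have h2 : Q (c • M) = c ^ p * Q M := by
      simp only [hQ, map_smul, Pi.smul_apply, norm_smul, Finset.mul_sum]
      refine Finset.sum_congr rfl fun i _ => ?_
      rw [Real.mul_rpow (norm_nonneg _) (norm_nonneg _), Real.norm_of_nonneg hc0.le]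
    have h3 : c ^ p * M.det ^ (p / r) = 1 := by
      rw [hc, ← Real.rpow_mul hM.le, ← Real.rpow_add hM]
      have : -(1 / (r : ℝ)) * p + p / r = 0 := by ring
      rw [this, Real.rpow_zero]
    rw [h2] at h1
    calc Q R * M.det ^ (p / r) ≤ c ^ p * Q M * M.det ^ (p / r) :=
          mul_le_mul_of_nonneg_right h1 (Real.rpow_nonneg hM.le _)
      _ = Q M * (c ^ p * M.det ^ (p / r)) := by ring
      _ = Q M := by rw [h3, mul_one]
  have hQR : Q R = ∑ i, ‖euclideanRow (B * R) i‖ ^ p := rfl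
  have hQpos : 0 < Q R := by
    refine lt_of_le_of_ne (Finset.sum_nonneg fun i _ => Real.rpow_nonneg (norm_nonneg _) _)
      fun h0 => ?_
    have hz : T R = 0 := by
      ext1 i
      have := (Finset.sum_eq_zero_iff_of_nonneg fun i _ =>
        Real.rpow_nonneg (norm_nonneg (T R i)) p).mp h0.symm i (Finset.mem_univ i)
      rw [Real.rpow_eq_zero (norm_nonneg _) hp0.ne', norm_eq_zero] at this
      exact this
    have hR0 : R = 0 := by
      have : R ∈ LinearMap.ker T := hz
      rwa [hTinj, Submodule.mem_bot] at this
    rw [hR0, Matrix.det_zero] at hRdet1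
    exact zero_ne_one hRdet1
  refine ⟨R, Q R / r, by rw [hRdet1]; exact isUnit_one, by positivity, fun x => ?_, ?_⟩
  swap
  · rw [← hQR]; field_simp
  set a : n → EuclideanSpace ℝ (Fin r) := fun i => euclideanRow (B * R) i with ha
  set g : ℝ → ℝ := fun s => ∑ i, ‖a i + (s * ⟪a i, x⟫) • x‖ ^ p -
    Q R * (1 + s * ‖x‖ ^ 2) ^ (p / r) with hg
  have hg0 : g 0 = 0 := by
    simp [hg, hQR, ha]
  have hmin : IsLocalMin g 0 := by
    have hpos : ∀ᶠ s : ℝ in nhds 0, 0 < 1 + s * ‖x‖ ^ 2 := by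
      have : Continuous fun s : ℝ => 1 + s * ‖x‖ ^ 2 := by fun_prop
      exact (this.tendsto 0).eventually_const_lt (by simp)
    filter_upwards [hpos] with s hs
    rw [hg0]
    -- The rank one perturbation R(1 + s x xᵀ) has determinant 1 + s‖x‖², so stationarity at s = 0
    -- is the isotropy identity at x.
    set M : Matrix (Fin r) (Fin r) ℝ := R * (1 + Matrix.replicateCol Unit (s • x.ofLp) *
      Matrix.replicateRow Unit x.ofLp) with hM
    have hxx : x.ofLp ⬝ᵥ x.ofLp = ‖x‖ ^ 2 := by
      rw [EuclideanSpace.real_norm_sq_eq]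
      exact Finset.sum_congr rfl fun k _ => (sq _).symm
    have hdet : M.det = 1 + s * ‖x‖ ^ 2 := by
      rw [hM, Matrix.det_mul, hRdet1, one_mul, Matrix.det_one_add_replicateCol_mul_replicateRow,
        dotProduct_smul, hxx, smul_eq_mul]
    have hrow : ∀ i, T M i = a i + (s * ⟪a i, x⟫) • x := by
      intro i
      rw [ha, inner_euclideanRow]
      ext k
      simp only [hT, LinearMap.coe_mk, AddHom.coe_mk, hM, euclideanRow, ← Matrix.mul_assoc,
        Matrix.mul_add, Matrix.mul_one, PiLp.add_apply, PiLp.smul_apply, Matrix.add_apply,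
        smul_eq_mul]
      congr 1
      simp only [Matrix.mul_apply, Matrix.replicateCol_apply, Matrix.replicateRow_apply,
        Finset.univ_unique, Finset.sum_singleton, Matrix.mulVec, dotProduct, Pi.smul_apply,
        smul_eq_mul, Finset.mul_sum, Finset.sum_mul]
      exact Finset.sum_congr rfl fun j _ => Finset.sum_congr rfl fun m _ => by ring
    have := hscale M (by rw [hdet]; exact hs)
    rw [hdet] at this
    simp only [hg]
    have e : Q M = ∑ i, ‖a i + (s * ⟪a i, x⟫) • x‖ ^ p := by
      simp only [hQ, hrow]
    rw [← e]
    linarith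
  have hder : HasDerivAt g (∑ i, p * (‖a i‖ ^ (p - 2) * ⟪a i, x⟫ ^ 2) -
      Q R * (‖x‖ ^ 2 * (p / r))) 0 := by
    refine HasDerivAt.sub (HasDerivAt.fun_sum fun i _ => hasDerivAt_norm_add_smul_rpow p _ _)
      (HasDerivAt.const_mul _ ?_)
    have h1 : HasDerivAt (fun s : ℝ => 1 + s * ‖x‖ ^ 2) (‖x‖ ^ 2) 0 := by
      simpa using ((hasDerivAt_id (0 : ℝ)).mul_const (‖x‖ ^ 2)).const_add 1
    have h2 := h1.rpow_const (p := p / r) (Or.inl (by simp))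
    simpa using h2
  have h0 := hmin.hasDerivAt_eq_zero hder
  rw [← Finset.mul_sum] at h0
  have h1 : p * (∑ i, ‖a i‖ ^ (p - 2) * ⟪a i, x⟫ ^ 2 - Q R / r * ‖x‖ ^ 2) = 0 := by
    rw [← h0]; ring
  have h2 := (mul_eq_zero.mp h1).resolve_left hp0.ne'
  linarith

/-! ### From Lewis' position to the bound on the sum of sensitivities. -/

lemma lpPow_nonneg (p : ℝ) {m : Type*} [Fintype m] (y : m → ℝ) : 0 ≤ lpPow p y :=
  Finset.sum_nonneg fun _ _ => Real.rpow_nonneg (abs_nonneg _) _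

lemma sensitivity_le_ofReal {p : ℝ} {d : ℕ} [Fintype n] (A : Matrix n (Fin d) ℝ) (a : Fin d → ℝ)
    {c : ℝ} (h : ∀ x, A *ᵥ x ≠ 0 → |a ⬝ᵥ x| ^ p ≤ c * lpPow p (A *ᵥ x)) (hc : 0 ≤ c) :
    sensitivity p A a ≤ ENNReal.ofReal c := by
  refine iSup₂_le fun x hx => ENNReal.ofReal_le_ofReal ?_
  exact div_le_of_le_mul₀ (lpPow_nonneg _ _) hc (h x hx)

/-- Coordinates on the column space of a matrix. -/
lemma exists_injective_factor {d : ℕ} (A : Matrix n (Fin d) ℝ) :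
    ∃ (r : ℕ) (B : Matrix n (Fin r) ℝ), r ≤ d ∧ (∀ c, B *ᵥ c = 0 → c = 0) ∧
      ∀ x, ∃ c, A *ᵥ x = B *ᵥ c := by
  set W := LinearMap.range A.mulVecLin with hW
  set b := Module.finBasis ℝ W with hb
  set B : Matrix n (Fin (Module.finrank ℝ W)) ℝ := fun i k => (b k : n → ℝ) i with hB
  have hBc : ∀ c, B *ᵥ c = ((∑ k, c k • b k : W) : n → ℝ) := by
    intro c
    ext i
    simp [hB, Matrix.mulVec, dotProduct, mul_comm]
  refine ⟨_, B, ?_, fun c hc => ?_, fun x => ?_⟩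
  · simpa using LinearMap.finrank_range_le A.mulVecLin
  · rw [hBc, ZeroMemClass.coe_eq_zero] at hc
    exact funext fun k => Fintype.linearIndependent_iff.mp b.linearIndependent c hc k
  · refine ⟨b.repr ⟨A *ᵥ x, x, rfl⟩, ?_⟩
    rw [hBc, b.sum_repr]

/-- The sum of the sensitivities of the rows of a matrix. -/
lemma sum_sensitivity_le {p : ℝ} (hp : 1 ≤ p) [Fintype n] {d : ℕ} (A : Matrix n (Fin d) ℝ) :
    ∑ i, sensitivity p A (A i) ≤ ENNReal.ofReal ((d : ℝ) ^ max (p / 2) 1) := by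
  have hp0 : 0 < p := by linarith
  obtain ⟨r, B, hrd, hB, hAB⟩ := exists_injective_factor A
  rcases Nat.eq_zero_or_pos r with hr | hr
  · subst hr
    have : ∀ x, A *ᵥ x = 0 := by
      intro x
      obtain ⟨c, hc⟩ := hAB x
      rw [hc, Subsingleton.elim c 0, Matrix.mulVec_zero]
    have h0 : ∀ i, sensitivity p A (A i) = 0 := fun i => by
      simp [sensitivity, this]
    simp [h0]
  obtain ⟨R, lam, hR, hlam, hiso, hsum⟩ := exists_lewis_position hp hr B hB
  set a := fun i => euclideanRow (B * R) i with ha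
  have hr0 : (0 : ℝ) < r := Nat.cast_pos.mpr hr
  have hcoord : ∀ x, ∃ z : EuclideanSpace ℝ (Fin r), ∀ i, (A *ᵥ x) i = ⟪a i, z⟫ := by
    intro x
    obtain ⟨c, hc⟩ := hAB x
    refine ⟨WithLp.toLp 2 (R⁻¹ *ᵥ c), fun i => ?_⟩
    rw [ha, inner_euclideanRow, ← Matrix.mulVec_mulVec, hc]
    congr 2
    rw [Matrix.mulVec_mulVec, Matrix.mul_nonsing_inv R hR, Matrix.one_mulVec]
  have hmain : ∀ z : EuclideanSpace ℝ (Fin r),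
      lam * ‖z‖ ^ p ≤ (r : ℝ) ^ (max (p / 2) 1 - 1) * ∑ i, |⟪a i, z⟫| ^ p := by
    intro z
    have hz := hiso z
    rcases le_total p 2 with hp2 | hp2
    · rw [max_eq_right (by linarith), sub_self, Real.rpow_zero, one_mul]
      rcases eq_or_ne z 0 with rfl | hz0
      · rw [norm_zero, Real.zero_rpow hp0.ne', mul_zero]
        exact Finset.sum_nonneg fun i _ => Real.rpow_nonneg (abs_nonneg _) _
      have hzn : 0 < ‖z‖ := norm_pos_iff.mpr hz0
      -- For p ≤ 2, Cauchy–Schwarz applied to |⟪a i, z⟫|^(2-p) turns the isotropy identity into a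
      -- lower bound on the p-th power sum.
      have h1 : ∀ i, ‖a i‖ ^ (p - 2) * ⟪a i, z⟫ ^ 2 ≤ ‖z‖ ^ (2 - p) * |⟪a i, z⟫| ^ p := by
        intro i
        rcases eq_or_ne ⟪a i, z⟫ 0 with h | h
        · rw [h]; simp [Real.zero_rpow hp0.ne']
        have hai : a i ≠ 0 := fun h' => h (by rw [h', inner_zero_left])
        have han : 0 < ‖a i‖ := norm_pos_iff.mpr hai
        have hin : 0 < |⟪a i, z⟫| := abs_pos.mpr h
        have e1 : ⟪a i, z⟫ ^ 2 = |⟪a i, z⟫| ^ (2 - p) * |⟪a i, z⟫| ^ p := by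
          rw [← Real.rpow_add hin, ← sq_abs, ← Real.rpow_natCast]
          congr 1
          push_cast; ring
        have e2 : |⟪a i, z⟫| ^ (2 - p) ≤ ‖a i‖ ^ (2 - p) * ‖z‖ ^ (2 - p) := by
          rw [← Real.mul_rpow han.le hzn.le]
          exact Real.rpow_le_rpow hin.le (abs_real_inner_le_norm _ _) (by linarith)
        have e3 : ‖a i‖ ^ (p - 2) * ‖a i‖ ^ (2 - p) = 1 := by
          rw [← Real.rpow_add han]
          ring_nf
          exact Real.rpow_zero _
        calc ‖a i‖ ^ (p - 2) * ⟪a i, z⟫ ^ 2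
            ≤ ‖a i‖ ^ (p - 2) * ((‖a i‖ ^ (2 - p) * ‖z‖ ^ (2 - p)) * |⟪a i, z⟫| ^ p) := by
              rw [e1]; gcongr
          _ = (‖a i‖ ^ (p - 2) * ‖a i‖ ^ (2 - p)) * (‖z‖ ^ (2 - p) * |⟪a i, z⟫| ^ p) := by ring
          _ = _ := by rw [e3, one_mul]
      have h2 := Finset.sum_le_sum fun i (_ : i ∈ Finset.univ) => h1 i
      rw [hz, ← Finset.mul_sum] at h2
      have e4 : ‖z‖ ^ 2 = ‖z‖ ^ (2 - p) * ‖z‖ ^ p := by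
        rw [← Real.rpow_add hzn, ← Real.rpow_natCast]
        congr 1
        push_cast; ring
      rw [e4] at h2
      have hpos : 0 < ‖z‖ ^ (2 - p) := Real.rpow_pos_of_pos hzn _
      refine le_of_mul_le_mul_left ?_ hpos
      linarith
    · rw [max_eq_left (by linarith)]
      -- For p ≥ 2, these weights sum to 1, and Jensen's inequality for t^(p/2) loses the factor
      -- r^(p/2-1).
      set w : n → ℝ := fun i => ‖a i‖ ^ p / (lam * r) with hw
      have hterm : ∀ i, w i * (⟪a i, z⟫ ^ 2 / ‖a i‖ ^ 2) =
          ‖a i‖ ^ (p - 2) * ⟪a i, z⟫ ^ 2 / (lam * r) := by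
        intro i
        rcases eq_or_ne (a i) 0 with h | h
        · simp [h]
        · have han : 0 < ‖a i‖ := norm_pos_iff.mpr h
          have : ‖a i‖ ^ (p - 2) = ‖a i‖ ^ p / ‖a i‖ ^ 2 := by
            rw [Real.rpow_sub han, Real.rpow_ofNat]
          rw [this, hw]; field_simp
      have hterm2 : ∀ i, w i * (⟪a i, z⟫ ^ 2 / ‖a i‖ ^ 2) ^ (p / 2) ≤
          |⟪a i, z⟫| ^ p / (lam * r) := by
        intro i
        rcases eq_or_ne (a i) 0 with h | h
        · simp only [h, hw, norm_zero, Real.zero_rpow hp0.ne', inner_zero_left]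
          simp [Real.zero_rpow hp0.ne']
        · have han : 0 < ‖a i‖ := norm_pos_iff.mpr h
          have hsq : ∀ t : ℝ, 0 ≤ t → (t ^ 2) ^ (p / 2) = t ^ p := by
            intro t ht
            rw [← Real.rpow_natCast_mul ht]
            congr 1
            push_cast; ring
          rw [Real.div_rpow (sq_nonneg _) (sq_nonneg _), hsq _ han.le, ← sq_abs,
            hsq _ (abs_nonneg _), hw]
          have := Real.rpow_pos_of_pos han p
          refine le_of_eq ?_
          field_simp
      have hj := Real.rpow_arith_mean_le_arith_mean_rpow Finset.univ w
        (fun i => ⟪a i, z⟫ ^ 2 / ‖a i‖ ^ 2) (fun i _ => by positivity)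
        (by rw [hw, ← Finset.sum_div, hsum, div_self (by positivity)]) (fun i _ => by positivity)
        (by linarith : 1 ≤ p / 2)
      have e1 : ∑ i, w i * (⟪a i, z⟫ ^ 2 / ‖a i‖ ^ 2) = ‖z‖ ^ 2 / r := by
        simp only [hterm]
        rw [← Finset.sum_div, hz]
        field_simp
      rw [e1] at hj
      have hj2 := hj.trans (Finset.sum_le_sum fun i _ => hterm2 i)
      rw [← Finset.sum_div, Real.div_rpow (sq_nonneg _) hr0.le,
        ← Real.rpow_natCast_mul (norm_nonneg _)] at hj2
      have e2 : ((2 : ℕ) : ℝ) * (p / 2) = p := by push_cast; ring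
      rw [e2, div_le_div_iff₀ (by positivity) (by positivity)] at hj2
      have e3 : (r : ℝ) ^ (p / 2) = r ^ (p / 2 - 1) * r := by
        rw [Real.rpow_sub_one hr0.ne']; field_simp
      rw [e3] at hj2
      refine le_of_mul_le_mul_right ?_ hr0
      linarith
  set K : ℝ := (r : ℝ) ^ (max (p / 2) 1 - 1) with hK
  have hK0 : 0 ≤ K := Real.rpow_nonneg hr0.le _
  have hsens : ∀ i, sensitivity p A (A i) ≤ ENNReal.ofReal (‖a i‖ ^ p * K / lam) := by
    intro i
    refine sensitivity_le_ofReal A _ (fun x _ => ?_) (by positivity)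
    obtain ⟨z, hz⟩ := hcoord x
    have hl : lpPow p (A *ᵥ x) = ∑ i, |⟪a i, z⟫| ^ p :=
      Finset.sum_congr rfl fun i _ => by rw [hz]
    have hi : A i ⬝ᵥ x = ⟪a i, z⟫ := hz i
    rw [hl, hi]
    calc |⟪a i, z⟫| ^ p ≤ (‖a i‖ * ‖z‖) ^ p :=
          Real.rpow_le_rpow (abs_nonneg _) (abs_real_inner_le_norm _ _) hp0.le
      _ = ‖a i‖ ^ p / lam * (lam * ‖z‖ ^ p) := by
          rw [Real.mul_rpow (norm_nonneg _) (norm_nonneg _)]; field_simp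
      _ ≤ ‖a i‖ ^ p / lam * (K * ∑ i, |⟪a i, z⟫| ^ p) :=
          mul_le_mul_of_nonneg_left (hmain z) (by positivity)
      _ = _ := by ring
  refine (Finset.sum_le_sum fun i _ => hsens i).trans ?_
  rw [← ENNReal.ofReal_sum_of_nonneg fun i _ => by positivity]
  refine ENNReal.ofReal_le_ofReal ?_
  rw [← Finset.sum_div, ← Finset.sum_mul, hsum]
  have e : lam * r * K / lam = (r : ℝ) ^ max (p / 2) 1 := by
    rw [hK, Real.rpow_sub_one hr0.ne']; field_simp
  rw [e]
  exact Real.rpow_le_rpow hr0.le (Nat.cast_le.mpr hrd) (le_max_of_le_right zero_le_one)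

end Lewis

end PersonalizedCongest

end

noncomputable section

namespace PersonalizedCongest

/-! ### Sampling by sensitivities gives subspace embeddings -/

section Sampling

open scoped RealInnerProductSpace

universe u

/-- Bernoulli sampling of the rows of any matrix with `d` columns, with rates of at least
`min(1, κ τ)`, fails to give an `ε` `ℓ_p`-subspace embedding with probability at most `η`. -/
def SamplesWell (p ε κ η : ℝ) (d : ℕ) : Prop :=
  ∀ (n : Type u) [Fintype n] [DecidableEq n] (A : Matrix n (Fin d) ℝ) (q : n → ℝ),
    (∀ i, 0 ≤ q i) → (∀ i, q i ≤ 1) →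
    (∀ i, min 1 (ENNReal.ofReal κ * sensitivity p A (A i)) ≤ ENNReal.ofReal (q i)) →
    bernProb q (fun σ => ∃ x, ε * lpPow p (A *ᵥ x) <
      |∑ i, centeredCoeff q σ i * |(A *ᵥ x) i| ^ p|) ≤ η

lemma SamplesWell.mono {p ε κ η η' : ℝ} {d : ℕ} (h : SamplesWell.{u} p ε κ η d) (hη : η ≤ η') :
    SamplesWell.{u} p ε κ η' d :=
  fun n _ _ A q h0 h1 hq => (h n A q h0 h1 hq).trans hη

lemma lpPow_pos {p : ℝ} {m : Type*} [Fintype m] {y : m → ℝ} (hy : y ≠ 0) : 0 < lpPow p y := by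
  obtain ⟨i, hi⟩ := Function.ne_iff.mp hy
  exact Finset.sum_pos' (fun _ _ => Real.rpow_nonneg (abs_nonneg _) _)
    ⟨i, Finset.mem_univ i, Real.rpow_pos_of_pos (abs_pos.mpr hi) _⟩

/-- Converts a rate condition on sensitivities into the hypothesis `hq` of the two concentration
results, with β = 1/κ; rows of rate 1 are exempt because they are kept for certain. -/
lemma le_mul_lpPow_of_sensitivity_le {p κ : ℝ} (hp : 1 ≤ p) (hκ : 0 < κ) {n : Type*} [Fintype n]
    {d : ℕ} (A : Matrix n (Fin d) ℝ) {i : n} {c : ℝ} (hc : 0 ≤ c) (hc1 : c ≤ 1)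
    (h : min 1 (ENNReal.ofReal κ * sensitivity p A (A i)) ≤ ENNReal.ofReal c) :
    c = 1 ∨ ∀ x, |(A *ᵥ x) i| ^ p ≤ 1 / κ * c * lpPow p (A *ᵥ x) := by
  rcases hc1.eq_or_lt with hc1 | hc1
  · exact Or.inl hc1
  right
  intro x
  by_cases hx : A *ᵥ x = 0
  · have : (0 : ℝ) ^ p = 0 := Real.zero_rpow (by linarith)
    simp [hx, lpPow, this]
  have h1 : ENNReal.ofReal κ * sensitivity p A (A i) ≤ ENNReal.ofReal c := by
    rcases min_le_iff.mp h with h | h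
    · rw [ENNReal.one_le_ofReal] at h
      linarith
    · exact h
  have h2 : ENNReal.ofReal (|A i ⬝ᵥ x| ^ p / lpPow p (A *ᵥ x)) ≤ sensitivity p A (A i) :=
    le_iSup₂ (f := fun (x : Fin d → ℝ) (_ : A *ᵥ x ≠ 0) =>
      ENNReal.ofReal (|A i ⬝ᵥ x| ^ p / lpPow p (A *ᵥ x))) x hx
  have h3 := (mul_le_mul_right h2 (ENNReal.ofReal κ)).trans h1
  rw [← ENNReal.ofReal_mul hκ.le, ENNReal.ofReal_le_ofReal_iff hc] at h3
  have hl := lpPow_pos (p := p) hx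
  have e : |(A *ᵥ x) i| ^ p = κ * (|A i ⬝ᵥ x| ^ p / lpPow p (A *ᵥ x)) *
      (1 / κ * lpPow p (A *ᵥ x)) := by
    change |A i ⬝ᵥ x| ^ p = _
    field_simp
  rw [e]
  refine (mul_le_mul_of_nonneg_right h3 (by positivity)).trans_eq ?_
  ring

/-- The case of a general exponent. -/
lemma samplesWell_of_chaining {p ε κ L : ℝ} {d : ℕ} (hp : 1 ≤ p) (hε : 0 < ε) (hε1 : ε ≤ 1)
    (hL : 1 ≤ L) (hκ : 768 * p ^ 2 * (6 * (d + L)) ≤ ε ^ 2 * κ) :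
    SamplesWell.{u} p ε κ (Real.exp (-(4 * L))) d := by
  intro n _ _ A q h0 h1 hq
  have hp0 : 0 < p := by linarith
  have hd0 : (0 : ℝ) ≤ d := Nat.cast_nonneg d
  have hκ0 : 0 < κ := by
    have h1 : 0 < 768 * p ^ 2 * (6 * (d + L)) := by positivity
    exact pos_of_mul_pos_right (h1.trans_le hκ) (sq_nonneg ε)
  have : Fact (1 ≤ ENNReal.ofReal p) := ⟨by rwa [ENNReal.one_le_ofReal]⟩
  have htr : (ENNReal.ofReal p).toReal = p := ENNReal.toReal_ofReal hp0.le
  -- The concentration takes place in the column space with its ℓ_p norm. Its dimension is at most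
  -- d, whatever the number of rows, and a kernel of A plays no role.
  set Φ : (Fin d → ℝ) →ₗ[ℝ] PiLp (ENNReal.ofReal p) (fun _ : n => ℝ) :=
    (WithLp.linearEquiv (ENNReal.ofReal p) ℝ (n → ℝ)).symm.toLinearMap ∘ₗ A.mulVecLin with hΦ
  set l : n → LinearMap.range Φ →ₗ[ℝ] ℝ := fun i =>
    (PiLp.projₗ (𝕜 := ℝ) (ENNReal.ofReal p) (fun _ : n => ℝ) i) ∘ₗ (LinearMap.range Φ).subtype
    with hl
  have hnorm : ∀ y, ∑ i, |l i y| ^ p = ‖y‖ ^ p := by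
    intro y
    rw [← Submodule.norm_coe, PiLp.norm_eq_sum (by rw [htr]; exact hp0), htr, ← Real.rpow_mul
      (Finset.sum_nonneg fun i _ => Real.rpow_nonneg (norm_nonneg _) _),
      one_div_mul_cancel hp0.ne', Real.rpow_one]
    rfl
  have hlp : ∀ x, lpPow p (A *ᵥ x) = ‖(⟨Φ x, x, rfl⟩ : LinearMap.range Φ)‖ ^ p := by
    intro x
    rw [← hnorm]
    rfl
  have hrank : (Module.finrank ℝ (LinearMap.range Φ) : ℝ) ≤ d := by
    have := LinearMap.finrank_range_le Φ
    rw [Module.finrank_fin_fun] at this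
    exact_mod_cast this
  refine le_trans (bernProb_mono h0 h1 ?_) (bernProb_chaining h0 h1 l hp hnorm
    (β := 1 / κ) (by positivity) (fun i => ?_) hε hε1 hL ?_)
  · rintro σ ⟨x, hx⟩
    refine ⟨⟨Φ x, x, rfl⟩, ?_⟩
    rw [← hlp]
    exact hx
  · refine (le_mul_lpPow_of_sensitivity_le hp hκ0 A (h0 i) (h1 i) (hq i)).imp id ?_
    rintro h ⟨_, x, rfl⟩
    rw [← hlp]
    exact h x
  · have e : ε ^ 2 / (1 / κ) = ε ^ 2 * κ := by field_simp
    rw [e]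
    refine le_trans ?_ hκ
    gcongr

/-- The case `p = 2`. -/
lemma samplesWell_two {ε κ : ℝ} {d : ℕ} (hε : 0 < ε) (hε1 : ε ≤ 2) (hκ0 : 0 < κ) :
    SamplesWell.{u} 2 ε κ (2 * d * Real.exp (-(ε ^ 2 * κ / 8))) d := by
  intro n _ _ A q h0 h1 hq
  set Φ : (Fin d → ℝ) →ₗ[ℝ] EuclideanSpace ℝ n :=
    (WithLp.linearEquiv 2 ℝ (n → ℝ)).symm.toLinearMap ∘ₗ A.mulVecLin with hΦ
  set E := LinearMap.range Φ with hE
  set l : n → E →L[ℝ] ℝ := fun i =>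
    (EuclideanSpace.proj i : EuclideanSpace ℝ n →L[ℝ] ℝ).comp E.subtypeL with hl
  set w : n → E := fun i => (InnerProductSpace.toDual ℝ E).symm (l i) with hw
  have hwi : ∀ i y, ⟪w i, y⟫ = l i y := fun i y => InnerProductSpace.toDual_symm_apply
  have hwx : ∀ i x, ⟪w i, (⟨Φ x, x, rfl⟩ : E)⟫ = (A *ᵥ x) i := fun i x => by rw [hwi]; rfl
  have hnorm : ∀ y : E, ∑ i, ⟪w i, y⟫ ^ 2 = ‖y‖ ^ 2 := by
    intro y
    rw [← Submodule.norm_coe, EuclideanSpace.real_norm_sq_eq]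
    exact Finset.sum_congr rfl fun i _ => by rw [hwi]; rfl
  have hsq : ∀ t : ℝ, |t| ^ (2 : ℝ) = t ^ 2 := fun t => by
    rw [Real.rpow_ofNat, sq_abs]
  have hlp : ∀ x, lpPow 2 (A *ᵥ x) = ‖(⟨Φ x, x, rfl⟩ : E)‖ ^ 2 := by
    intro x
    rw [← hnorm]
    exact Finset.sum_congr rfl fun i _ => by rw [hwx, hsq]
  have hrank : (Module.finrank ℝ E : ℝ) ≤ d := by
    have := LinearMap.finrank_range_le Φ
    rw [Module.finrank_fin_fun] at this
    exact_mod_cast this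
  refine le_trans (bernProb_mono h0 h1 ?_) ((bernProb_quadratic_le h0 h1 w hnorm
    (β := 1 / κ) (ε := ε) (by positivity) (fun i => ?_) hε.le hε1).trans ?_)
  · rintro σ ⟨x, hx⟩
    refine ⟨⟨Φ x, x, rfl⟩, ?_⟩
    rw [← hlp]
    simpa only [hwx, hsq] using hx
  · refine (le_mul_lpPow_of_sensitivity_le one_le_two hκ0 A (h0 i) (h1 i) (hq i)).imp id ?_
    intro h
    -- Testing the sensitivity on a preimage of w i itself bounds ‖w i‖², the leverage score.
    obtain ⟨x, hx⟩ := (w i).2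
    have hwe : w i = ⟨Φ x, x, rfl⟩ := Subtype.ext hx.symm
    have h' := h x
    rw [hlp, ← hwe, hsq, ← hwx, ← hwe, real_inner_self_eq_norm_sq] at h'
    rcases eq_or_ne (w i) 0 with h0' | h0'
    · rw [h0', norm_zero, zero_pow two_ne_zero]
      have := h0 i
      positivity
    · have hn : 0 < ‖w i‖ := norm_pos_iff.mpr h0'
      have : ‖w i‖ ^ 2 * ‖w i‖ ^ 2 ≤ 1 / κ * q i * ‖w i‖ ^ 2 := by linarith [sq (‖w i‖ ^ 2)]
      exact le_of_mul_le_mul_right this (by positivity)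
  · have e : ε ^ 2 / (8 * (1 / κ)) = ε ^ 2 * κ / 8 := by field_simp
    rw [e]
    gcongr

end Sampling

end PersonalizedCongest

end

noncomputable section

namespace PersonalizedCongest

/-! ### Adaptive sampling with independent hash functions -/

section Hashing

open ProbabilityTheory

variable {Key : Type*}

instance : IsProbabilityMeasure (hashLaw Key) := by
  unfold hashLaw; infer_instance

lemma iIndepFun_hash : iIndepFun (fun (i : ℕ × Key) (h : Hashes Key) => h i) (hashLaw Key) :=
  iIndepFun_infinitePi (X := fun (_ : ℕ × Key) (x : unitInterval) => x) fun _ => measurable_id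

/-- The event that a hash value is at most a threshold. -/
lemma hashLaw_le (i : ℕ × Key) (c : ℝ≥0∞) :
    hashLaw Key {h | ENNReal.ofReal (h i : ℝ) ≤ c} = min 1 c := by
  have hm : MeasurableSet {x : unitInterval | ENNReal.ofReal (x : ℝ) ≤ c} :=
    measurableSet_le (by fun_prop) measurable_const
  have e1 : hashLaw Key {h | ENNReal.ofReal (h i : ℝ) ≤ c} =
      (volume : Measure unitInterval) {x | ENNReal.ofReal (x : ℝ) ≤ c} := by
    rw [← Measure.infinitePi_map_eval (fun _ : ℕ × Key => (volume : Measure unitInterval)) i,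
      Measure.map_apply (by fun_prop) hm]
    rfl
  rw [e1]
  rcases le_total 1 c with hc | hc
  · have : {x : unitInterval | ENNReal.ofReal (x : ℝ) ≤ c} = Set.univ :=
      Set.eq_univ_of_forall fun x => le_trans (by
        rw [ENNReal.ofReal_le_one]; exact x.2.2) hc
    rw [this, measure_univ, min_eq_left hc]
  · rw [min_eq_right hc]
    have hct : c ≠ ⊤ := ne_top_of_le_ne_top ENNReal.one_ne_top hc
    have hc1 : c.toReal ≤ 1 := ENNReal.toReal_le_of_le_ofReal zero_le_one (by simpa using hc)
    have : {x : unitInterval | ENNReal.ofReal (x : ℝ) ≤ c} =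
        Set.Iic (⟨c.toReal, ENNReal.toReal_nonneg, hc1⟩ : unitInterval) := by
      ext x
      simp only [Set.mem_ofPred_eq, Set.mem_Iic]
      rw [ENNReal.ofReal_le_iff_le_toReal hct]
      rfl
    rw [this, unitInterval.volume_Iic, ENNReal.ofReal_toReal hct]

/-- The `σ`-algebra of the hash functions with an index greater than `t`. -/
abbrev hashesAbove (Key : Type*) (t : ℕ) : MeasurableSpace (Hashes Key) :=
  ⨆ i ∈ {i : ℕ × Key | t < i.1}, MeasurableSpace.comap (fun h : Hashes Key => h i) inferInstance

lemma hashesAbove_le (t : ℕ) : hashesAbove Key t ≤ MeasurableSpace.pi :=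
  iSup₂_le fun i _ => (measurable_pi_apply i).comap_le

lemma hashesAbove_anti {t t' : ℕ} (h : t ≤ t') : hashesAbove Key t' ≤ hashesAbove Key t :=
  biSup_mono fun _ hi => lt_of_le_of_lt h hi

/-- A function of the hashes that takes finitely many values and is determined by the hash functions
with an index greater than `t`. -/
structure Revealed {β : Type*} (t : ℕ) (f : Hashes Key → β) : Prop where
  finite_range : (Set.range f).Finite
  measurableSet_fiber : ∀ b, MeasurableSet[hashesAbove Key t] (f ⁻¹' {b})

namespace Revealed

variable {β γ : Type*} {t t' : ℕ}

lemma anti {f : Hashes Key → β} (hf : Revealed t' f) (h : t ≤ t') : Revealed t f :=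
  ⟨hf.1, fun b => hashesAbove_anti h _ (hf.2 b)⟩

lemma const (t : ℕ) (b : β) : Revealed (Key := Key) t fun _ => b := by
  refine ⟨Set.finite_range_const, fun c => ?_⟩
  by_cases h : b = c
  · have : (fun _ : Hashes Key => b) ⁻¹' {c} = Set.univ := by ext; simp [h]
    rw [this]
    exact @MeasurableSet.univ _ (hashesAbove Key t)
  · have : (fun _ : Hashes Key => b) ⁻¹' {c} = ∅ := by ext; simp [h]
    rw [this]
    exact @MeasurableSet.empty _ (hashesAbove Key t)

/-- Finiteness of the range splits each preimage into finitely many pieces on which f is constant,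
so no joint measurability of g is needed. -/
lemma bind {f : Hashes Key → β} {g : β → Hashes Key → γ} (hf : Revealed t f)
    (hg : ∀ b, Revealed t (g b)) : Revealed t fun h => g (f h) h := by
  refine ⟨(hf.1.biUnion fun b _ => (hg b).1).subset ?_, fun c => ?_⟩
  · rintro _ ⟨h, rfl⟩
    exact Set.mem_biUnion (Set.mem_range_self h) (Set.mem_range_self h)
  · have : (fun h => g (f h) h) ⁻¹' {c} = ⋃ b ∈ Set.range f, f ⁻¹' {b} ∩ g b ⁻¹' {c} := by
      ext h
      simp only [Set.mem_preimage, Set.mem_singleton_iff, Set.mem_range, Set.iUnion_exists,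
        Set.iUnion_iUnion_eq', Set.mem_iUnion, Set.mem_inter_iff]
      constructor
      · exact fun e => ⟨h, rfl, e⟩
      · rintro ⟨i, e1, e2⟩
        rwa [e1]
    rw [this]
    refine @MeasurableSet.biUnion _ _ (hashesAbove Key t) _ _ hf.1.countable fun b _ => ?_
    exact @MeasurableSet.inter _ (hashesAbove Key t) _ _ (hf.2 b) ((hg b).2 c)

lemma comp {f : Hashes Key → β} (hf : Revealed t f) (g : β → γ) : Revealed t fun h => g (f h) :=
  hf.bind fun b => const t (g b)

lemma pi {ι : Type*} [Finite ι] {β : ι → Type*} {f : Hashes Key → ∀ i, β i}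
    (hf : ∀ i, Revealed t fun h => f h i) : Revealed t f := by
  refine ⟨(Set.Finite.pi fun i => (hf i).1).subset ?_, fun c => ?_⟩
  · rintro _ ⟨h, rfl⟩ i _
    exact Set.mem_range_self h
  · have : f ⁻¹' {c} = ⋂ i, (fun h => f h i) ⁻¹' {c i} := by
      ext h
      simp [funext_iff]
    rw [this]
    exact @MeasurableSet.iInter _ _ (hashesAbove Key t) _ _ fun i => (hf i).2 (c i)

lemma threshold {i : ℕ × Key} (hi : t < i.1) (c : ℝ≥0∞) :
    Revealed t fun h : Hashes Key => ENNReal.ofReal (h i : ℝ) ≤ c := by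
  refine ⟨Set.toFinite _, fun P => ?_⟩
  have hle : MeasurableSpace.comap (fun h : Hashes Key => h i) inferInstance ≤
      hashesAbove Key t :=
    le_iSup₂ (f := fun (i : ℕ × Key) (_ : i ∈ {i : ℕ × Key | t < i.1}) =>
      MeasurableSpace.comap (fun h : Hashes Key => h i) inferInstance) i hi
  have hm : MeasurableSet[hashesAbove Key t]
      {h : Hashes Key | ENNReal.ofReal (h i : ℝ) ≤ c} := by
    refine hle _ ⟨{x | ENNReal.ofReal (x : ℝ) ≤ c}, ?_, rfl⟩
    exact measurableSet_le (by fun_prop) measurable_const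
  by_cases hP : P
  · have : (fun h : Hashes Key => ENNReal.ofReal (h i : ℝ) ≤ c) ⁻¹' {P} =
        {h : Hashes Key | ENNReal.ofReal (h i : ℝ) ≤ c} := by
      ext h; simp [hP]
    rw [this]; exact hm
  · have : (fun h : Hashes Key => ENNReal.ofReal (h i : ℝ) ≤ c) ⁻¹' {P} =
        {h : Hashes Key | ENNReal.ofReal (h i : ℝ) ≤ c}ᶜ := by
      ext h; simp [hP]
    rw [this]; exact @MeasurableSet.compl _ _ (hashesAbove Key t) hm

end Revealed

variable {ι : Type*}

/-- The sampling rates that belong to the sampling values `c`. -/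
def rate (c : ι → ℝ≥0∞) (i : ι) : ℝ := (min 1 (c i)).toReal

lemma rate_nonneg (c : ι → ℝ≥0∞) (i : ι) : 0 ≤ rate c i := ENNReal.toReal_nonneg

lemma rate_le_one (c : ι → ℝ≥0∞) (i : ι) : rate c i ≤ 1 :=
  ENNReal.toReal_le_of_le_ofReal zero_le_one (by simp)

lemma ofReal_rate (c : ι → ℝ≥0∞) (i : ι) : ENNReal.ofReal (rate c i) = min 1 (c i) :=
  ENNReal.ofReal_toReal (ne_top_of_le_ne_top ENNReal.one_ne_top (min_le_left _ _))

variable [Fintype ι]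

open Classical in
/-- The items, with keys `k`, that are selected by the `t`-th hash function with the sampling
values `c`. -/
def selected (k : ι → Key) (t : ℕ) (c : ι → ℝ≥0∞) (h : Hashes Key) : Finset ι :=
  Finset.univ.filter fun i => ENNReal.ofReal (h (t, k i) : ℝ) ≤ c i

lemma mem_selected {k : ι → Key} {t : ℕ} {c : ι → ℝ≥0∞} {h : Hashes Key} {i : ι} :
    i ∈ selected k t c h ↔ ENNReal.ofReal (h (t, k i) : ℝ) ≤ c i := by
  simp [selected]

variable [DecidableEq ι]

/-- Injectivity of the keys gives distinct items distinct, hence independent, hash values. The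
conformity of the datasets enters here. -/
lemma hashLaw_selected_eq {k : ι → Key} (hk : Function.Injective k) (t : ℕ) (c : ι → ℝ≥0∞)
    (σ : Finset ι) :
    hashLaw Key {h | selected k t c h = σ} = ENNReal.ofReal (bernWeight (rate c) σ) := by
  have hinj : Function.Injective fun i => (t, k i) := fun i j hij => hk (Prod.ext_iff.mp hij).2
  have hind := (iIndepFun_hash (Key := Key)).precomp hinj
  set s : ι → Set unitInterval := fun i => if i ∈ σ then {x | ENNReal.ofReal (x : ℝ) ≤ c i}
    else {x | ENNReal.ofReal (x : ℝ) ≤ c i}ᶜ with hs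
  have hm : ∀ i, MeasurableSet {x : unitInterval | ENNReal.ofReal (x : ℝ) ≤ c i} := fun i =>
    measurableSet_le (by fun_prop) measurable_const
  have hsm : ∀ i, MeasurableSet (s i) := by
    intro i
    simp only [hs]
    split_ifs
    exacts [hm i, (hm i).compl]
  have e : {h : Hashes Key | selected k t c h = σ} =
      ⋂ i ∈ (Finset.univ : Finset ι), (fun h : Hashes Key => h (t, k i)) ⁻¹' s i := by
    ext h
    simp only [Set.mem_ofPred_eq, Finset.ext_iff, mem_selected, Finset.mem_univ, Set.iInter_true,
      Set.mem_iInter, Set.mem_preimage, hs]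
    refine forall_congr' fun i => ?_
    by_cases hi : i ∈ σ <;> simp [hi]
  rw [e, hind.measure_inter_preimage_eq_mul Finset.univ fun i _ => hsm i, bernWeight,
    ENNReal.ofReal_prod_of_nonneg fun i _ => by
      split_ifs <;> linarith [rate_nonneg c i, rate_le_one c i]]
  refine Finset.prod_congr rfl fun i _ => ?_
  simp only [hs]
  split_ifs with hi
  · rw [ofReal_rate]
    exact hashLaw_le _ _
  · have hev : Measurable fun h : Hashes Key => h (t, k i) := measurable_pi_apply _
    rw [ENNReal.ofReal_sub _ (rate_nonneg c i), ofReal_rate, ENNReal.ofReal_one, Set.preimage_compl,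
      measure_compl (hev (hm i)) (measure_ne_top _ _), measure_univ]
    congr 1
    exact hashLaw_le _ _

lemma hashLaw_selected {k : ι → Key} (hk : Function.Injective k) (t : ℕ) (c : ι → ℝ≥0∞)
    (B : Finset ι → Prop) :
    hashLaw Key {h | B (selected k t c h)} ≤ ENNReal.ofReal (bernProb (rate c) B) := by
  classical
  have hsub : {h : Hashes Key | B (selected k t c h)} ⊆
      ⋃ σ ∈ Finset.univ.filter B, {h | selected k t c h = σ} := fun h hh => by
    simpa using hh
  refine (measure_mono hsub).trans ((measure_biUnion_finset_le _ _).trans ?_)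
  rw [bernProb, ← Finset.sum_filter, ENNReal.ofReal_sum_of_nonneg fun σ _ =>
    bernWeight_nonneg (rate_nonneg c) (rate_le_one c) σ]
  refine le_of_eq (Finset.sum_congr ?_ fun σ _ => hashLaw_selected_eq hk t c σ)
  ext; simp

lemma measurableSet_selected (k : ι → Key) (t : ℕ) (c : ι → ℝ≥0∞) (B : Finset ι → Prop) :
    MeasurableSet[⨆ i ∈ {i : ℕ × Key | i.1 = t},
      MeasurableSpace.comap (fun h : Hashes Key => h i) inferInstance]
      {h | B (selected k t c h)} := by
  classical
  set m := ⨆ i ∈ {i : ℕ × Key | i.1 = t},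
      MeasurableSpace.comap (fun h : Hashes Key => h i) inferInstance with hmdef
  have hev : ∀ i : ι, MeasurableSet[m] {h : Hashes Key | ENNReal.ofReal (h (t, k i) : ℝ) ≤ c i} := by
    intro i
    have hle : MeasurableSpace.comap (fun h : Hashes Key => h (t, k i)) inferInstance ≤ m :=
      le_iSup₂ (f := fun (i : ℕ × Key) (_ : i ∈ {i : ℕ × Key | i.1 = t}) =>
        MeasurableSpace.comap (fun h : Hashes Key => h i) inferInstance) (t, k i) rfl
    exact hle _ ⟨{x | ENNReal.ofReal (x : ℝ) ≤ c i},
      measurableSet_le (by fun_prop) measurable_const, rfl⟩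
  have heq : ∀ σ, MeasurableSet[m] {h : Hashes Key | selected k t c h = σ} := by
    intro σ
    have : {h : Hashes Key | selected k t c h = σ} =
        ⋂ i, {h | ENNReal.ofReal (h (t, k i) : ℝ) ≤ c i ↔ i ∈ σ} := by
      ext h
      simp [Finset.ext_iff, mem_selected]
    rw [this]
    refine @MeasurableSet.iInter _ _ m _ _ fun i => ?_
    by_cases hi : i ∈ σ
    · simpa [hi] using hev i
    · have e : {h : Hashes Key | ENNReal.ofReal (h (t, k i) : ℝ) ≤ c i ↔ i ∈ σ} =
          {h : Hashes Key | ENNReal.ofReal (h (t, k i) : ℝ) ≤ c i}ᶜ := by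
        ext h; simp [hi]
      rw [e]
      exact @MeasurableSet.compl _ _ m (hev i)
  have : {h : Hashes Key | B (selected k t c h)} =
      ⋃ σ ∈ {σ | B σ}, {h | selected k t c h = σ} := by
    ext h; simp
  rw [this]
  exact @MeasurableSet.biUnion _ _ m _ _ (Set.to_countable _) fun σ _ => heq σ

/-- Failure probabilities of samples whose sampling values depend on hash functions of larger
indices. -/
lemma hashLaw_adaptive_le {k : ι → Key} (hk : Function.Injective k) {t : ℕ}
    {Q : Hashes Key → ι → ℝ≥0∞} (hQ : Revealed t Q) (B : (ι → ℝ≥0∞) → Finset ι → Prop) {η : ℝ}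
    (hB : ∀ c, bernProb (rate c) (B c) ≤ η) :
    hashLaw Key {h | B (Q h) (selected k t (Q h) h)} ≤ ENNReal.ofReal η := by
  have hind : Indep (hashesAbove Key t) (⨆ i ∈ {i : ℕ × Key | i.1 = t},
      MeasurableSpace.comap (fun h : Hashes Key => h i) inferInstance) (hashLaw Key) :=
    indep_iSup_of_disjoint (fun i => (measurable_pi_apply i).comap_le) iIndepFun_hash.iIndep
      (Set.disjoint_left.mpr fun i hi hi' => by
        simp only [Set.mem_ofPred_eq] at hi hi'
        omega)
  rw [Indep_iff] at hind
  -- Split by the finitely many values c of Q. The event Q = c depends on hashes above t, the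
  -- selection for fixed c on the t-th one, so each piece factors and the bound η is averaged.
  set F := hQ.1.toFinset with hF
  have hsub : {h | B (Q h) (selected k t (Q h) h)} ⊆
      ⋃ c ∈ F, Q ⁻¹' {c} ∩ {h | B c (selected k t c h)} := fun h hh =>
    Set.mem_biUnion (hQ.1.mem_toFinset.mpr (Set.mem_range_self h)) ⟨rfl, hh⟩
  calc hashLaw Key {h | B (Q h) (selected k t (Q h) h)}
      ≤ ∑ c ∈ F, hashLaw Key (Q ⁻¹' {c} ∩ {h | B c (selected k t c h)}) :=
        (measure_mono hsub).trans (measure_biUnion_finset_le _ _)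
    _ ≤ ∑ c ∈ F, hashLaw Key (Q ⁻¹' {c}) * ENNReal.ofReal η := by
        refine Finset.sum_le_sum fun c _ => ?_
        rw [hind _ _ (hQ.2 c) (measurableSet_selected k t c (B c))]
        exact mul_le_mul_right ((hashLaw_selected hk t c (B c)).trans
          (ENNReal.ofReal_le_ofReal (hB c))) _
    _ = hashLaw Key (⋃ c ∈ F, Q ⁻¹' {c}) * ENNReal.ofReal η := by
        rw [← Finset.sum_mul, measure_biUnion_finset]
        · intro c _ c' _ hcc
          exact Disjoint.preimage _ (Set.disjoint_singleton.mpr hcc)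
        · exact fun c _ => hashesAbove_le t _ (hQ.2 c)
    _ ≤ 1 * ENNReal.ofReal η := mul_le_mul_left prob_le_one _
    _ = ENNReal.ofReal η := one_mul _

end Hashing

end PersonalizedCongest

end

noncomputable section

namespace PersonalizedCongest

/-! ### Sensitivities of related matrices -/

section Sensitivity

variable {p : ℝ} {d : ℕ} {m n : Type*} [Fintype m] [Fintype n]

lemma lpPow_zero (hp : 1 ≤ p) : lpPow p (0 : n → ℝ) = 0 := by
  simp [lpPow, Real.zero_rpow (by linarith : p ≠ 0)]

lemma ofReal_le_sensitivity (A : Matrix n (Fin d) ℝ) (a x : Fin d → ℝ) (hx : A *ᵥ x ≠ 0) :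
    ENNReal.ofReal (|a ⬝ᵥ x| ^ p / lpPow p (A *ᵥ x)) ≤ sensitivity p A a :=
  le_iSup₂ (f := fun (x : Fin d → ℝ) (_ : A *ᵥ x ≠ 0) =>
    ENNReal.ofReal (|a ⬝ᵥ x| ^ p / lpPow p (A *ᵥ x))) x hx

/-- If `‖B x‖^p ≤ c ‖A x‖^p`, then the sensitivities with respect to `A` are at most `c` times those
with respect to `B`, as long as `⟨a, x⟩` vanishes on the kernel of `B`. -/
lemma sensitivity_le_mul (hp : 1 ≤ p) {A : Matrix n (Fin d) ℝ} {B : Matrix m (Fin d) ℝ}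
    {a : Fin d → ℝ} {c : ℝ} (hc : 0 ≤ c)
    (h : ∀ x, lpPow p (B *ᵥ x) ≤ c * lpPow p (A *ᵥ x))
    (hker : ∀ x, A *ᵥ x ≠ 0 → B *ᵥ x = 0 → a ⬝ᵥ x = 0) :
    sensitivity p A a ≤ ENNReal.ofReal c * sensitivity p B a := by
  refine iSup₂_le fun x hx => ?_
  by_cases hB : B *ᵥ x = 0
  · rw [hker x hx hB, abs_zero, Real.zero_rpow (by linarith), zero_div, ENNReal.ofReal_zero]
    exact zero_le
  · refine le_trans ?_ (mul_le_mul_right (ofReal_le_sensitivity B a x hB) _)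
    rw [← ENNReal.ofReal_mul hc]
    refine ENNReal.ofReal_le_ofReal ?_
    have h1 := lpPow_pos (p := p) hx
    have h2 := lpPow_pos (p := p) hB
    rw [← mul_div_assoc, div_le_div_iff₀ h1 h2]
    have h3 : 0 ≤ |a ⬝ᵥ x| ^ p := Real.rpow_nonneg (abs_nonneg _) _
    nlinarith [mul_le_mul_of_nonneg_left (h x) h3]

lemma mulVec_eq_zero_of_lpPow_le {A : Matrix n (Fin d) ℝ} {B : Matrix m (Fin d) ℝ} (hp : 1 ≤ p)
    {c : ℝ} {x : Fin d → ℝ} (h : lpPow p (A *ᵥ x) ≤ c * lpPow p (B *ᵥ x)) (hB : B *ᵥ x = 0) :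
    A *ᵥ x = 0 := by
  by_contra hA
  rw [hB, lpPow_zero hp, mul_zero] at h
  exact absurd h (not_le.mpr (lpPow_pos hA))

lemma sensitivity_le_of_embedding (hp : 1 ≤ p) {ε : ℝ} (hε1 : ε < 1)
    {M : Matrix m (Fin d) ℝ} {A : Matrix n (Fin d) ℝ} (h : IsSubspaceEmbedding p ε M A)
    (a : Fin d → ℝ) : sensitivity p M a ≤ ENNReal.ofReal (1 / (1 - ε)) * sensitivity p A a := by
  have h1 : 0 < 1 - ε := by linarith
  refine sensitivity_le_mul hp (by positivity) (fun x => ?_) fun x hM hA => ?_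
  · rw [one_div, le_inv_mul_iff₀ h1]
    exact (h x).1
  · exact absurd (mulVec_eq_zero_of_lpPow_le hp (h x).2 hA) hM

lemma sensitivity_le_of_embedding' (hp : 1 ≤ p) {ε : ℝ} (hε0 : 0 ≤ ε) (hε1 : ε < 1)
    {M : Matrix m (Fin d) ℝ} {A : Matrix n (Fin d) ℝ} (h : IsSubspaceEmbedding p ε M A)
    (a : Fin d → ℝ) : sensitivity p A a ≤ ENNReal.ofReal (1 + ε) * sensitivity p M a := by
  refine sensitivity_le_mul hp (by positivity) (fun x => (h x).2) fun x hA hM => ?_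
  refine absurd (mulVec_eq_zero_of_lpPow_le hp (c := 1 / (1 - ε)) ?_ hM) hA
  rw [one_div, le_inv_mul_iff₀ (by linarith)]
  exact (h x).1

variable {Key : Type*}

lemma lpPow_vals (p : ℝ) (A : Dataset Key d) (x : Fin d → ℝ) :
    lpPow p (A.vals *ᵥ x) = ∑ item ∈ A, |item.2 ⬝ᵥ x| ^ p :=
  Finset.sum_coe_sort A fun item => |item.2 ⬝ᵥ x| ^ p

/-- Additional rows only enlarge ‖Ax‖_p^p. Since the item is itself a row of the smaller dataset, it
vanishes on the kernel there, so directions invisible to that dataset contribute nothing. -/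
lemma sensitivity_vals_anti (hp : 1 ≤ p) {A B : Dataset Key d} (hAB : A ⊆ B)
    {item : Key × (Fin d → ℝ)} (hi : item ∈ A) :
    sensitivity p B.vals item.2 ≤ sensitivity p A.vals item.2 := by
  have := sensitivity_le_mul (p := p) (A := B.vals) (B := A.vals) (a := item.2) (c := 1) hp
    zero_le_one (fun x => ?_) fun x _ hA => ?_
  · simpa using this
  · rw [one_mul, lpPow_vals, lpPow_vals]
    exact Finset.sum_le_sum_of_subset_of_nonneg hAB fun _ _ _ => Real.rpow_nonneg (abs_nonneg _) _
  · exact congrFun hA ⟨item, hi⟩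

end Sensitivity

/-! ### Drawing rows with given sampling values -/

section Draw

universe u

variable {Key : Type*} {d : ℕ}

open Classical in
/-- The rows that the `j`-th hash function selects from a dataset, with the sampling values `c`. -/
def drawRows (h : Hashes Key) (j : ℕ) (D : Dataset Key d) (c : Key × (Fin d → ℝ) → ℝ≥0∞) :
    Finset (SampledRow Key d) :=
  (D.filter fun item => ENNReal.ofReal (h (j, item.1) : ℝ) ≤ c item).image
    fun item => ⟨item.1, item.2, (min 1 (c item)).toNNReal⟩

lemma mem_drawRows {h : Hashes Key} {j : ℕ} {D : Dataset Key d} {c : Key × (Fin d → ℝ) → ℝ≥0∞}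
    {r : SampledRow Key d} : r ∈ drawRows h j D c ↔ (r.key, r.val) ∈ D ∧
      ENNReal.ofReal (h (j, r.key) : ℝ) ≤ c (r.key, r.val) ∧
      r.prob = (min 1 (c (r.key, r.val))).toNNReal := by
  simp only [drawRows, Finset.mem_image, Finset.mem_filter]
  constructor
  · rintro ⟨item, ⟨h1, h2⟩, rfl⟩
    exact ⟨h1, h2, rfl⟩
  · rintro ⟨h1, h2, h3⟩
    refine ⟨(r.key, r.val), ⟨h1, h2⟩, ?_⟩
    rw [← h3]

/-- The keys of a dataset. -/
def Dataset.keys (D : Dataset Key d) (i : D) : Key := i.1.1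

lemma lpPow_rescaledMatrix {p : ℝ} (hp : 1 ≤ p) (R : Finset (SampledRow Key d)) (x : Fin d → ℝ) :
    lpPow p (rescaledMatrix p R *ᵥ x) = ∑ r ∈ R, 1 / (r.prob : ℝ) * |r.val ⬝ᵥ x| ^ p := by
  rw [← Finset.sum_coe_sort]
  refine Finset.sum_congr rfl fun r _ => ?_
  have h0 : 0 ≤ 1 / (r.1.prob : ℝ) := by positivity
  have e : (rescaledMatrix p R *ᵥ x) r = (1 / (r.1.prob : ℝ)) ^ (1 / p) * (r.1.val ⬝ᵥ x) := by
    simp only [rescaledMatrix, Matrix.mulVec, dotProduct, Finset.mul_sum, mul_assoc]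
  rw [e, abs_mul, abs_of_nonneg (Real.rpow_nonneg h0 _),
    Real.mul_rpow (Real.rpow_nonneg h0 _) (abs_nonneg _), ← Real.rpow_mul h0,
    one_div_mul_cancel (by linarith), Real.rpow_one]

open Classical in
-- Links sketches to the Bernoulli model: the error of the rescaled sample is the centered sum.
-- Items of value 0 agree too, both sides reading 1 / 0 as 0.
lemma lpPow_drawRows {p : ℝ} (hp : 1 ≤ p) (h : Hashes Key) (j : ℕ) (D : Dataset Key d)
    (c : Key × (Fin d → ℝ) → ℝ≥0∞) (x : Fin d → ℝ) :
    lpPow p (rescaledMatrix p (drawRows h j D c) *ᵥ x) =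
      lpPow p (D.vals *ᵥ x) + ∑ i : D, centeredCoeff (rate fun i : D => c i)
        (selected D.keys j (fun i : D => c i) h) i * |(D.vals *ᵥ x) i| ^ p := by
  rw [lpPow_rescaledMatrix hp, drawRows, Finset.sum_image, Finset.sum_filter, lpPow,
    ← Finset.sum_add_distrib, ← Finset.sum_coe_sort]
  · refine Finset.sum_congr rfl fun i _ => ?_
    have e : (D.vals *ᵥ x) i = i.1.2 ⬝ᵥ x := rfl
    rw [e, centeredCoeff]
    simp only [mem_selected, Dataset.keys, rate]
    split_ifs
    · change 1 / (min 1 (c i)).toReal * _ = _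
      ring
    · ring
  · intro i _ i' _ h
    simp only [SampledRow.mk.injEq] at h
    exact Prod.ext h.1 h.2.1

/-- The sampling values `c` lead to a good approximation of the dataset. -/
def GoodDraw (p ε : ℝ) (h : Hashes Key) (j : ℕ) (D : Dataset Key d)
    (c : Key × (Fin d → ℝ) → ℝ≥0∞) : Prop :=
  IsSubspaceEmbedding p ε (rescaledMatrix p (drawRows h j D c)) D.vals

/-- The lower bound on the values is put inside the event rather than conditioned on. The estimate
then holds unconditionally, and the lower bound is supplied later, on the good event, by induction
over the rounds. -/
lemma hashLaw_not_goodDraw_le {Key : Type u} {p ε κ η : ℝ} (hp : 1 ≤ p) (hη : 0 ≤ η)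
    (hS : SamplesWell.{u} p ε κ η d) {D : Dataset Key d} (hD : Function.Injective D.keys) {j : ℕ}
    {c : Hashes Key → Key × (Fin d → ℝ) → ℝ≥0∞} (hc : Revealed j c) :
    hashLaw Key {h | (∀ item ∈ D, ENNReal.ofReal κ * sensitivity p D.vals item.2 ≤ c h item) ∧
      ¬ GoodDraw p ε h j D (c h)} ≤ ENNReal.ofReal η := by
  classical
  refine (measure_mono ?_).trans (hashLaw_adaptive_le (k := D.keys) hD
    (Q := fun h (i : D) => c h i) (hc.comp fun c (i : D) => c i)
    (fun c σ => (∀ i : D, ENNReal.ofReal κ * sensitivity p D.vals (D.vals i) ≤ c i) ∧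
      ∃ x, ε * lpPow p (D.vals *ᵥ x) <
        |∑ i, centeredCoeff (rate c) σ i * |(D.vals *ᵥ x) i| ^ p|) (η := η) fun c => ?_)
  · rintro h ⟨h1, h2⟩
    refine ⟨fun i => h1 i i.2, ?_⟩
    by_contra! hcon
    refine h2 fun x => ?_
    have := abs_le.mp (hcon x)
    rw [lpPow_drawRows hp]
    constructor <;> linarith [this.1, this.2]
  · by_cases hcκ : ∀ i : D, ENNReal.ofReal κ * sensitivity p D.vals (D.vals i) ≤ c i
    · refine (bernProb_mono (rate_nonneg c) (rate_le_one c) fun σ hσ => hσ.2).trans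
        (hS D D.vals (rate c) (rate_nonneg c) (rate_le_one c) fun i => ?_)
      rw [ofReal_rate]
      exact min_le_min_left _ (hcκ i)
    · refine le_trans (le_of_eq (Finset.sum_eq_zero fun σ _ => if_neg fun h => hcκ h.1)) hη

lemma card_drawRows_le (h : Hashes Key) (j : ℕ) (D : Dataset Key d)
    (c : Key × (Fin d → ℝ) → ℝ≥0∞) :
    (drawRows h j D c).card ≤ (selected D.keys j (fun i : D => c i) h).card := by
  classical
  refine Finset.card_image_le.trans ?_
  have : D.filter (fun item => ENNReal.ofReal (h (j, item.1) : ℝ) ≤ c item) =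
      (selected D.keys j (fun i : D => c i) h).map (Function.Embedding.subtype _) := by
    ext item
    simp only [Finset.mem_filter, Finset.mem_map, mem_selected, Dataset.keys,
      Function.Embedding.coe_subtype, Subtype.exists, exists_and_right, exists_eq_right]
    constructor
    · rintro ⟨h1, h2⟩; exact ⟨h1, h2⟩
    · rintro ⟨h1, h2⟩; exact ⟨h1, h2⟩
  rw [this, Finset.card_map]

lemma hashLaw_card_drawRows_le {p K B η : ℝ} (hp : 1 ≤ p) (hK : 0 ≤ K) (hη : 0 ≤ η)
    (hB : K * (d : ℝ) ^ max (p / 2) 1 ≤ B) (hBη : B = 0 ∨ Real.exp (-B) ≤ η)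
    {D : Dataset Key d} (hD : Function.Injective D.keys) {j : ℕ}
    {c : Hashes Key → Key × (Fin d → ℝ) → ℝ≥0∞} (hc : Revealed j c) :
    hashLaw Key {h | (∀ item ∈ D, c h item ≤ ENNReal.ofReal K * sensitivity p D.vals item.2) ∧
      3 * B < ((drawRows h j D (c h)).card : ℝ)} ≤ ENNReal.ofReal η := by
  classical
  refine (measure_mono ?_).trans (hashLaw_adaptive_le (k := D.keys) hD
    (Q := fun h (i : D) => c h i) (hc.comp fun c (i : D) => c i)
    (fun c σ => (∀ i : D, c i ≤ ENNReal.ofReal K * sensitivity p D.vals (D.vals i)) ∧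
      3 * B < (σ.card : ℝ)) (η := η) fun c => ?_)
  · rintro h ⟨h1, h2⟩
    exact ⟨fun i => h1 i i.2, h2.trans_le (Nat.cast_le.mpr (card_drawRows_le h j D (c h)))⟩
  · by_cases hcK : ∀ i : D, c i ≤ ENNReal.ofReal K * sensitivity p D.vals (D.vals i)
    · have hW0 : 0 ≤ (d : ℝ) ^ max (p / 2) 1 := Real.rpow_nonneg (Nat.cast_nonneg d) _
      have hB0 : 0 ≤ B := le_trans (mul_nonneg hK hW0) hB
      have hsum : ∑ i, rate c i ≤ B := by
        rw [← ENNReal.ofReal_le_ofReal_iff hB0, ENNReal.ofReal_sum_of_nonneg fun i _ =>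
          rate_nonneg c i]
        refine le_trans ?_ (ENNReal.ofReal_le_ofReal hB)
        rw [ENNReal.ofReal_mul hK]
        refine le_trans ?_ (mul_le_mul_right (sum_sensitivity_le hp D.vals) _)
        rw [Finset.mul_sum]
        refine Finset.sum_le_sum fun i _ => ?_
        rw [ofReal_rate]
        exact (min_le_right _ _).trans (hcK i)
      refine (bernProb_mono (rate_nonneg c) (rate_le_one c) fun σ hσ => hσ.2).trans ?_
      rcases hBη with h0 | h0
      · have hz : ∀ i, rate c i = 0 := fun i =>
          (Finset.sum_eq_zero_iff_of_nonneg fun i _ => rate_nonneg c i).mp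
            (le_antisymm (hsum.trans_eq h0) (Finset.sum_nonneg fun i _ => rate_nonneg c i)) i
            (Finset.mem_univ i)
        rw [h0, mul_zero]
        simp only [Nat.cast_pos]
        rw [bernProb_nonempty_of_zero hz]
        exact hη
      · exact (bernProb_card_le (rate_nonneg c) (rate_le_one c) hsum).trans h0
    · refine le_trans (le_of_eq (Finset.sum_eq_zero fun σ _ => if_neg fun h => hcK h.1)) hη

/-- The sample depends on the hashes only through finitely many threshold comparisons, so it takes
finitely many values. -/
lemma revealed_drawRows {t j : ℕ} (hj : t < j) (D : Dataset Key d)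
    (c : Key × (Fin d → ℝ) → ℝ≥0∞) : Revealed t fun h => drawRows h j D c := by
  classical
  have h1 : Revealed t fun (h : Hashes Key) (i : D) => ENNReal.ofReal (h (j, i.1.1) : ℝ) ≤ c i :=
    Revealed.pi fun i => Revealed.threshold (i := (j, i.1.1)) hj _
  have h2 := h1.comp fun (Q : D → Prop) => (D.filter fun item => ∃ hi : item ∈ D, Q ⟨item, hi⟩).image
    fun item => (⟨item.1, item.2, (min 1 (c item)).toNNReal⟩ : SampledRow Key d)
  convert h2 using 2 with h
  ext r
  simp only [mem_drawRows, Finset.mem_image, Finset.mem_filter]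
  constructor
  · rintro ⟨h1, h2, h3⟩
    exact ⟨(r.key, r.val), ⟨h1, h1, h2⟩, by rw [← h3]⟩
  · rintro ⟨item, ⟨h1, _, h2⟩, rfl⟩
    exact ⟨h1, h2, rfl⟩

end Draw

end PersonalizedCongest

end

noncomputable section

namespace PersonalizedCongest

/-! ### Sketches that follow a plan -/

section Plan

variable {Key : Type*} {d : ℕ}

/-- A plan describes a sketch: the number of its copies, the dataset from which it is sampled, and
the sampling values. -/
structure Plan (Key : Type*) (d : ℕ) where
  copies : ℕ
  data : Dataset Key d
  value : (Fin d → ℝ) → ℝ≥0∞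

open Classical in
/-- The sketch that is described by a plan. -/
def Plan.sketch (s : Plan Key d) (h : Hashes Key) : Sketch Key d where
  copies := s.copies
  sample j := if j ∈ Finset.Icc 1 s.copies then drawRows h j s.data (fun item => s.value item.2)
    else ∅

/-- The plan of a new sketch. -/
def Plan.create (P : SketchParams) (A : Dataset Key d) : Plan Key d where
  copies := P.copies
  data := A
  value a := ENNReal.ofReal (P.κ * (1 + P.ε) ^ P.copies) * sensitivity P.p A.vals a

variable {ι : Type*}

open Classical in
/-- The largest sampling value of an item in those of the planned sketches whose dataset contains
it. -/
def pooledValue (I : Finset ι) (s : ι → Plan Key d) (item : Key × (Fin d → ℝ)) : ℝ≥0∞ :=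
  (I.filter fun i => item ∈ (s i).data).sup fun i => (s i).value item.2

open Classical in
/-- The union of the datasets of plans. -/
def pooledData (I : Finset ι) (s : ι → Plan Key d) : Dataset Key d :=
  I.biUnion fun i => (s i).data

lemma mem_pooledData {I : Finset ι} {s : ι → Plan Key d} {item : Key × (Fin d → ℝ)} :
    item ∈ pooledData I s ↔ ∃ i ∈ I, item ∈ (s i).data := by
  simp [pooledData]

/-- The least number of copies of planned sketches. -/
def minCopies (T : ℕ) (I : Finset ι) (s : ι → Plan Key d) : ℕ :=
  I.fold min T fun i => (s i).copies

lemma minCopies_le {T : ℕ} {I : Finset ι} {s : ι → Plan Key d} {i : ι} (hi : i ∈ I) :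
    minCopies T I s ≤ (s i).copies :=
  (Finset.le_fold_min (minCopies T I s)).mp le_rfl |>.2 i hi

/-- The plan of a merged sketch. -/
def Plan.merge (P : SketchParams) (h : Hashes Key) (I : Finset ι) (s : ι → Plan Key d) :
    Plan Key d where
  copies := minCopies P.copies I s - 1
  data := pooledData I s
  value a := ENNReal.ofReal (P.κ * ((1 + P.ε) ^ (minCopies P.copies I s - 1) * (1 + P.ε / 4))) *
    sensitivity P.p (rescaledMatrix P.p (drawRows h (minCopies P.copies I s) (pooledData I s)
      (pooledValue I s))) a

lemma value_le_pooledValue {I : Finset ι} {s : ι → Plan Key d} {i : ι} (hi : i ∈ I)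
    {item : Key × (Fin d → ℝ)} (hit : item ∈ (s i).data) :
    (s i).value item.2 ≤ pooledValue I s item := by
  classical
  exact Finset.le_sup (f := fun i => (s i).value item.2) (Finset.mem_filter.mpr ⟨hi, hit⟩)

lemma exists_value_eq_pooledValue {I : Finset ι} {s : ι → Plan Key d}
    {item : Key × (Fin d → ℝ)} (hit : item ∈ pooledData I s) :
    ∃ i ∈ I, item ∈ (s i).data ∧ (s i).value item.2 = pooledValue I s item := by
  classical
  obtain ⟨j, hj, hij⟩ := mem_pooledData.mp hit
  obtain ⟨i, hi, he⟩ := Finset.exists_mem_eq_sup (I.filter fun i => item ∈ (s i).data)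
    ⟨j, Finset.mem_filter.mpr ⟨hj, hij⟩⟩ fun i => (s i).value item.2
  exact ⟨i, (Finset.mem_filter.mp hi).1, (Finset.mem_filter.mp hi).2, he.symm⟩

lemma mem_pooled {h : Hashes Key} {I : Finset ι} {s : ι → Plan Key d} {j : ℕ} (hj : 1 ≤ j)
    (hjc : ∀ i ∈ I, j ≤ (s i).copies) {r : SampledRow Key d} :
    r ∈ pooled (I.val.map fun i => (s i).sketch h) j ↔
      ∃ i ∈ I, r ∈ drawRows h j (s i).data fun item => (s i).value item.2 := by
  classical
  simp only [pooled, Finset.mem_biUnion, Multiset.mem_toFinset, Multiset.mem_map, Finset.mem_val]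
  constructor
  · rintro ⟨_, ⟨i, hi, rfl⟩, hr⟩
    refine ⟨i, hi, ?_⟩
    simpa [Plan.sketch, hj, hjc i hi] using hr
  · rintro ⟨i, hi, hr⟩
    refine ⟨_, ⟨i, hi, rfl⟩, ?_⟩
    simpa [Plan.sketch, hj, hjc i hi] using hr

lemma min_one_ne_top (c : ℝ≥0∞) : min 1 c ≠ ⊤ :=
  ne_top_of_le_ne_top ENNReal.one_ne_top (min_le_left _ _)

lemma toNNReal_min_one_mono {c c' : ℝ≥0∞} (h : c ≤ c') :
    (min 1 c).toNNReal ≤ (min 1 c').toNNReal :=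
  ENNReal.toNNReal_mono (min_one_ne_top _) (min_le_min_left _ h)

/-- The largest stored probability of an item belongs to its largest sampling value. -/
lemma maxProb_pooled {h : Hashes Key} {I : Finset ι} {s : ι → Plan Key d} {j : ℕ} (hj : 1 ≤ j)
    (hjc : ∀ i ∈ I, j ≤ (s i).copies) {item : Key × (Fin d → ℝ)} (hit : item ∈ pooledData I s)
    (hsel : ENNReal.ofReal (h (j, item.1) : ℝ) ≤ pooledValue I s item) :
    maxProb (pooled (I.val.map fun i => (s i).sketch h) j) item.1 item.2 =
      (min 1 (pooledValue I s item)).toNNReal := by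
  classical
  refine le_antisymm (Finset.sup_le fun r hr => ?_) ?_
  · obtain ⟨hr, hk, hv⟩ := Finset.mem_filter.mp hr
    obtain ⟨i, hi, hr⟩ := (mem_pooled hj hjc).mp hr
    obtain ⟨h1, _, h3⟩ := mem_drawRows.mp hr
    rw [h3]
    rw [hk, hv] at h1
    rw [hv]
    exact toNNReal_min_one_mono (value_le_pooledValue hi h1)
  · obtain ⟨i, hi, hid, he⟩ := exists_value_eq_pooledValue hit
    rw [← he]
    refine Finset.le_sup (f := SampledRow.prob) (b := ⟨item.1, item.2, _⟩)
      (Finset.mem_filter.mpr ⟨(mem_pooled hj hjc).mpr ⟨i, hi, mem_drawRows.mpr ⟨hid, ?_, rfl⟩⟩,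
        rfl, rfl⟩)
    simpa only [he] using hsel

/-- An item passes the largest of its thresholds exactly when it occurs in some sample, because all
samples compare the same hash value. The plan attaining the largest value then has it in its sample,
so the largest stored probability is the right one. -/
lemma dedup_pooled {h : Hashes Key} {I : Finset ι} {s : ι → Plan Key d} {j : ℕ} (hj : 1 ≤ j)
    (hjc : ∀ i ∈ I, j ≤ (s i).copies) :
    dedup (pooled (I.val.map fun i => (s i).sketch h) j) =
      drawRows h j (pooledData I s) (pooledValue I s) := by
  classical
  ext r
  simp only [dedup, Finset.mem_image]
  constructor
  · rintro ⟨r', hr', rfl⟩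
    obtain ⟨i, hi, hr⟩ := (mem_pooled hj hjc).mp hr'
    obtain ⟨h1, h2, _⟩ := mem_drawRows.mp hr
    have hit : (r'.key, r'.val) ∈ pooledData I s := mem_pooledData.mpr ⟨i, hi, h1⟩
    have hsel := h2.trans (value_le_pooledValue hi h1)
    exact mem_drawRows.mpr ⟨hit, hsel, maxProb_pooled hj hjc hit hsel⟩
  · intro hr
    obtain ⟨h1, h2, h3⟩ := mem_drawRows.mp hr
    obtain ⟨i, hi, hid, he⟩ := exists_value_eq_pooledValue h1
    refine ⟨⟨r.key, r.val, (min 1 ((s i).value r.val)).toNNReal⟩,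
      (mem_pooled hj hjc).mpr ⟨i, hi, mem_drawRows.mpr ⟨hid, ?_, rfl⟩⟩, ?_⟩
    · simpa only [he] using h2
    · have := maxProb_pooled hj hjc h1 h2
      simp only at this ⊢
      rw [this, ← h3]

/-- If the sampling values decrease, then merging does not fail, and follows the merged plan. -/
lemma mergeAll_sketch (P : SketchParams) (h : Hashes Key) (I : Finset ι) (s : ι → Plan Key d)
    (ht : 1 ≤ minCopies P.copies I s)
    (hmono : ∀ i ∈ I, ∀ item ∈ (s i).data,
      (Plan.merge P h I s).value item.2 ≤ (s i).value item.2) :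
    mergeAll P h (I.val.map fun i => some ((s i).sketch h)) =
      some ((Plan.merge P h I s).sketch h) := by
  classical
  have hnone : none ∉ I.val.map fun i => some ((s i).sketch h) := by simp
  have hfm : (I.val.map fun i => some ((s i).sketch h)).filterMap id =
      I.val.map fun i => (s i).sketch h := by
    rw [Multiset.filterMap_map]
    exact Multiset.filterMap_eq_map _ ▸ rfl
  rw [mergeAll, if_neg hnone, hfm]
  set l := I.val.map fun i => (s i).sketch h with hl
  have hfold : (l.map Sketch.copies).fold min P.copies = minCopies P.copies I s := by
    rw [hl, Multiset.map_map]
    rfl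
  have hcop : ∀ i ∈ I, minCopies P.copies I s ≤ (s i).copies := fun i hi => minCopies_le hi
  set t := minCopies P.copies I s with htdef
  have hval : ∀ a, ENNReal.ofReal (P.κ * ((1 + P.ε) ^ (t - 1) * (1 + P.ε / 4))) *
      sensitivity P.p (rescaledMatrix P.p
        (dedup (pooled l ((l.map Sketch.copies).fold min P.copies)))) a =
        (Plan.merge P h I s).value a := by
    intro a
    rw [hfold, hl, dedup_pooled ht hcop]
    rfl
  rw [Sketch.merge]
  simp only [hfold, hval]
  have hj1 : ∀ j ∈ Finset.Icc 1 (t - 1), 1 ≤ j ∧ ∀ i ∈ I, j ≤ (s i).copies := fun j hj => by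
    rw [Finset.mem_Icc] at hj
    exact ⟨hj.1, fun i hi => by have := hcop i hi; omega⟩
  have hnofail : ¬ ∃ j ∈ Finset.Icc 1 (t - 1), ∃ r ∈ pooled l j,
      maxProb (pooled l j) r.key r.val <
        (min 1 ((Plan.merge P h I s).value r.val)).toNNReal := by
    rintro ⟨j, hj, r, hr, hlt⟩
    obtain ⟨hj0, hjc⟩ := hj1 j hj
    obtain ⟨i, hi, hrd⟩ := (mem_pooled hj0 hjc).mp hr
    obtain ⟨h1, _, h3⟩ := mem_drawRows.mp hrd
    have hle : r.prob ≤ maxProb (pooled l j) r.key r.val :=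
      Finset.le_sup (f := SampledRow.prob) (Finset.mem_filter.mpr ⟨hr, rfl, rfl⟩)
    have := toNNReal_min_one_mono (hmono i hi _ h1)
    rw [← h3] at this
    exact absurd (hlt.trans_le (this.trans hle)) (lt_irrefl _)
  rw [if_neg hnofail]
  congr 1
  rw [Plan.sketch, Sketch.mk.injEq]
  refine ⟨rfl, funext fun j => ?_⟩
  have hc : (Plan.merge P h I s).copies = t - 1 := rfl
  rw [hc]
  split_ifs with hj
  swap
  · rfl
  obtain ⟨hj0, hjc⟩ := hj1 j hj
  ext r
  simp only [Finset.mem_image, Finset.mem_filter]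
  constructor
  · rintro ⟨r', ⟨hr', hsel⟩, rfl⟩
    obtain ⟨i, hi, hrd⟩ := (mem_pooled hj0 hjc).mp hr'
    exact mem_drawRows.mpr ⟨mem_pooledData.mpr ⟨i, hi, (mem_drawRows.mp hrd).1⟩, hsel, rfl⟩
  · intro hr
    obtain ⟨h1, h2, h3⟩ := mem_drawRows.mp hr
    obtain ⟨i, hi, hid⟩ := mem_pooledData.mp h1
    refine ⟨⟨r.key, r.val, (min 1 ((s i).value r.val)).toNNReal⟩,
      ⟨(mem_pooled hj0 hjc).mpr ⟨i, hi, mem_drawRows.mpr ⟨hid, ?_, rfl⟩⟩, h2⟩, ?_⟩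
    · exact h2.trans (hmono i hi _ hid)
    · simp only
      rw [← h3]

/-- The sampling values of a plan are approximately proportional to the sensitivities. -/
def Plan.Accurate (P : SketchParams) (s : Plan Key d) : Prop :=
  ∀ item ∈ s.data,
    ENNReal.ofReal (P.κ * (1 + P.ε) ^ s.copies) * sensitivity P.p s.data.vals item.2 ≤
      s.value item.2 ∧
    s.value item.2 ≤
      ENNReal.ofReal (P.κ * (1 + P.ε) ^ (s.copies + 1)) * sensitivity P.p s.data.vals item.2

lemma Plan.accurate_create (P : SketchParams) (hε : 0 ≤ P.ε) (hκ : 0 ≤ P.κ) (A : Dataset Key d) :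
    (Plan.create P A).Accurate P := by
  refine fun item _ => ⟨le_rfl, mul_le_mul_left (ENNReal.ofReal_le_ofReal ?_) _⟩
  have : (1 + P.ε) ^ P.copies ≤ (1 + P.ε) ^ (P.copies + 1) :=
    pow_le_pow_right₀ (by linarith) (Nat.le_succ _)
  exact mul_le_mul_of_nonneg_left this hκ

/-- With t the least number of copies, this is the lower bound that the merged values must not
exceed for the merge to succeed; with t = 0 it supplies the rate that sampling needs. -/
lemma le_value_of_accurate {P : SketchParams} (hp : 1 ≤ P.p) (hε : 0 ≤ P.ε) (hκ : 0 ≤ P.κ)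
    {I : Finset ι} {s : ι → Plan Key d} (hs : ∀ i ∈ I, (s i).Accurate P) {t : ℕ}
    (ht : ∀ i ∈ I, t ≤ (s i).copies) {i : ι} (hi : i ∈ I) {item : Key × (Fin d → ℝ)}
    (hit : item ∈ (s i).data) :
    ENNReal.ofReal (P.κ * (1 + P.ε) ^ t) * sensitivity P.p (pooledData I s).vals item.2 ≤
      (s i).value item.2 := by
  classical
  refine le_trans (mul_le_mul' (ENNReal.ofReal_le_ofReal ?_) ?_) (hs i hi item hit).1
  · exact mul_le_mul_of_nonneg_left (pow_le_pow_right₀ (by linarith) (ht i hi)) hκ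
  · exact sensitivity_vals_anti hp (Finset.subset_biUnion_of_mem (fun i => (s i).data) hi) hit

lemma le_pooledValue_of_accurate {P : SketchParams} (hp : 1 ≤ P.p) (hε : 0 ≤ P.ε) (hκ : 0 ≤ P.κ)
    {I : Finset ι} {s : ι → Plan Key d} (hs : ∀ i ∈ I, (s i).Accurate P)
    {item : Key × (Fin d → ℝ)} (hit : item ∈ pooledData I s) :
    ENNReal.ofReal P.κ * sensitivity P.p (pooledData I s).vals item.2 ≤ pooledValue I s item := by
  obtain ⟨i, hi, hid⟩ := mem_pooledData.mp hit
  refine le_trans ?_ (value_le_pooledValue hi hid)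
  simpa using le_value_of_accurate hp hε hκ hs (t := 0) (fun _ _ => Nat.zero_le _) hi hid

/-- The factor 1 + ε/4 in the merged value compensates the largest possible loss of sensitivity when
passing to M; the overshoot (1 + ε/4)/(1 - ε/4) is at most 1 + ε, which the lost copy pays for. -/
lemma merge_bounds {P : SketchParams} (hp : 1 ≤ P.p) (hε : 0 ≤ P.ε) (hε1 : P.ε ≤ 1) (hκ : 0 ≤ P.κ)
    {h : Hashes Key} {I : Finset ι} {s : ι → Plan Key d} (ht : 1 ≤ minCopies P.copies I s)
    (hgood : GoodDraw P.p (P.ε / 4) h (minCopies P.copies I s) (pooledData I s)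
      (pooledValue I s)) (a : Fin d → ℝ) :
    ENNReal.ofReal (P.κ * (1 + P.ε) ^ (minCopies P.copies I s - 1)) *
        sensitivity P.p (pooledData I s).vals a ≤ (Plan.merge P h I s).value a ∧
      (Plan.merge P h I s).value a ≤ ENNReal.ofReal (P.κ * (1 + P.ε) ^ minCopies P.copies I s) *
        sensitivity P.p (pooledData I s).vals a := by
  set t := minCopies P.copies I s with htdef
  set M := rescaledMatrix P.p (drawRows h t (pooledData I s) (pooledValue I s)) with hM
  have hval : (Plan.merge P h I s).value a =
      ENNReal.ofReal (P.κ * ((1 + P.ε) ^ (t - 1) * (1 + P.ε / 4))) * sensitivity P.p M a := rfl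
  have hpow : 0 ≤ (1 + P.ε) ^ (t - 1) := by positivity
  rw [hval]
  constructor
  · refine (mul_le_mul_right (sensitivity_le_of_embedding' hp (by linarith) (by linarith)
      hgood a) _).trans (le_of_eq ?_)
    rw [← mul_assoc, ← ENNReal.ofReal_mul (by positivity)]
    congr 2
    ring
  · refine (mul_le_mul_right (sensitivity_le_of_embedding hp (by linarith) hgood a) _).trans ?_
    rw [← mul_assoc, ← ENNReal.ofReal_mul (by positivity)]
    refine mul_le_mul_left (ENNReal.ofReal_le_ofReal ?_) _
    have e : (1 + P.ε) ^ t = (1 + P.ε) ^ (t - 1) * (1 + P.ε) := by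
      rw [← pow_succ, Nat.sub_add_cancel ht]
    have h1 : (1 + P.ε / 4) * (1 / (1 - P.ε / 4)) ≤ 1 + P.ε := by
      rw [mul_one_div, div_le_iff₀ (by linarith)]
      nlinarith
    calc P.κ * ((1 + P.ε) ^ (t - 1) * (1 + P.ε / 4)) * (1 / (1 - P.ε / 4))
        = P.κ * (1 + P.ε) ^ (t - 1) * ((1 + P.ε / 4) * (1 / (1 - P.ε / 4))) := by ring
      _ ≤ P.κ * (1 + P.ε) ^ (t - 1) * (1 + P.ε) := mul_le_mul_of_nonneg_left h1 (by positivity)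
      _ = P.κ * (1 + P.ε) ^ t := by rw [e]; ring

lemma Plan.accurate_merge {P : SketchParams} (hp : 1 ≤ P.p) (hε : 0 ≤ P.ε) (hε1 : P.ε ≤ 1)
    (hκ : 0 ≤ P.κ) {h : Hashes Key} {I : Finset ι} {s : ι → Plan Key d}
    (ht : 1 ≤ minCopies P.copies I s)
    (hgood : GoodDraw P.p (P.ε / 4) h (minCopies P.copies I s) (pooledData I s)
      (pooledValue I s)) : (Plan.merge P h I s).Accurate P := by
  intro item _
  have := merge_bounds hp hε hε1 hκ ht hgood item.2
  have e : (Plan.merge P h I s).copies + 1 = minCopies P.copies I s := Nat.sub_add_cancel ht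
  rw [e]
  exact this

lemma mergeAll_sketch_of_good {P : SketchParams} (hp : 1 ≤ P.p) (hε : 0 ≤ P.ε) (hε1 : P.ε ≤ 1)
    (hκ : 0 ≤ P.κ) {h : Hashes Key} {I : Finset ι} {s : ι → Plan Key d}
    (hs : ∀ i ∈ I, (s i).Accurate P) (ht : 1 ≤ minCopies P.copies I s)
    (hgood : GoodDraw P.p (P.ε / 4) h (minCopies P.copies I s) (pooledData I s)
      (pooledValue I s)) :
    mergeAll P h (I.val.map fun i => some ((s i).sketch h)) =
      some ((Plan.merge P h I s).sketch h) :=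
  mergeAll_sketch P h I s ht fun _ hi _ hit =>
    (merge_bounds hp hε hε1 hκ ht hgood _).2.trans
      (le_value_of_accurate hp hε hκ hs (fun _ hj => minCopies_le hj) hi hit)

/-- The plan of a merged sketch depends on one more hash function than the plans of the given
sketches. -/
lemma revealed_merge (P : SketchParams) {I : Finset ι} {s : Hashes Key → ι → Plan Key d}
    {t : ℕ} {D : Dataset Key d} (ht : ∀ h, minCopies P.copies I (s h) = t) (ht1 : 1 ≤ t)
    (hD : ∀ h, pooledData I (s h) = D) (hs : ∀ i ∈ I, Revealed t fun h => s h i) :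
    (Revealed t fun h => pooledValue I (s h)) ∧
      Revealed (t - 1) fun h => Plan.merge P h I (s h) := by
  classical
  have h1 : Revealed t fun h (i : I) => s h i := Revealed.pi fun i => hs i i.2
  have h2 : Revealed t fun h => pooledValue I (s h) := by
    have := h1.comp fun (s : I → Plan Key d) => pooledValue Finset.univ s
    convert this using 2 with h
    ext item
    simp only [pooledValue]
    refine le_antisymm (Finset.sup_le fun i hi => ?_) (Finset.sup_le fun i hi => ?_)
    · rw [Finset.mem_filter] at hi
      exact Finset.le_sup (f := fun i : I => (s h i).value item.2) (b := ⟨i, hi.1⟩)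
        (Finset.mem_filter.mpr ⟨Finset.mem_univ _, hi.2⟩)
    · rw [Finset.mem_filter] at hi
      exact Finset.le_sup (f := fun i => (s h i).value item.2) (b := i.1)
        (Finset.mem_filter.mpr ⟨i.2, hi.2⟩)
  refine ⟨h2, ?_⟩
  have h3 := (h2.anti (Nat.sub_le t 1)).bind (g := fun c h => drawRows h t D c) fun c =>
    revealed_drawRows (by omega) D c
  have h4 := h3.comp fun R => (⟨t - 1, D, fun a =>
    ENNReal.ofReal (P.κ * ((1 + P.ε) ^ (t - 1) * (1 + P.ε / 4))) *
      sensitivity P.p (rescaledMatrix P.p R) a⟩ : Plan Key d)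
  convert h4 using 2 with h
  rw [Plan.merge, ht h, hD h]

end Plan

end PersonalizedCongest

end

noncomputable section

namespace PersonalizedCongest

/-! ### Analysis of neighborhood propagation -/

section Propagation

universe u

variable {Key : Type u} {V : Type*} [Fintype V] {d : ℕ}

open Classical in
/-- The neighbors of a vertex. -/
def nbrs (G : SimpleGraph V) (u : V) : Finset V :=
  Finset.univ.filter fun v => G.Adj u v

lemma mem_nbrs {G : SimpleGraph V} {u v : V} : v ∈ nbrs G u ↔ G.Adj u v := by
  simp [nbrs]

/-- The plan of the sketch of a vertex after `i` rounds. -/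
def planAt (P : SketchParams) (G : SimpleGraph V) (S : V → Dataset Key d) (h : Hashes Key) :
    ℕ → V → Plan Key d
  | 0, u => Plan.create P (S u)
  | i + 1, u => Plan.merge P h (nbrs G u) (planAt P G S h i)

/-- The number of copies in the sketch of a vertex after `i` rounds, if a new sketch has `T`
copies. -/
def copiesAt (T : ℕ) (G : SimpleGraph V) : ℕ → V → ℕ
  | 0, _ => T
  | i + 1, u => (nbrs G u).fold min T (copiesAt T G i) - 1

open Classical in
/-- The data that are represented by the sketch of a vertex after `i` rounds. -/
def dataAt (G : SimpleGraph V) (S : V → Dataset Key d) : ℕ → V → Dataset Key d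
  | 0, u => S u
  | i + 1, u => (nbrs G u).biUnion (dataAt G S i)

variable (P : SketchParams) (G : SimpleGraph V) (S : V → Dataset Key d)

lemma copies_planAt (h : Hashes Key) (i : ℕ) (u : V) :
    (planAt P G S h i u).copies = copiesAt P.copies G i u := by
  induction i generalizing u with
  | zero => rfl
  | succ i ih =>
    rw [planAt, Plan.merge, minCopies, copiesAt]
    simp only [ih]

lemma data_planAt (h : Hashes Key) (i : ℕ) (u : V) :
    (planAt P G S h i u).data = dataAt G S i u := by
  induction i generalizing u with
  | zero => rfl
  | succ i ih =>
    rw [planAt, Plan.merge, pooledData, dataAt]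
    simp only [ih]

lemma copiesAt_le (T i : ℕ) (u : V) : copiesAt T G i u ≤ T := by
  cases i with
  | zero => exact le_rfl
  | succ i =>
    exact (Nat.sub_le _ _).trans ((Finset.le_fold_min _).mp le_rfl).1

/-- Only an inequality holds: an isolated vertex merges nothing and starts again from T, so the
number of copies depends on the vertex. -/
lemma le_copiesAt (T i : ℕ) (u : V) : T - i ≤ copiesAt T G i u := by
  induction i generalizing u with
  | zero => exact le_rfl
  | succ i ih =>
    rw [copiesAt, ← Nat.sub_sub]
    exact Nat.sub_le_sub_right ((Finset.le_fold_min _).mpr ⟨Nat.sub_le _ _, fun v _ => ih v⟩) 1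

/-- Walks have length exactly i, because a node does not merge its own sketch in a round. The data
of successive rounds need not be nested, which is why the last merge runs over all rounds. -/
lemma mem_dataAt {i : ℕ} {u : V} {item : Key × (Fin d → ℝ)} :
    item ∈ dataAt G S i u ↔ ∃ (v : V) (w : G.Walk u v), w.length = i ∧ item ∈ S v := by
  classical
  induction i generalizing u with
  | zero =>
    constructor
    · exact fun hi => ⟨u, .nil, rfl, hi⟩
    · rintro ⟨v, w, hw, hi⟩
      obtain rfl := SimpleGraph.Walk.eq_of_length_eq_zero hw
      exact hi
  | succ i ih =>
    rw [dataAt, Finset.mem_biUnion]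
    constructor
    · rintro ⟨v, hv, hi⟩
      obtain ⟨v', w, hw, hi⟩ := ih.mp hi
      exact ⟨v', .cons (mem_nbrs.mp hv) w, by simp [hw], hi⟩
    · rintro ⟨v, w, hw, hi⟩
      cases w with
      | nil => simp at hw
      | cons hadj w =>
        exact ⟨_, mem_nbrs.mpr hadj, ih.mpr ⟨v, w, by simpa using hw, hi⟩⟩

lemma mem_neighborhoodData {Δ : ℕ} {u : V} {item : Key × (Fin d → ℝ)} :
    item ∈ neighborhoodData G S Δ u ↔ ∃ i ∈ Finset.range (Δ + 1), item ∈ dataAt G S i u := by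
  simp only [neighborhoodData, Finset.mem_biUnion, Finset.mem_filter, Finset.mem_univ, true_and,
    Finset.mem_range, mem_dataAt]
  constructor
  · rintro ⟨v, hv, hi⟩
    obtain ⟨w, hw⟩ := SimpleGraph.exists_walk_of_edist_ne_top
      (ne_top_of_le_ne_top (ENat.natCast_ne_top Δ) hv)
    refine ⟨w.length, ?_, v, w, rfl, hi⟩
    rw [← hw] at hv
    have := ENat.natCast_le_natCast.mp hv
    omega
  · rintro ⟨i, hi, v, w, rfl, hiv⟩
    refine ⟨v, (SimpleGraph.edist_le w).trans (ENat.natCast_le_natCast.mpr (by omega)), hiv⟩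

variable {S}

omit [Fintype V] in
lemma keys_injective (hS : Conforming S) {D : Dataset Key d}
    (hD : ∀ item ∈ D, ∃ v, item ∈ S v) : Function.Injective D.keys := by
  rintro ⟨⟨k, a⟩, h1⟩ ⟨⟨k', b⟩, h2⟩ (hk : k = k')
  subst hk
  obtain ⟨v, hv⟩ := hD _ h1
  obtain ⟨v', hv'⟩ := hD _ h2
  obtain rfl := hS v v' k a b hv hv'
  rfl

lemma keys_dataAt_injective (hS : Conforming S) (i : ℕ) (u : V) :
    Function.Injective (dataAt G S i u).keys :=
  keys_injective hS fun _ hi => let ⟨v, _, _, hv⟩ := (mem_dataAt G S).mp hi; ⟨v, hv⟩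

lemma keys_neighborhoodData_injective (hS : Conforming S) (Δ : ℕ) (u : V) :
    Function.Injective (neighborhoodData G S Δ u).keys :=
  keys_injective hS fun _ hi =>
    let ⟨_, _, hi⟩ := (mem_neighborhoodData G S).mp hi
    let ⟨v, _, _, hv⟩ := (mem_dataAt G S).mp hi
    ⟨v, hv⟩

variable (S)

lemma minCopies_planAt (h : Hashes Key) (i : ℕ) (u : V) :
    minCopies P.copies (nbrs G u) (planAt P G S h i) =
      (nbrs G u).fold min P.copies (copiesAt P.copies G i) := by
  simp only [minCopies, copies_planAt]

lemma pooledData_planAt (h : Hashes Key) (i : ℕ) (u : V) :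
    pooledData (nbrs G u) (planAt P G S h i) = dataAt G S (i + 1) u := by
  rw [← data_planAt P G S h (i + 1)]
  rfl

lemma le_fold_copiesAt (T i : ℕ) (u : V) :
    T - i ≤ (nbrs G u).fold min T (copiesAt T G i) :=
  (Finset.le_fold_min _).mpr ⟨Nat.sub_le _ _, fun v _ => le_copiesAt G T i v⟩

/-- The independence invariant: a plan with t copies has used only the hash functions above t, hence
its remaining copies are fresh. -/
lemma revealed_planAt {i : ℕ} (hi : i ≤ P.copies) (u : V) :
    Revealed (copiesAt P.copies G i u) fun h => planAt P G S h i u := by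
  induction i generalizing u with
  | zero => exact Revealed.const _ _
  | succ i ih =>
    have ht := fun h => minCopies_planAt P G S h i u
    refine (revealed_merge P ht ?_ (fun h => pooledData_planAt P G S h i u) fun v hv =>
      (ih (by omega) v).anti ?_).2
    · have := le_fold_copiesAt G P.copies i u
      omega
    · exact ((Finset.le_fold_min _).mp le_rfl).2 v hv

lemma revealed_pooledValue_planAt {i : ℕ} (hi : i < P.copies) (u : V) :
    Revealed ((nbrs G u).fold min P.copies (copiesAt P.copies G i)) fun h =>
      pooledValue (nbrs G u) (planAt P G S h i) := by
  have ht := fun h => minCopies_planAt P G S h i u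
  refine (revealed_merge P ht ?_ (fun h => pooledData_planAt P G S h i u) fun v hv =>
    (revealed_planAt P G S hi.le v).anti ?_).1
  · have := le_fold_copiesAt G P.copies i u
    omega
  · exact ((Finset.le_fold_min _).mp le_rfl).2 v hv

/-- The plan of the final sketch of a vertex after `Δ` rounds. -/
def finalPlan (h : Hashes Key) (Δ : ℕ) (u : V) : Plan Key d :=
  Plan.merge P h (Finset.range (Δ + 1)) fun i => planAt P G S h i u

/-- The least number of copies in the sketches of a vertex in the rounds `0, …, Δ`. -/
def finalCopies (T : ℕ) (Δ : ℕ) (u : V) : ℕ :=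
  (Finset.range (Δ + 1)).fold min T fun i => copiesAt T G i u

lemma le_finalCopies (T Δ : ℕ) (u : V) : T - Δ ≤ finalCopies G T Δ u :=
  (Finset.le_fold_min _).mpr ⟨Nat.sub_le _ _, fun i hi =>
    le_trans (by rw [Finset.mem_range] at hi; omega) (le_copiesAt G T i u)⟩

lemma minCopies_final (h : Hashes Key) (Δ : ℕ) (u : V) :
    minCopies P.copies (Finset.range (Δ + 1)) (fun i => planAt P G S h i u) =
      finalCopies G P.copies Δ u := by
  simp only [minCopies, copies_planAt, finalCopies]

lemma pooledData_final (h : Hashes Key) (Δ : ℕ) (u : V) :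
    pooledData (Finset.range (Δ + 1)) (fun i => planAt P G S h i u) =
      neighborhoodData G S Δ u := by
  ext item
  simp only [mem_pooledData, mem_neighborhoodData, data_planAt]

lemma revealed_final {Δ : ℕ} (hΔ : Δ < P.copies) (u : V) :
    (Revealed (finalCopies G P.copies Δ u) fun h =>
      pooledValue (Finset.range (Δ + 1)) fun i => planAt P G S h i u) ∧
      Revealed (finalCopies G P.copies Δ u - 1) fun h => finalPlan P G S h Δ u := by
  refine revealed_merge P (fun h => minCopies_final P G S h Δ u) ?_
    (fun h => pooledData_final P G S h Δ u) fun i hi => ?_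
  · have := le_finalCopies G P.copies Δ u
    omega
  · refine (revealed_planAt P G S (by rw [Finset.mem_range] at hi; omega) u).anti ?_
    exact ((Finset.le_fold_min _).mp le_rfl).2 i hi

end Propagation

end PersonalizedCongest

end

noncomputable section

namespace PersonalizedCongest

/-! ### The sketches on a good event -/

section Success

universe u

variable {Key : Type u} {V : Type*} [Fintype V] {d : ℕ}

lemma IsSubspaceEmbedding.mono {p ε ε' : ℝ} {m n : Type*} [Fintype m] [Fintype n]
    {M : Matrix m (Fin d) ℝ} {A : Matrix n (Fin d) ℝ} (h : IsSubspaceEmbedding p ε M A)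
    (hε : ε ≤ ε') : IsSubspaceEmbedding p ε' M A := fun x => by
  have h0 := lpPow_nonneg p (A *ᵥ x)
  constructor
  · exact le_trans (mul_le_mul_of_nonneg_right (by linarith) h0) (h x).1
  · exact (h x).2.trans (mul_le_mul_of_nonneg_right (by linarith) h0)

/-- Outside of finitely many events of small probability. -/
lemma exists_measurableSet_of_events {ι : Type*} [Fintype ι] (bad : ι → Set (Hashes Key)) {η : ℝ}
    (hbad : ∀ i, hashLaw Key (bad i) ≤ ENNReal.ofReal η) (hη : Fintype.card ι * η ≤ 1 / 10) :
    ∃ E : Set (Hashes Key), MeasurableSet E ∧ 9 / 10 ≤ hashLaw Key E ∧ ∀ h ∈ E, ∀ i, h ∉ bad i := by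
  have hle : hashLaw Key (toMeasurable (hashLaw Key) (⋃ i, bad i)) ≤ 1 / 10 := by
    rw [measure_toMeasurable]
    refine (measure_iUnion_fintype_le _ _).trans ((Finset.sum_le_sum fun i _ => hbad i).trans ?_)
    rw [Finset.sum_const, Finset.card_univ, nsmul_eq_mul, ← ENNReal.ofReal_natCast,
      ← ENNReal.ofReal_mul (Nat.cast_nonneg _)]
    refine (ENNReal.ofReal_le_ofReal hη).trans (le_of_eq ?_)
    rw [ENNReal.ofReal_div_of_pos (by norm_num)]
    norm_num
  refine ⟨(toMeasurable (hashLaw Key) (⋃ i, bad i))ᶜ, (measurableSet_toMeasurable _ _).compl, ?_,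
    fun h hh i hi => hh (subset_toMeasurable _ _ (Set.mem_iUnion_of_mem i hi))⟩
  rw [prob_compl_eq_one_sub (measurableSet_toMeasurable _ _)]
  refine ENNReal.le_sub_of_add_le_right (ne_top_of_le_ne_top (by simp) hle) ?_
  calc (9 / 10 : ℝ≥0∞) + hashLaw Key (toMeasurable (hashLaw Key) (⋃ i, bad i))
      ≤ 9 / 10 + 1 / 10 := by gcongr
    _ = 1 := by
      rw [ENNReal.div_add_div_same]
      norm_num
      exact ENNReal.div_self (by norm_num) (by norm_num)

variable {P : SketchParams} {G : SimpleGraph V} {S : V → Dataset Key d} {Δ : ℕ} {h : Hashes Key}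

/-- If all merges use good samples, then they succeed, and the sampling values are accurate. -/
lemma roundSketch_of_good (hp : 1 ≤ P.p) (hε : 0 ≤ P.ε) (hε1 : P.ε ≤ 1) (hκ : 0 ≤ P.κ)
    (hΔ : Δ ≤ P.copies)
    (hgood : ∀ i < Δ, ∀ u,
      (∀ item ∈ dataAt G S (i + 1) u, ENNReal.ofReal P.κ *
        sensitivity P.p (dataAt G S (i + 1) u).vals item.2 ≤
          pooledValue (nbrs G u) (planAt P G S h i) item) →
      GoodDraw P.p (P.ε / 4) h ((nbrs G u).fold min P.copies (copiesAt P.copies G i))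
        (dataAt G S (i + 1) u) (pooledValue (nbrs G u) (planAt P G S h i)))
    {i : ℕ} (hi : i ≤ Δ) (u : V) :
    (planAt P G S h i u).Accurate P ∧
      roundSketch P G S h i u = some ((planAt P G S h i u).sketch h) := by
  induction i generalizing u with
  | zero => exact ⟨Plan.accurate_create P hε hκ (S u), rfl⟩
  | succ i ih =>
    have hacc : ∀ v ∈ nbrs G u, (planAt P G S h i v).Accurate P := fun v _ => (ih (by omega) v).1
    have ht : 1 ≤ minCopies P.copies (nbrs G u) (planAt P G S h i) := by
      rw [minCopies_planAt]
      have := le_fold_copiesAt G P.copies i u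
      omega
    have hg := hgood i (by omega) u fun item hit => by
      rw [← pooledData_planAt P G S h] at hit ⊢
      exact le_pooledValue_of_accurate hp hε hκ hacc hit
    rw [← minCopies_planAt P G S h, ← pooledData_planAt P G S h] at hg
    refine ⟨Plan.accurate_merge hp hε hε1 hκ ht hg, ?_⟩
    have e : roundSketch P G S h i = fun v => some ((planAt P G S h i v).sketch h) :=
      funext fun v => (ih (by omega) v).2
    rw [roundSketch, e]
    exact mergeAll_sketch_of_good hp hε hε1 hκ hacc ht hg

lemma finalSketch_of_good (hp : 1 ≤ P.p) (hε : 0 ≤ P.ε) (hε1 : P.ε ≤ 1) (hκ : 0 ≤ P.κ)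
    (hΔ : Δ < P.copies) {u : V}
    (hround : ∀ i ≤ Δ, (planAt P G S h i u).Accurate P ∧
      roundSketch P G S h i u = some ((planAt P G S h i u).sketch h))
    (hgood : (∀ item ∈ neighborhoodData G S Δ u, ENNReal.ofReal P.κ *
        sensitivity P.p (neighborhoodData G S Δ u).vals item.2 ≤
          pooledValue (Finset.range (Δ + 1)) (fun i => planAt P G S h i u) item) →
      GoodDraw P.p (P.ε / 4) h (finalCopies G P.copies Δ u) (neighborhoodData G S Δ u)
        (pooledValue (Finset.range (Δ + 1)) fun i => planAt P G S h i u)) :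
    (finalPlan P G S h Δ u).Accurate P ∧
      finalSketch P G S h Δ u = some ((finalPlan P G S h Δ u).sketch h) := by
  have hacc : ∀ i ∈ Finset.range (Δ + 1), (planAt P G S h i u).Accurate P := fun i hi =>
    (hround i (Nat.lt_succ_iff.mp (Finset.mem_range.mp hi))).1
  have ht : 1 ≤ minCopies P.copies (Finset.range (Δ + 1)) fun i => planAt P G S h i u := by
    rw [minCopies_final]
    have := le_finalCopies G P.copies Δ u
    omega
  have hg := hgood fun item hit => by
    rw [← pooledData_final P G S h] at hit ⊢
    exact le_pooledValue_of_accurate hp hε hκ hacc hit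
  rw [← minCopies_final P G S h, ← pooledData_final P G S h] at hg
  refine ⟨Plan.accurate_merge hp hε hε1 hκ ht hg, ?_⟩
  have e : (Multiset.range (Δ + 1)).map (fun i => roundSketch P G S h i u) =
      (Finset.range (Δ + 1)).val.map fun i => some ((planAt P G S h i u).sketch h) :=
    Multiset.map_congr rfl fun i hi =>
      (hround i (Nat.lt_succ_iff.mp (Multiset.mem_range.mp hi))).2
  rw [finalSketch, e]
  exact mergeAll_sketch_of_good hp hε hε1 hκ hacc ht hg

lemma messageRows_le {s : Plan Key d} {c : ℕ} {B : ℝ} (hB : 0 ≤ B) (hc : s.copies ≤ c)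
    (hrows : ∀ j ∈ Finset.Icc 1 s.copies,
      ((drawRows h j s.data fun item => s.value item.2).card : ℝ) ≤ B) :
    (messageRows (some (s.sketch h)) : ℝ) ≤ c * B := by
  have e : messageRows (some (s.sketch h)) = ∑ j ∈ Finset.Icc 1 s.copies,
      (drawRows h j s.data fun item => s.value item.2).card :=
    Finset.sum_congr (s₁ := Finset.Icc 1 s.copies) rfl fun j hj =>
      congrArg Finset.card (if_pos hj)
  rw [e, Nat.cast_sum]
  refine (Finset.sum_le_sum hrows).trans ?_
  rw [Finset.sum_const, Nat.card_Icc, nsmul_eq_mul, Nat.add_sub_cancel]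
  exact mul_le_mul_of_nonneg_right (Nat.cast_le.mpr hc) hB

/-- The sampling values in a merge are large enough, but the sample is not good. -/
def MergeFailure (P : SketchParams) (G : SimpleGraph V) (S : V → Dataset Key d) (i : ℕ) (u : V)
    (h : Hashes Key) : Prop :=
  (∀ item ∈ dataAt G S (i + 1) u, ENNReal.ofReal P.κ *
    sensitivity P.p (dataAt G S (i + 1) u).vals item.2 ≤
      pooledValue (nbrs G u) (planAt P G S h i) item) ∧
  ¬ GoodDraw P.p (P.ε / 4) h ((nbrs G u).fold min P.copies (copiesAt P.copies G i))
    (dataAt G S (i + 1) u) (pooledValue (nbrs G u) (planAt P G S h i))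

/-- The sampling values in the final merge are large enough, but the sample is not good. -/
def FinalMergeFailure (P : SketchParams) (G : SimpleGraph V) (S : V → Dataset Key d) (Δ : ℕ)
    (u : V) (h : Hashes Key) : Prop :=
  (∀ item ∈ neighborhoodData G S Δ u, ENNReal.ofReal P.κ *
    sensitivity P.p (neighborhoodData G S Δ u).vals item.2 ≤
      pooledValue (Finset.range (Δ + 1)) (fun i => planAt P G S h i u) item) ∧
  ¬ GoodDraw P.p (P.ε / 4) h (finalCopies G P.copies Δ u) (neighborhoodData G S Δ u)
    (pooledValue (Finset.range (Δ + 1)) fun i => planAt P G S h i u)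

/-- The sampling values of the final sketch are large enough, but its first sample is not good. -/
def SolveFailure (P : SketchParams) (G : SimpleGraph V) (S : V → Dataset Key d) (Δ : ℕ)
    (u : V) (h : Hashes Key) : Prop :=
  (∀ item ∈ neighborhoodData G S Δ u, ENNReal.ofReal P.κ *
    sensitivity P.p (neighborhoodData G S Δ u).vals item.2 ≤
      (finalPlan P G S h Δ u).value item.2) ∧
  ¬ GoodDraw P.p (P.ε / 4) h 1 (neighborhoodData G S Δ u)
    fun item => (finalPlan P G S h Δ u).value item.2

/-- The sampling values of a sketch are small enough, but its `j`-th sample is too large. -/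
def RowsFailure (P : SketchParams) (G : SimpleGraph V) (S : V → Dataset Key d) (K B : ℝ)
    (i : ℕ) (u : V) (j : ℕ) (h : Hashes Key) : Prop :=
  j ≤ copiesAt P.copies G i u ∧
  (∀ item ∈ dataAt G S i u, (planAt P G S h i u).value item.2 ≤
    ENNReal.ofReal K * sensitivity P.p (dataAt G S i u).vals item.2) ∧
  3 * B < ((drawRows h j (dataAt G S i u)
    fun item => (planAt P G S h i u).value item.2).card : ℝ)

/-! ### Probabilities of the four kinds of failure. -/

section

variable {η : ℝ} (hp : 1 ≤ P.p) (hS : Conforming S) (hη : 0 ≤ η)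
include hp hS hη

lemma hashLaw_mergeFailure_le (hW : SamplesWell.{u} P.p (P.ε / 4) P.κ η d) {i : ℕ}
    (hi : i < P.copies) (u : V) :
    hashLaw Key {h | MergeFailure P G S i u h} ≤ ENNReal.ofReal η :=
  hashLaw_not_goodDraw_le hp hη hW (keys_dataAt_injective G hS (i + 1) u)
    (revealed_pooledValue_planAt P G S hi u)

lemma hashLaw_finalMergeFailure_le (hW : SamplesWell.{u} P.p (P.ε / 4) P.κ η d)
    (hΔ : Δ < P.copies) (u : V) :
    hashLaw Key {h | FinalMergeFailure P G S Δ u h} ≤ ENNReal.ofReal η :=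
  hashLaw_not_goodDraw_le hp hη hW (keys_neighborhoodData_injective G hS Δ u)
    (revealed_final P G S hΔ u).1

/-- This is where T = Δ + 2 is needed: at least two copies enter the final merge, so the final
values are revealed without h_1, which then draws the output. -/
lemma hashLaw_solveFailure_le (hW : SamplesWell.{u} P.p (P.ε / 4) P.κ η d)
    (hΔ : Δ + 1 < P.copies) (u : V) :
    hashLaw Key {h | SolveFailure P G S Δ u h} ≤ ENNReal.ofReal η := by
  have h1 := (revealed_final P G S (by omega : Δ < P.copies) u).2.anti (t := 1) (by
    have := le_finalCopies G P.copies Δ u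
    omega)
  exact hashLaw_not_goodDraw_le hp hη hW (keys_neighborhoodData_injective G hS Δ u)
    (c := fun h item => (finalPlan P G S h Δ u).value item.2)
    (h1.comp fun (s : Plan Key d) (item : Key × (Fin d → ℝ)) => s.value item.2)

lemma hashLaw_rowsFailure_le {K B : ℝ} (hK : 0 ≤ K) (hB : K * (d : ℝ) ^ max (P.p / 2) 1 ≤ B)
    (hBη : B = 0 ∨ Real.exp (-B) ≤ η) {i : ℕ} (hi : i ≤ P.copies) (u : V) (j : ℕ) :
    hashLaw Key {h | RowsFailure P G S K B i u j h} ≤ ENNReal.ofReal η := by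
  by_cases hj : j ≤ copiesAt P.copies G i u
  · have h1 := (revealed_planAt P G S hi u).anti hj
    refine (measure_mono fun h hh => ?_).trans (hashLaw_card_drawRows_le hp hK hη hB hBη
      (keys_dataAt_injective G hS i u)
      (c := fun h item => (planAt P G S h i u).value item.2)
      (h1.comp fun (s : Plan Key d) (item : Key × (Fin d → ℝ)) => s.value item.2))
    exact hh.2
  · exact (measure_mono (t := ∅) fun h hh => (hj hh.1).elim).trans (by simp)

end

/-- The analysis of neighborhood propagation, in terms of the failure probability `η` of one
sample. -/
theorem propagationSucceeds_of {η B bound : ℝ} (hp : 1 ≤ P.p) (hε : 0 ≤ P.ε) (hε1 : P.ε ≤ 1)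
    (hκ : 0 ≤ P.κ) (hcopies : P.copies = Δ + 2) (hS : Conforming S) (hη : 0 ≤ η)
    (hW : SamplesWell.{u} P.p (P.ε / 4) P.κ η d)
    (hB : P.κ * (1 + P.ε) ^ (Δ + 3) * (d : ℝ) ^ max (P.p / 2) 1 ≤ B)
    (hBη : B = 0 ∨ Real.exp (-B) ≤ η)
    (hcount : (Fintype.card V * ((Δ + 1) * (Δ + 2)) : ℝ) * η ≤ 1 / 10)
    (hbound : ∀ u v, G.Adj u v → (Δ + 2) * (3 * B) ≤ bound) :
    PropagationSucceeds P G S Δ bound := by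
  have hK : 0 ≤ P.κ * (1 + P.ε) ^ (Δ + 3) := by positivity
  have hB0 : 0 ≤ B := le_trans (by positivity) hB
  -- There are sΔ merges, s final merges, s outputs and sΔ(Δ+2) samples in messages, in total
  -- s(Δ+1)(Δ+2) events. Sample j has the index j - 1 in `Fin (Δ + 2)`.
  obtain ⟨E, hE, hE9, hEgood⟩ := exists_measurableSet_of_events (ι := ((V × Fin Δ) ⊕ V) ⊕
      (V ⊕ (V × Fin Δ × Fin (Δ + 2))))
    (Sum.elim (Sum.elim (fun x => {h | MergeFailure P G S x.2 x.1 h})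
      fun u => {h | FinalMergeFailure P G S Δ u h}) (Sum.elim
        (fun u => {h | SolveFailure P G S Δ u h}) fun x =>
          {h | RowsFailure P G S (P.κ * (1 + P.ε) ^ (Δ + 3)) B x.2.1 x.1 (x.2.2 + 1) h}))
    (η := η) (by
      rintro ((⟨u, i⟩ | u) | (u | ⟨u, i, j⟩))
      · exact hashLaw_mergeFailure_le hp hS hη hW (by omega) u
      · exact hashLaw_finalMergeFailure_le hp hS hη hW (by omega) u
      · exact hashLaw_solveFailure_le hp hS hη hW (by omega) u
      · exact hashLaw_rowsFailure_le hp hS hη hK hB hBη (by omega) u _)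
    (le_trans (le_of_eq (by
      simp only [Fintype.card_prod, Fintype.card_sum, Fintype.card_fin]
      push_cast
      ring)) hcount)
  refine ⟨E, hE, hE9, fun h hh => ?_⟩
  have hmerge := fun x => hEgood h hh (.inl (.inl x))
  have hfin := fun u => hEgood h hh (.inl (.inr u))
  have hsolve := fun u => hEgood h hh (.inr (.inl u))
  have hrows := fun x => hEgood h hh (.inr (.inr x))
  have hround : ∀ i ≤ Δ, ∀ u, (planAt P G S h i u).Accurate P ∧
      roundSketch P G S h i u = some ((planAt P G S h i u).sketch h) :=
    fun i hi u => roundSketch_of_good hp hε hε1 hκ (by omega) (fun i hi u hi' => by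
      by_contra hcon
      exact hmerge (u, ⟨i, hi⟩) ⟨hi', hcon⟩) hi u
  have hfinal := fun u => finalSketch_of_good hp hε hε1 hκ (by omega : Δ < P.copies)
    (fun i hi => hround i hi u) fun hi' => by
      by_contra hcon
      exact hfin u ⟨hi', hcon⟩
  refine ⟨fun u => ⟨_, (hfinal u).2, ?_⟩, fun i hi u v huv => ?_⟩
  · have hdata : (finalPlan P G S h Δ u).data = neighborhoodData G S Δ u :=
      pooledData_final P G S h Δ u
    have hc : 1 ≤ (finalPlan P G S h Δ u).copies := by
      change 1 ≤ minCopies _ _ _ - 1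
      rw [minCopies_final]
      have := le_finalCopies G P.copies Δ u
      omega
    have hsample : ((finalPlan P G S h Δ u).sketch h).sample 1 =
        drawRows h 1 (neighborhoodData G S Δ u)
          fun item => (finalPlan P G S h Δ u).value item.2 := by
      rw [← hdata]
      exact if_pos (Finset.mem_Icc.mpr ⟨le_rfl, hc⟩)
    have hdraw : GoodDraw P.p (P.ε / 4) h 1 (neighborhoodData G S Δ u)
        fun item => (finalPlan P G S h Δ u).value item.2 := by
      by_contra hcon
      refine hsolve u ⟨fun item hit => ?_, hcon⟩
      have := ((hfinal u).1 item (hdata ▸ hit)).1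
      rw [hdata] at this
      refine le_trans (mul_le_mul_left (ENNReal.ofReal_le_ofReal ?_) _) this
      exact le_mul_of_one_le_right hκ (one_le_pow₀ (by linarith))
    rw [Sketch.solve, hsample]
    exact IsSubspaceEmbedding.mono hdraw (by linarith)
  · refine le_trans ?_ (hbound u v huv)
    rw [(hround i hi.le u).2]
    have hc : (planAt P G S h i u).copies ≤ Δ + 2 := by
      rw [copies_planAt, ← hcopies]
      exact copiesAt_le G _ _ _
    refine (messageRows_le (B := 3 * B) (by positivity) hc fun j hj => ?_).trans_eq (by simp)
    obtain ⟨hj1, hjc⟩ := Finset.mem_Icc.mp hj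
    by_contra! hcon
    have hjj : j - 1 + 1 = j := by omega
    refine hrows (u, ⟨i, hi⟩, ⟨j - 1, by omega⟩) ⟨?_, fun item hit => ?_, ?_⟩
    · rw [copies_planAt] at hjc
      exact hjj.trans_le hjc
    · rw [← data_planAt P G S h] at hit ⊢
      refine ((hround i hi.le u).1 item hit).2.trans
        (mul_le_mul_left (ENNReal.ofReal_le_ofReal ?_) _)
      exact mul_le_mul_of_nonneg_left (pow_le_pow_right₀ (by linarith) (by omega)) hκ
    · simp only [hjj]
      rw [data_planAt] at hcon
      exact hcon

end Success

end PersonalizedCongest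

end

noncomputable section

namespace PersonalizedCongest

/-! ### Parameters -/

section Parameters

universe u

lemma one_le_log_failureParam {s Δ : ℕ} (hs : 1 ≤ s) : 1 ≤ Real.log (1 / failureParam s Δ) := by
  have h1 : (1 : ℝ) ≤ s := Nat.one_le_cast.mpr hs
  have h2 : (1 : ℝ) ≤ (2 * (s : ℝ)) ^ Δ := one_le_pow₀ (by linarith)
  rw [failureParam, div_div, one_div_one_div, Real.le_log_iff_exp_le (by positivity)]
  have := Real.exp_one_lt_d9
  nlinarith

/-- The constant 7 is 4 + 1 + 2, from log 10 ≤ 4 log 2, from log s, and from log(2s) ≤ 2 log s; the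
last needs s ≥ 2. -/
lemma log_failureParam_le {s Δ : ℕ} (hs : 2 ≤ s) (hΔ : 1 ≤ Δ) :
    Real.log (1 / failureParam s Δ) ≤ 7 * (Δ * Real.log s) := by
  have h1 : (2 : ℝ) ≤ s := by exact_mod_cast hs
  have hΔ1 : (1 : ℝ) ≤ Δ := Nat.one_le_cast.mpr hΔ
  have hl2 : Real.log 2 ≤ Real.log s := Real.log_le_log (by norm_num) h1
  have hl0 : 0 < Real.log 2 := Real.log_pos (by norm_num)
  have hl10 : Real.log 10 ≤ 4 * Real.log 2 := by
    rw [← Real.log_rpow (by norm_num)]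
    exact Real.log_le_log (by norm_num) (by norm_num)
  rw [failureParam, div_div, one_div_one_div, Real.log_mul (by positivity) (by positivity),
    Real.log_pow, Real.log_mul (by norm_num) (by positivity),
    Real.log_mul (by norm_num) (by positivity)]
  nlinarith

lemma exp_neg_log_failureParam {s Δ : ℕ} (hs : 1 ≤ s) :
    Real.exp (-(2 * Real.log (1 / failureParam s Δ))) = failureParam s Δ ^ 2 := by
  have h1 : (1 : ℝ) ≤ s := Nat.one_le_cast.mpr hs
  have h0 : 0 < failureParam s Δ := by unfold failureParam; positivity
  rw [one_div, Real.log_inv, mul_neg, neg_neg, ← Nat.cast_two, ← Real.log_pow,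
    Real.exp_log (by positivity)]

/-- With w = (2s)^Δ ≥ Δ + 1, the number of events is at most 2sw², whereas δ² = 1/(100s²w²). -/
lemma count_mul_failureParam_sq_le {s Δ : ℕ} (hs : 1 ≤ s) :
    ((s * ((Δ + 1) * (Δ + 2)) : ℝ)) * failureParam s Δ ^ 2 ≤ 1 / 10 := by
  have h1 : (1 : ℝ) ≤ s := Nat.one_le_cast.mpr hs
  have hpow : ((Δ : ℝ) + 1) ≤ (2 * (s : ℝ)) ^ Δ := by
    have h2 : ((Δ : ℝ) + 1) ≤ 2 ^ Δ := by exact_mod_cast Nat.lt_two_pow_self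
    exact h2.trans (pow_le_pow_left₀ (by norm_num) (by linarith) _)
  set w := (2 * (s : ℝ)) ^ Δ with hw
  have hΔ0 : (0 : ℝ) ≤ Δ := Nat.cast_nonneg Δ
  have hw1 : 1 ≤ w := by linarith
  have e : failureParam s Δ ^ 2 = 1 / (100 * s ^ 2 * w ^ 2) := by
    rw [failureParam, ← hw]
    field_simp
    norm_num
  rw [e, mul_one_div, div_le_div_iff₀ (by positivity) (by norm_num)]
  have h3 : ((Δ : ℝ) + 1) * (Δ + 2) ≤ w * (2 * w) :=
    mul_le_mul hpow (by linarith) (by linarith) (by linarith)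
  have h4 : (s : ℝ) * ((Δ + 1) * (Δ + 2)) ≤ s * (w * (2 * w)) :=
    mul_le_mul_of_nonneg_left h3 (by linarith)
  have h5 : (s : ℝ) * w ^ 2 ≤ s ^ 2 * w ^ 2 :=
    mul_le_mul_of_nonneg_right (by nlinarith) (by positivity)
  nlinarith

variable {Key : Type u} {V : Type*} [Fintype V] {d : ℕ}

/-- Neighborhood propagation for an oversampling factor `C (N + log (1 / δ)) / ε ^ 2`. -/
theorem propagationSucceeds_of_samplesWell {p C N ε : ℝ} {Δ : ℕ} (G : SimpleGraph V)
    {S : V → Dataset Key d} (hp : 1 ≤ p) (hC : 2 ≤ C) (hN : 0 ≤ N) (hΔ : 1 ≤ Δ) (hε : 0 < ε)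
    (hεΔ : ε < 1 / (Δ : ℝ)) (hS : Conforming S)
    (hW : 1 ≤ Real.log (1 / failureParam (Fintype.card V) Δ) → SamplesWell.{u} p (ε / 4)
      (C * (N + Real.log (1 / failureParam (Fintype.card V) Δ)) / ε ^ 2)
      (Real.exp (-(2 * Real.log (1 / failureParam (Fintype.card V) Δ)))) d) :
    PropagationSucceeds
      { p := p
        ε := ε
        κ := C * (N + Real.log (1 / failureParam (Fintype.card V) Δ)) / ε ^ 2
        copies := Δ + 2 } G S Δ
      (63 * Real.exp 4 * C *
        (Δ * (d : ℝ) ^ max (p / 2) 1 * (N + Δ * Real.log (Fintype.card V)) / ε ^ 2)) := by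
  -- For s = 0 the bound on log(1/δ) is not available, but there is nothing to prove.
  rcases isEmpty_or_nonempty V with hV | hV
  · exact ⟨Set.univ, MeasurableSet.univ, by
      rw [measure_univ]
      exact ENNReal.div_le_of_le_mul (by norm_num), fun h _ =>
        ⟨fun u => isEmptyElim u, fun _ _ u => isEmptyElim u⟩⟩
  have hs : 1 ≤ Fintype.card V := Fintype.card_pos
  have hΔ1 : (1 : ℝ) ≤ Δ := Nat.one_le_cast.mpr hΔ
  have hεΔ' : ε * Δ < 1 := (lt_div_iff₀ (by linarith)).mp hεΔ
  have hε1 : ε ≤ 1 := by nlinarith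
  have hL1 := one_le_log_failureParam (Δ := Δ) hs
  specialize hW hL1
  set L := Real.log (1 / failureParam (Fintype.card V) Δ) with hL
  set W := (d : ℝ) ^ max (p / 2) 1 with hWd
  have hW0 : 0 ≤ W := Real.rpow_nonneg (Nat.cast_nonneg d) _
  have hκ0 : 0 ≤ C * (N + L) / ε ^ 2 := by positivity
  have hpow1 : 1 ≤ (1 + ε) ^ (Δ + 3) := one_le_pow₀ (by linarith)
  refine propagationSucceeds_of (η := Real.exp (-(2 * L)))
    (B := C * (N + L) / ε ^ 2 * (1 + ε) ^ (Δ + 3) * W) hp hε.le hε1 hκ0 rfl hS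
    (Real.exp_pos _).le hW le_rfl ?_ ?_ fun u v huv => ?_
  · rcases Nat.eq_zero_or_pos d with rfl | hd
    · left
      rw [hWd, Nat.cast_zero, Real.zero_rpow (by positivity), mul_zero]
    · right
      have hd1 : (1 : ℝ) ≤ d := Nat.one_le_cast.mpr hd
      have hW1 : 1 ≤ W := Real.one_le_rpow hd1 (by positivity)
      refine Real.exp_le_exp.mpr (neg_le_neg ?_)
      have h1 : 2 * L ≤ C * (N + L) := by nlinarith
      have h2 : C * (N + L) ≤ C * (N + L) / ε ^ 2 :=
        le_div_self (by positivity) (by positivity) (pow_le_one₀ hε.le hε1)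
      have h3 := le_mul_of_one_le_right hκ0 hpow1
      exact ((h1.trans h2).trans h3).trans (le_mul_of_one_le_right (by positivity) hW1)
  · rw [exp_neg_log_failureParam hs]
    exact count_mul_failureParam_sq_le hs
  -- A message exists only along an edge, so s ≥ 2 and log s can absorb the constants in log(1/δ).
  · have hs2 : 2 ≤ Fintype.card V := Fintype.one_lt_card_iff.mpr ⟨u, v, huv.ne⟩
    have hLs := log_failureParam_le hs2 hΔ
    have hpow : (1 + ε) ^ (Δ + 3) ≤ Real.exp 4 := by
      calc (1 + ε) ^ (Δ + 3) ≤ Real.exp ε ^ (Δ + 3) :=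
            pow_le_pow_left₀ (by linarith) (by linarith [Real.add_one_le_exp ε]) _
        _ = Real.exp ((Δ + 3 : ℕ) * ε) := (Real.exp_nat_mul _ _).symm
        _ ≤ Real.exp 4 := Real.exp_le_exp.mpr (by push_cast; nlinarith)
    have hNL : N + L ≤ 7 * (N + Δ * Real.log (Fintype.card V)) := by linarith
    -- The constant 63 is 3 · 3 · 7: from Δ + 2 ≤ 3Δ, the Chernoff factor, and the bound on
    -- log(1/δ).
    calc ((Δ : ℝ) + 2) * (3 * (C * (N + L) / ε ^ 2 * (1 + ε) ^ (Δ + 3) * W))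
        ≤ (3 * Δ) * (3 * (C * (7 * (N + Δ * Real.log (Fintype.card V))) / ε ^ 2 *
            Real.exp 4 * W)) := by
          gcongr
          linarith
      _ = _ := by ring

/-- Chaining needs d + L, which is at most 2(d log d + L) because d log d ≥ d - 1 and L ≥ 1. Hence
147456 = 16 · 768 · 6 · 2, where 16 stems from the accuracy ε/4. -/
lemma samplesWell_chaining_of_params {p ε L : ℝ} (hp : 1 ≤ p) (hε : 0 < ε) (hε1 : ε ≤ 1)
    (hL : 1 ≤ L) (d : ℕ) :
    SamplesWell.{u} p (ε / 4) (147456 * p ^ 2 * (d * Real.log d + L) / ε ^ 2)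
      (Real.exp (-(2 * L))) d := by
  refine (samplesWell_of_chaining hp (by positivity) (by linarith) hL ?_).mono
    (Real.exp_le_exp.mpr (by linarith))
  have h1 : (d + L) / 2 ≤ d * Real.log d + L := by
    rcases Nat.eq_zero_or_pos d with rfl | hd
    · simp only [Nat.cast_zero, zero_mul, zero_add]
      linarith
    · have hd1 : (1 : ℝ) ≤ d := Nat.one_le_cast.mpr hd
      have h2 := mul_le_mul_of_nonneg_left (Real.one_sub_inv_le_log_of_pos (by linarith :
        (0 : ℝ) < d)) (by linarith : (0 : ℝ) ≤ d)
      rw [mul_sub, mul_inv_cancel₀ (by linarith)] at h2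
      linarith
  have e : (ε / 4) ^ 2 * (147456 * p ^ 2 * (d * Real.log d + L) / ε ^ 2) =
      768 * p ^ 2 * (6 * (2 * (d * Real.log d + L))) := by
    field_simp
    ring
  rw [e]
  have : 0 ≤ p ^ 2 := by positivity
  nlinarith

/-- The constant 384 = 16 · 8 · 3 makes the exponent 3(log d + L), enough to cancel the dimension
factor 2d and to leave 2L. -/
lemma samplesWell_two_of_params {ε L : ℝ} (hε : 0 < ε) (hε1 : ε ≤ 1) (hL : 1 ≤ L) (d : ℕ) :
    SamplesWell.{u} 2 (ε / 4) (384 * (Real.log d + L) / ε ^ 2) (Real.exp (-(2 * L))) d := by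
  have hlog := Real.log_natCast_nonneg d
  refine (samplesWell_two (by positivity) (by linarith) (by positivity)).mono ?_
  have e : (ε / 4) ^ 2 * (384 * (Real.log d + L) / ε ^ 2) / 8 = 3 * (Real.log d + L) := by
    field_simp
    ring
  rw [e]
  rcases Nat.eq_zero_or_pos d with rfl | hd
  · simp only [Nat.cast_zero, mul_zero, zero_mul]
    positivity
  · have hd0 : (0 : ℝ) < d := Nat.cast_pos.mpr hd
    have h2 : (2 : ℝ) ≤ Real.exp 1 := by linarith [Real.add_one_le_exp 1]
    calc 2 * d * Real.exp (-(3 * (Real.log d + L)))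
        ≤ Real.exp 1 * Real.exp (Real.log d) * Real.exp (-(3 * (Real.log d + L))) := by
          rw [Real.exp_log hd0]
          gcongr
      _ = Real.exp (1 + Real.log d + -(3 * (Real.log d + L))) := by
          rw [Real.exp_add, Real.exp_add]
      _ ≤ Real.exp (-(2 * L)) := Real.exp_le_exp.mpr (by linarith)

lemma le_one_of_lt_one_div {ε : ℝ} {Δ : ℕ} (hΔ : 1 ≤ Δ) (h : ε < 1 / (Δ : ℝ)) : ε ≤ 1 :=
  h.le.trans (div_le_one_of_le₀ (Nat.one_le_cast.mpr hΔ) (Nat.cast_nonneg Δ))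

end Parameters

end PersonalizedCongest

end

/-! ### Choice of the constants for general p and for p = 2. -/

theorem mainTheorem8 :
    (∀ p : ℝ, 1 ≤ p → ∃ C K : ℝ, 0 < C ∧ 0 < K ∧
      ∀ (V : Type*) [Fintype V] (G : SimpleGraph V) (Key : Type*) (d Δ : ℕ) (ε : ℝ)
        (S : V → PersonalizedCongest.Dataset Key d),
        1 ≤ Δ → 0 < ε → ε < 1 / (Δ : ℝ) → PersonalizedCongest.Conforming S →
        PersonalizedCongest.PropagationSucceeds
          { p := p
            ε := ε
            κ := C * ((d : ℝ) * Real.log d +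
              Real.log (1 / PersonalizedCongest.failureParam (Fintype.card V) Δ)) / ε ^ 2
            copies := Δ + 2 }
          G S Δ
          (K * (Δ * (d : ℝ) ^ max (p / 2) 1 *
            (d * Real.log d + Δ * Real.log (Fintype.card V)) / ε ^ 2))) ∧
    (∃ C K : ℝ, 0 < C ∧ 0 < K ∧
      ∀ (V : Type*) [Fintype V] (G : SimpleGraph V) (Key : Type*) (d Δ : ℕ) (ε : ℝ)
        (S : V → PersonalizedCongest.Dataset Key d),
        1 ≤ Δ → 0 < ε → ε < 1 / (Δ : ℝ) → PersonalizedCongest.Conforming S →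
        PersonalizedCongest.PropagationSucceeds
          { p := 2
            ε := ε
            κ := C * (Real.log d +
              Real.log (1 / PersonalizedCongest.failureParam (Fintype.card V) Δ)) / ε ^ 2
            copies := Δ + 2 }
          G S Δ
          (K * (Δ * (d : ℝ) *
            (Real.log d + Δ * Real.log (Fintype.card V)) / ε ^ 2))) := by

  refine ⟨fun p hp => ⟨147456 * p ^ 2, 63 * Real.exp 4 * (147456 * p ^ 2), by positivity,
    by positivity, ?_⟩, 384, 63 * Real.exp 4 * 384, by norm_num, by positivity, ?_⟩
  · intro V _ G Key d Δ ε S hΔ hε hεΔ hS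
    exact PersonalizedCongest.propagationSucceeds_of_samplesWell G hp (by nlinarith)
      (mul_nonneg (Nat.cast_nonneg d) (Real.log_natCast_nonneg d)) hΔ hε hεΔ hS fun hL =>
        PersonalizedCongest.samplesWell_chaining_of_params hp hε
          (PersonalizedCongest.le_one_of_lt_one_div hΔ hεΔ) hL d
  · intro V _ G Key d Δ ε S hΔ hε hεΔ hS
    have h := PersonalizedCongest.propagationSucceeds_of_samplesWell (C := 384) G one_le_two
      (by norm_num) (Real.log_natCast_nonneg d) hΔ hε hεΔ hS fun hL =>
        PersonalizedCongest.samplesWell_two_of_params hε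
          (PersonalizedCongest.le_one_of_lt_one_div hΔ hεΔ) hL d
    have e : (d : ℝ) ^ max ((2 : ℝ) / 2) 1 = d := by
      rw [div_self two_ne_zero, max_self, Real.rpow_one]
    rwa [e] at h
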